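/- Notation: $M\succ0$ ($M\prec0$) means that the real matrix $M$ is symmetric positive (negative) definite, $|\cdot|$ is the Euclidean norm, $\|x\|_M=\sqrt{x^\top Mx}$ for $M\succ0$, and $\otimes$ is the Kronecker product. If $P\succ0$ and $PG+G^\top P\succ0$, the canonical homogeneous norm of the dilation $\mathbf d(s)=\exp(sG)$ induced by $\|\cdot\|_P$ is $\|0\|_{\mathbf d}=0$ and $\|x\|_{\mathbf d}=e^{s_x}$ for $x\neq0$, where $s_x\in\mathbb R$ is the unique number with $\|\mathbf d(-s_x)x\|_P=1$. Plant, graph, gains. Let $n,N\ge1$, $A\in\mathbb R^{n\times n}$, $B\in\mathbb R^{n\times m}$, $C_i\in\mathbb R^{p_i\times n}$ $(i=1,\dots,N)$, $C=(C_1^\top,\dots,C_N^\top)^\top$, with $(A,C)$ observable, and let $\tilde n$ be the least $k$ such that the rows of $C,CA,\dots,CA^{k-1}$ have rank $n$. Let $(Y_0,G_0)$ satisfy $G_0A-AG_0+Y_0C=-A$, $CG_0=0$, with $I_n+G_0$ invertible, and suppose $L_0:=(I_n+G_0)^{-1}Y_0=0$. For $\mu\in\mathbb R$ put $G_{\mathbf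 d}=\mu G_0+I_n$, $\mathbf d(s)=\exp(sG_{\mathbf d})$. Let $\mathcal G$ be a strongly connected directed graph on $\{1,\dots,N\}$ without self-loops, $a_{ij}=1$ if $(i,j)$ is an edge and $a_{ij}=0$ otherwise, $\mathcal L$ its Laplacian ($l_{ij}=-a_{ij}$ for $i\ne j$, $l_{ii}=\sum_k a_{ik}$), $\zeta$ the left null vector of $\mathcal L$ with $\sum_i\zeta_i=1$, and $\Delta\in\mathbb R^{(N-1)\times(N-1)}$ a matrix whose eigenvalues are, with multiplicity, the nonzero eigenvalues of $\mathcal L$. Let $\rho>0$, let $P_a\in\mathbb R^{n\times n}$ and $Y\in\mathbb R^{n\times p}$, $p=\sum_i p_i$, with $P_a\succ0$ and $(\Delta^\top+\Delta)\otimes P_a\succ0$, and let $H_i=\bar H_i/\zeta_i$, where $(\bar H_1,\dots,\bar H_N)=P_a^{-1}Y$, $\bar H_i\in\mathbb R^{n\times p_i}$. Observer. Consider the unperturbed plant $\dot x=Ax+Bu(t)+\gamma(t,x)$, $y_i=C_ix$, and the observers $$\dot{\hat x}_i=A\hat x_i+Bu+\gamma(t,\hat x_i)+\exp\!\big(\mu(G_0+I_n)\ln|\omega_i|\big)H_i\omega_i+\nu\|\theta_i\|_{\mathbf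 d}^{\mu}\theta_i,\qquad i=1,\dots,N,$$ $\omega_i=C_i\hat x_i-y_i$, $\theta_i=\sum_j a_{ij}(\hat x_j-\hat x_i)$, where $\|\cdot\|_{\mathbf d}$ is induced by $\|\cdot\|_{P_a}$ and the last two terms are read as $0$ when $\omega_i=0$, resp. $\theta_i=0$. Let $e=(\hat x_1-x,\dots,\hat x_N-x)\in\mathbb R^{Nn}$. Let $\|\cdot\|_{\tilde{\mathbf d}}$ be the canonical homogeneous norm of $\tilde{\mathbf d}(s)=I_N\otimes\mathbf d(s)$ induced by $\|\cdot\|_P$, $P=I_N\otimes P_a$. Theorem. There is $\nu_0>0$ such that for every $\nu\ge\nu_0$ there is $\mu_0>0$ with the following property. Let $\mu>-1/\tilde n$, $0<|\mu|<\mu_0$, be such that $$P_a\succ0,\quad P_aG_{\mathbf d}+G_{\mathbf d}^\top P_a\succ0,\quad P_aA+A^\top P_a+YC+C^\top Y^\top+\rho(P_aG_{\mathbf d}+G_{\mathbf d}^\top P_a)\prec0 ,$$ let $0<\tau<\rho/3$, and let $\gamma:\mathbb R\times\mathbb R^n\to\mathbb R^n$ be continuous with $$\big\|\tilde{\mathbf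 d}(-\ln\|\hat x-\tilde x\|_{\tilde{\mathbf d}})\,(\hat\gamma(t,\hat x)-\tilde\gamma(t,x))\big\|_P\le\tau\,\|\hat x-\tilde x\|_{\tilde{\mathbf d}}^{\mu}$$ for all $t>0$, $x\in\mathbb R^n$ and $\hat x=(\hat x_1,\dots,\hat x_N)\in\mathbb R^{Nn}$ with $\hat x\neq\tilde x$, where $\tilde x=\mathbf 1_N\otimes x$, $\hat\gamma(t,\hat x)=(\gamma(t,\hat x_1),\dots,\gamma(t,\hat x_N))$, $\tilde\gamma(t,x)=\mathbf 1_N\otimes\gamma(t,x)$. Then the equation of the error $e$ is forward complete (for every initial value a solution exists, and every solution can be continued as long as the plant trajectory exists), it is Lyapunov stable at $0$, and: 1. if $\mu<0$, it is globally uniformly finite-time stable: there is a locally bounded $T:\mathbb R^{Nn}\to[0,\infty)$ such that $e(t)=0$ for all $t\ge t_0+T(e(t_0))$, and $$T(e(t_0))\le\frac{3}{\mu(3\tau-\rho)}\,\|e(t_0)\|_{\tilde{\mathbf d}}^{-\mu};$$ 2. if $\mu>0$, it is globally uniformly nearly fixed-time stable: for every $r>0$ there is $T_r>0$, independent of the initial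 value, with $\|e(t)\|<r$ for all $t\ge t_0+T_r$. Lyapunov stability and the times $T$, $T_r$ are uniform in the initial time $t_0\ge0$, the control $u$ and the plant trajectory $x$ (and concern every solution). -/

import Mathlib

open scoped Matrix Kronecker Topology

noncomputable section

namespace DistObs

/-! ### Linear algebra: observability, weighted norms, dilations -/

/-- The matrix obtained by stacking the sensor matrices `C i` on top of each other. -/
def stack {n N : ℕ} {p : Fin N → ℕ} (C : ∀ i, Matrix (Fin (p i)) (Fin n) ℝ) :
    Matrix (Σ i, Fin (p i)) (Fin n) ℝ :=
  Matrix.of fun r => C r.1 r.2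

/-- The rows of `C, C A, …, C A^(k-1)`. -/
def obsMatrix {n : ℕ} {ι : Type*} (A : Matrix (Fin n) (Fin n) ℝ) (C : Matrix ι (Fin n) ℝ)
    (k : ℕ) : Matrix (Fin k × ι) (Fin n) ℝ :=
  Matrix.of fun r => (C * A ^ (r.1 : ℕ)) r.2

/-- The pair `(A, C)` is observable (Kalman rank condition). -/
def IsObservable {n : ℕ} {ι : Type*} (A : Matrix (Fin n) (Fin n) ℝ)
    (C : Matrix ι (Fin n) ℝ) : Prop :=
  (obsMatrix A C n).rank = n

/-- The observability index: the least `k` such that `C, C A, …, C A^(k-1)` together have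
rank `n`. -/
def obsIndex {n : ℕ} {ι : Type*} (A : Matrix (Fin n) (Fin n) ℝ)
    (C : Matrix ι (Fin n) ℝ) : ℕ :=
  sInf {k : ℕ | (obsMatrix A C k).rank = n}

/-- The weighted Euclidean norm `‖x‖_P = √(xᵀ P x)`. -/
def weightedNorm {ι : Type*} [Fintype ι] (P : Matrix ι ι ℝ) (x : ι → ℝ) : ℝ :=
  Real.sqrt (x ⬝ᵥ (P *ᵥ x))

/-- The linear dilation `d(s) = exp (s G)` with generator `G`. -/
def dilation {ι : Type*} [Fintype ι] [DecidableEq ι] (G : Matrix ι ι ℝ) (s : ℝ) :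
    Matrix ι ι ℝ :=
  NormedSpace.exp (s • G)

open Classical in
/-- The canonical homogeneous norm of the dilation generated by `G`, induced by `‖·‖_P`:
`‖0‖_d = 0`, and `‖x‖_d = exp s` where `‖d(-s) x‖_P = 1` for `x ≠ 0`
(such an `s` exists and is unique when `P` and `P G + Gᵀ P` are positive definite). -/
def homNorm {ι : Type*} [Fintype ι] [DecidableEq ι] (G P : Matrix ι ι ℝ) (x : ι → ℝ) : ℝ :=
  if h : x ≠ 0 ∧ ∃ s : ℝ, weightedNorm P (dilation G (-s) *ᵥ x) = 1 then
    Real.exp h.2.choose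
  else 0

/-- `Y₀, G₀` solve `G₀ A - A G₀ + Y₀ C = -A`, `C G₀ = 0`, and `I + G₀` is invertible. -/
structure SolvesGeneratorEq {n : ℕ} {ι : Type*} [Fintype ι] (A : Matrix (Fin n) (Fin n) ℝ)
    (C : Matrix ι (Fin n) ℝ) (Y₀ : Matrix (Fin n) ι ℝ) (G₀ : Matrix (Fin n) (Fin n) ℝ) :
    Prop where
  eq_A : G₀ * A - A * G₀ + Y₀ * C = -A
  eq_C : C * G₀ = 0
  isUnit : IsUnit (1 + G₀)

/-- `L₀ = (I + G₀)⁻¹ Y₀`. -/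
def gainL₀ {n : ℕ} {ι : Type*} (Y₀ : Matrix (Fin n) ι ℝ) (G₀ : Matrix (Fin n) (Fin n) ℝ) :
    Matrix (Fin n) ι ℝ :=
  (1 + G₀)⁻¹ * Y₀

/-- The generator `G_d = μ G₀ + I` of the dilation `d`. -/
def genD {n : ℕ} (μ : ℝ) (G₀ : Matrix (Fin n) (Fin n) ℝ) : Matrix (Fin n) (Fin n) ℝ :=
  μ • G₀ + 1

/-- The linear matrix inequalities
`P_a ≻ 0`, `P_a G_d + G_dᵀ P_a ≻ 0` and
`P_a A + Aᵀ P_a + Y C + Cᵀ Yᵀ + ρ (P_a G_d + G_dᵀ P_a) ≺ 0`. -/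
structure HomogeneousLMI {n : ℕ} {ι : Type*} [Fintype ι] (A : Matrix (Fin n) (Fin n) ℝ)
    (C : Matrix ι (Fin n) ℝ) (Gd : Matrix (Fin n) (Fin n) ℝ) (ρ : ℝ)
    (Pa : Matrix (Fin n) (Fin n) ℝ) (Y : Matrix (Fin n) ι ℝ) : Prop where
  posDef : Pa.PosDef
  monotone : (Pa * Gd + Gdᵀ * Pa).PosDef
  stable : (-(Pa * A + Aᵀ * Pa + Y * C + Cᵀ * Yᵀ + ρ • (Pa * Gd + Gdᵀ * Pa))).PosDef

/-! ### The communication graph -/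

open Classical in
/-- `a i j = 1` if `(i, j)` is an edge (node `j` sends information to node `i`),
and `0` otherwise. -/
def adj {N : ℕ} (G : Digraph (Fin N)) (i j : Fin N) : ℝ :=
  if G.Adj i j then 1 else 0

/-- The Laplacian matrix of the graph. -/
def laplacian {N : ℕ} (G : Digraph (Fin N)) : Matrix (Fin N) (Fin N) ℝ :=
  Matrix.of fun i j => if i = j then ∑ k, adj G i k else -adj G i j

/-- Every ordered pair of nodes is joined by a directed path. -/
def StronglyConnected {N : ℕ} (G : Digraph (Fin N)) : Prop :=
  ∀ i j, Relation.ReflTransGen G.Adj i j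

/-! ### Plant, observer, solutions -/

/-- The right-hand side of the unperturbed plant `ẋ = A x + B u(t) + γ(t, x)`. -/
def plantField {n m : ℕ} (A : Matrix (Fin n) (Fin n) ℝ) (B : Matrix (Fin n) (Fin m) ℝ)
    (u : ℝ → Fin m → ℝ) (γ : ℝ → (Fin n → ℝ) → (Fin n → ℝ)) (t : ℝ) (x : Fin n → ℝ) :
    Fin n → ℝ :=
  A *ᵥ x + B *ᵥ u t + γ t x

/-- The observer gain `H_i = H̄_i / ζ_i`, where `(H̄_1, …, H̄_N) = P_a⁻¹ Y`. -/
def gain {n N : ℕ} {p : Fin N → ℕ} (Pa : Matrix (Fin n) (Fin n) ℝ)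
    (Y : Matrix (Fin n) (Σ i, Fin (p i)) ℝ) (ζ : Fin N → ℝ) (i : Fin N) :
    Matrix (Fin n) (Fin (p i)) ℝ :=
  (ζ i)⁻¹ • Matrix.of fun a b => (Pa⁻¹ * Y) a ⟨i, b⟩

/-- `g(r) = exp (μ (G₀ + I) ln r)`. Where `r = |ω| = 0`, it is only ever applied to the zero
vector, which amounts to extending `g(|ω|) H ω` by zero at `ω = 0`. -/
def outputScaling {n : ℕ} (μ : ℝ) (G₀ : Matrix (Fin n) (Fin n) ℝ) (r : ℝ) :
    Matrix (Fin n) (Fin n) ℝ :=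
  NormedSpace.exp ((μ * Real.log r) • (G₀ + 1))

/-- The right-hand side of the homogeneous distributed observer without measurement noise
(`y_i = C_i x`):
`A x̂_i + B u + γ(t, x̂_i) + g(|ω_i|) H_i ω_i + ν ‖θ_i‖_d^μ θ_i`,
`ω_i = C_i x̂_i - y_i`, `θ_i = ∑_j a_ij (x̂_j - x̂_i)`, with `|·|` the Euclidean norm and
`‖·‖_d` induced by `‖·‖_{P_a}`. -/
def observerField {n m N : ℕ} {p : Fin N → ℕ} (A : Matrix (Fin n) (Fin n) ℝ)
    (B : Matrix (Fin n) (Fin m) ℝ) (C : ∀ i, Matrix (Fin (p i)) (Fin n) ℝ)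
    (G : Digraph (Fin N)) (G₀ Pa : Matrix (Fin n) (Fin n) ℝ)
    (H : ∀ i, Matrix (Fin n) (Fin (p i)) ℝ) (μ ν : ℝ)
    (γ : ℝ → (Fin n → ℝ) → (Fin n → ℝ)) (u : ℝ → Fin m → ℝ) (x : ℝ → Fin n → ℝ)
    (t : ℝ) (xh : Fin N → Fin n → ℝ) : Fin N → Fin n → ℝ := fun i =>
  let y : Fin (p i) → ℝ := C i *ᵥ x t
  let ω : Fin (p i) → ℝ := C i *ᵥ xh i - y
  let θ : Fin n → ℝ := ∑ j, adj G i j • (xh j - xh i)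
  A *ᵥ xh i + B *ᵥ u t + γ t (xh i)
    + outputScaling μ G₀ ‖WithLp.toLp 2 ω‖ *ᵥ (H i *ᵥ ω)
    + (ν * homNorm (genD μ G₀) Pa θ ^ μ) • θ

/-- `I` is an interval (of any kind, bounded or not) whose least element is `t₀`. -/
def IsTimeInterval (t₀ : ℝ) (I : Set ℝ) : Prop :=
  IsLeast I t₀ ∧ I.OrdConnected

/-- `x` is a (Carathéodory) solution of `ẋ = F(t, x)` on the interval `I` starting at `t₀`. -/
def IsSolutionOn {V : Type*} [NormedAddCommGroup V] [NormedSpace ℝ V] (F : ℝ → V → V)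
    (t₀ : ℝ) (I : Set ℝ) (x : ℝ → V) : Prop :=
  ContinuousOn x I ∧ ∀ t ∈ I,
    IntervalIntegrable (fun s => F s (x s)) MeasureTheory.volume t₀ t ∧
      x t = x t₀ + ∫ s in t₀..t, F s (x s)

/-! ### Stability of a system given by its trajectories

A system with state space `E` is given by the predicate `S t₀ I e`: "`e` is a trajectory on the
time interval `I`, whose least element is the initial time `t₀`". -/

/-- Lyapunov stability of the origin, uniformly in the initial time and in the trajectory. -/
def LyapunovStable {E : Type*} [NormedAddCommGroup E]
    (S : ℝ → Set ℝ → (ℝ → E) → Prop) : Prop :=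
  ∀ ε > 0, ∃ δ > 0, ∀ t₀ ≥ 0, ∀ I e, S t₀ I e → ‖e t₀‖ < δ → ∀ t ∈ I, ‖e t‖ < ε

/-- `T` is a locally bounded settling-time function: every trajectory vanishes from the time
`T (e t₀)` after its start onwards. -/
def IsSettlingTime {E : Type*} [NormedAddCommGroup E]
    (S : ℝ → Set ℝ → (ℝ → E) → Prop) (T : E → ℝ) : Prop :=
  (∀ e₀, 0 ≤ T e₀) ∧ (∀ e₀, ∃ M, ∀ᶠ e in 𝓝 e₀, T e ≤ M) ∧
    ∀ t₀ ≥ 0, ∀ I e, S t₀ I e → ∀ t ∈ I, t₀ + T (e t₀) ≤ t → e t = 0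

/-- Convergence to every neighbourhood of the origin in a time that does not depend on the
initial value. -/
def NearlyFixedTimeAttractive {E : Type*} [NormedAddCommGroup E]
    (S : ℝ → Set ℝ → (ℝ → E) → Prop) : Prop :=
  ∀ r > 0, ∃ Tr > 0, ∀ t₀ ≥ 0, ∀ I e, S t₀ I e → ∀ t ∈ I, t₀ + Tr ≤ t → ‖e t‖ < r

/-- The trajectories `e = (x̂_1 - x, …, x̂_N - x)` of the estimation error, over all plant
trajectories `x` (with any control `u`) and all trajectories `x̂` of an observer with right-hand
side `obs u x`. -/
def IsErrorTrajectory {n m N : ℕ}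
    (plant : (ℝ → Fin m → ℝ) → ℝ → (Fin n → ℝ) → (Fin n → ℝ))
    (obs : (ℝ → Fin m → ℝ) → (ℝ → Fin n → ℝ) → ℝ → (Fin N → Fin n → ℝ) → (Fin N → Fin n → ℝ))
    (t₀ : ℝ) (I : Set ℝ) (e : ℝ → Fin N → Fin n → ℝ) : Prop :=
  IsTimeInterval t₀ I ∧ ∃ (u : ℝ → Fin m → ℝ) (x : ℝ → Fin n → ℝ) (xh : ℝ → Fin N → Fin n → ℝ),
    IsSolutionOn (plant u) t₀ I x ∧ IsSolutionOn (obs u x) t₀ I xh ∧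
      ∀ t ∈ I, ∀ i, e t i = xh t i - x t

/-- The error equation is forward complete: from every initial value the observer has a
trajectory, and every trajectory of the observer can be continued (to `[t₀, t₁]`) as long as the
plant trajectory exists. The first part is the case `J = {t₀}`. -/
def ErrorForwardComplete {n m N : ℕ}
    (plant : (ℝ → Fin m → ℝ) → ℝ → (Fin n → ℝ) → (Fin n → ℝ))
    (obs : (ℝ → Fin m → ℝ) → (ℝ → Fin n → ℝ) → ℝ → (Fin N → Fin n → ℝ) → (Fin N → Fin n → ℝ)) :
    Prop :=
  ∀ (u : ℝ → Fin m → ℝ) (x : ℝ → Fin n → ℝ) (t₀ t₁ : ℝ), 0 ≤ t₀ → t₀ ≤ t₁ →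
    IsSolutionOn (plant u) t₀ (Set.Icc t₀ t₁) x →
    ∀ (J : Set ℝ) (xh : ℝ → Fin N → Fin n → ℝ), J ⊆ Set.Icc t₀ t₁ → IsTimeInterval t₀ J →
      IsSolutionOn (obs u x) t₀ J xh →
      ∃ xh' : ℝ → Fin N → Fin n → ℝ,
        IsSolutionOn (obs u x) t₀ (Set.Icc t₀ t₁) xh' ∧ Set.EqOn xh' xh J

/-- The error equation is globally uniformly finite-time stable, with a settling-time function
bounded by `bound`. -/
def FiniteTimeStable {n m N : ℕ}
    (plant : (ℝ → Fin m → ℝ) → ℝ → (Fin n → ℝ) → (Fin n → ℝ))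
    (obs : (ℝ → Fin m → ℝ) → (ℝ → Fin n → ℝ) → ℝ → (Fin N → Fin n → ℝ) → (Fin N → Fin n → ℝ))
    (bound : (Fin N → Fin n → ℝ) → ℝ) : Prop :=
  ErrorForwardComplete plant obs ∧ LyapunovStable (IsErrorTrajectory plant obs) ∧
    ∃ T : (Fin N → Fin n → ℝ) → ℝ, IsSettlingTime (IsErrorTrajectory plant obs) T ∧
      ∀ e₀, T e₀ ≤ bound e₀

/-- The error equation is globally uniformly nearly fixed-time stable. -/
def NearlyFixedTimeStable {n m N : ℕ}
    (plant : (ℝ → Fin m → ℝ) → ℝ → (Fin n → ℝ) → (Fin n → ℝ))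
    (obs : (ℝ → Fin m → ℝ) → (ℝ → Fin n → ℝ) → ℝ → (Fin N → Fin n → ℝ) → (Fin N → Fin n → ℝ)) :
    Prop :=
  ErrorForwardComplete plant obs ∧ LyapunovStable (IsErrorTrajectory plant obs) ∧
    NearlyFixedTimeAttractive (IsErrorTrajectory plant obs)

/-! ### The stacked dilation and the condition on the nonlinearity -/

/-- The canonical homogeneous norm `‖e‖_d̃` on `ℝ^{Nn}`: dilation generated by `I_N ⊗ G_d`,
induced by `‖·‖_P`, `P = I_N ⊗ P_a`. -/
def stackedHomNorm {n N : ℕ} (Gd Pa : Matrix (Fin n) (Fin n) ℝ) (e : Fin N → Fin n → ℝ) : ℝ :=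
  homNorm ((1 : Matrix (Fin N) (Fin N) ℝ) ⊗ₖ Gd) ((1 : Matrix (Fin N) (Fin N) ℝ) ⊗ₖ Pa)
    (Function.uncurry e)

/-- The Hölder-type condition on `γ`:
`‖d̃(-ln ‖x̂ - x̃‖_d̃) (γ̂(t, x̂) - γ̃(t, x))‖_P ≤ τ ‖x̂ - x̃‖_d̃ ^ μ` for all `t > 0`, all
`x̂ = (x̂_1, …, x̂_N)` and all `x`, with `x̃ = (x, …, x)`. (Where `x̂ = x̃` it holds trivially,
both sides being nonnegative and the left one zero.) -/
def HolderCondition {n : ℕ} (N : ℕ) (Gd Pa : Matrix (Fin n) (Fin n) ℝ) (μ τ : ℝ)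
    (γ : ℝ → (Fin n → ℝ) → (Fin n → ℝ)) : Prop :=
  ∀ t > 0, ∀ (xh : Fin N → Fin n → ℝ) (x : Fin n → ℝ),
    weightedNorm ((1 : Matrix (Fin N) (Fin N) ℝ) ⊗ₖ Pa)
        (dilation ((1 : Matrix (Fin N) (Fin N) ℝ) ⊗ₖ Gd)
            (-Real.log (stackedHomNorm Gd Pa fun i => xh i - x)) *ᵥ
          Function.uncurry fun i => γ t (xh i) - γ t x)
      ≤ τ * stackedHomNorm Gd Pa (fun i => xh i - x) ^ μ

end DistObs

end

/-!
The error system is homogeneous of degree `μ` with respect to the dilation `exp (s (μ G₀ + 1))`, and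
it is controlled by a single Lyapunov function for all small `μ`.

Let `‖·‖` be the norm of `Pa`, `wᵢ` the error at node `i`, and `V w = ∑ i, ζ i * ‖w i‖ ^ 2`, where
the weights `ζ`, the left null vector of the Laplacian, are positive because the graph is strongly
connected (`isBalancing_of_laplacian`). These weights balance the graph: the linear coupling
`∑ j, a i j • (w j - w i)` contributes to the derivative of `V` minus the weighted sum of
`‖w j - w i‖ ^ 2` over the edges, which vanishes only on the diagonal. On the diagonal the gains
`H i = Hbar i / ζ i` make the weighted sum of the node dynamics equal to the closed loop
`A + Pa⁻¹ Y C`, which the matrix inequality makes dissipative (`sum_inner_closedLoop_le`). By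
compactness of the unit level set of `V`, the field at `μ = 0` is dissipative with rate more than
`ρ / 3` for every sufficiently large `ν` (`ErrorSystem.exists_forall_sum_inner_linField_lt`).

As `μ` tends to `0` the homogeneous field, weighted with the generator of the dilation, tends to the
linear one uniformly on the unit level set, so for fixed `ν` the strict inequality survives for all
small `|μ|`, also with a nonlinearity whose homogeneous size is at most `τ < ρ / 3`
(`ErrorSystem.exists_forall_sum_inner_field_lt`). Since `L₀ = 0` gives `A G₀ - G₀ A = A` and
`C i G₀ = 0`, every term of the error equation is homogeneous, which transports the estimate from
the unit level set to all of its dilates.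

The sets where `V (exp (-s (μ G₀ + 1)) w) ≤ 1` shrink as `s` decreases. An error trajectory that
starts in one of them stays in those whose size `r = exp s` solves `r' = -c r ^ (1 + μ)`,
`c = ρ / 3 - τ`. For `μ < 0` this comparison solution reaches zero at the time
`r₀ ^ (-μ) / (-μ c)`, and for `μ > 0` it is below any given level after a time that does not depend
on `r₀`. As `ζ i ≤ 1`, the initial size is at most the canonical homogeneous norm of the initial error
(`scaledEnergy_log_stackedHomNorm_le`), hence the bound on the settling time.

The field is merely continuous, so solutions come from Peano's theorem, applied to the field with a
cutoff (`exists_solution_of_bounded`). A solution on an interval stays in a sublevel set, where the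
field is bounded, and can therefore be continued (`exists_extension`).
-/

namespace DistObs

open Filter Set MeasureTheory
open scoped RealInnerProductSpace

/-! ### Exponentials in a Banach algebra -/

theorem norm_normedSpaceExp_sub_one_le {R : Type*} [NormedRing R] [NormedAlgebra ℝ R]
    [CompleteSpace R] (x : R) : ‖NormedSpace.exp x - 1‖ ≤ Real.exp ‖x‖ - 1 := by
  have h1 := NormedSpace.exp_series_hasSum_exp' (𝕂 := ℝ) x
  have h2 := NormedSpace.exp_series_hasSum_exp' (𝕂 := ℝ) ‖x‖
  rw [← hasSum_nat_add_iff' 1] at h1 h2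
  simp only [Finset.range_one, Finset.sum_singleton, Nat.factorial_zero, Nat.cast_one, inv_one,
    pow_zero, one_smul] at h1 h2
  rw [← Real.exp_eq_exp_ℝ] at h2
  rw [← h1.tsum_eq]
  refine tsum_of_norm_bounded h2 fun k => ?_
  rw [norm_smul, smul_eq_mul, Real.norm_of_nonneg (by positivity)]
  exact mul_le_mul_of_nonneg_left (norm_pow_le' x (Nat.succ_pos k)) (by positivity)

section NormedSpace

variable {E : Type*} [NormedAddCommGroup E] [NormedSpace ℝ E]

theorem norm_normedSpaceExp_le [CompleteSpace E] (x : E →L[ℝ] E) :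
    ‖NormedSpace.exp x‖ ≤ Real.exp ‖x‖ := by
  have h : ‖(1 : E →L[ℝ] E)‖ ≤ 1 := ContinuousLinearMap.norm_id_le
  calc ‖NormedSpace.exp x‖ = ‖(NormedSpace.exp x - 1) + 1‖ := by rw [sub_add_cancel]
    _ ≤ ‖NormedSpace.exp x - 1‖ + ‖(1 : E →L[ℝ] E)‖ := norm_add_le _ _
    _ ≤ Real.exp ‖x‖ := by linarith [norm_normedSpaceExp_sub_one_le x]

theorem comp_normedSpaceExp_of_comp_eq_zero [CompleteSpace E] {F : Type*} [NormedAddCommGroup F]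
    [NormedSpace ℝ F] (L : E →L[ℝ] F) (M : E →L[ℝ] E) (h : L ∘L M = 0) (x : E) :
    L (NormedSpace.exp M x) = L x := by
  have h1 := NormedSpace.exp_series_hasSum_exp' (𝕂 := ℝ) M
  have h2 : HasSum (fun k : ℕ => L (((k.factorial : ℝ)⁻¹ • M ^ k) x)) (L (NormedSpace.exp M x)) :=
    (h1.mapL (ContinuousLinearMap.apply ℝ E x)).mapL L
  refine h2.unique ?_
  have h3 := hasSum_single (f := fun k : ℕ => L (((k.factorial : ℝ)⁻¹ • M ^ k) x)) 0 ?_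
  · simpa using h3
  · intro k hk
    obtain ⟨j, rfl⟩ := Nat.exists_eq_succ_of_ne_zero hk
    have h4 : L (M ((M ^ j) x)) = 0 := DFunLike.congr_fun h ((M ^ j) x)
    simp only [pow_succ', smul_apply, map_smul, Nat.succ_eq_add_one]
    exact (congrArg _ h4).trans (smul_zero _)

theorem normedSpaceExp_add_of_commute {R : Type*} [NormedRing R] [NormedAlgebra ℝ R]
    [CompleteSpace R] {x y : R} (h : Commute x y) :
    NormedSpace.exp (x + y) = NormedSpace.exp x * NormedSpace.exp y :=
  letI := NormedAlgebra.restrictScalars ℚ ℝ R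
  NormedSpace.exp_add_of_commute h

/-! ### The dilation of a normed space generated by `μ G₀ + 1` -/

/-- The dilation `exp (s (μ G₀ + 1))` of a normed space, for a bounded operator `G₀`. -/
noncomputable def dil (G₀ : E →L[ℝ] E) (μ s : ℝ) : E →L[ℝ] E :=
  NormedSpace.exp (s • (μ • G₀ + 1))

section Dilation

variable (G₀ : E →L[ℝ] E) (μ : ℝ)

@[simp] theorem dil_zero : dil G₀ μ 0 = 1 := by simp [dil]

theorem normedSpaceExp_smul_one (r : ℝ) :
    NormedSpace.exp (r • (1 : E →L[ℝ] E)) = Real.exp r • 1 := by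
  rw [← Algebra.algebraMap_eq_smul_one, ← NormedSpace.algebraMap_exp_comm,
    Algebra.algebraMap_eq_smul_one, Real.exp_eq_exp_ℝ]

variable [CompleteSpace E]

theorem dil_add (s t : ℝ) : dil G₀ μ (s + t) = dil G₀ μ s * dil G₀ μ t := by
  rw [dil, add_smul]
  exact normedSpaceExp_add_of_commute (((Commute.refl _).smul_left s).smul_right t)

theorem dil_dil (s t : ℝ) (x : E) : dil G₀ μ s (dil G₀ μ t x) = dil G₀ μ (s + t) x := by
  rw [dil_add]; rfl

@[simp] theorem dil_neg_dil (s : ℝ) (x : E) : dil G₀ μ (-s) (dil G₀ μ s x) = x := by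
  rw [dil_dil]; simp

@[simp] theorem dil_dil_neg (s : ℝ) (x : E) : dil G₀ μ s (dil G₀ μ (-s) x) = x := by
  rw [dil_dil]; simp

theorem dil_eq (s : ℝ) : dil G₀ μ s = Real.exp s • NormedSpace.exp ((s * μ) • G₀) := by
  have h : Commute ((s * μ) • G₀) (s • (1 : E →L[ℝ] E)) := (Commute.one_right _).smul_right s
  rw [dil, smul_add, smul_smul, normedSpaceExp_add_of_commute h, normedSpaceExp_smul_one]
  simp

theorem norm_dil_apply_le (s : ℝ) (x : E) :
    ‖dil G₀ μ s x‖ ≤ Real.exp (s + |s| * (|μ| * ‖G₀‖)) * ‖x‖ := by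
  rw [dil_eq, Real.exp_add]
  simp only [smul_apply, norm_smul, Real.norm_eq_abs, Real.abs_exp, mul_assoc]
  gcongr
  refine (ContinuousLinearMap.le_opNorm _ _).trans ?_
  gcongr
  refine (norm_normedSpaceExp_le _).trans (le_of_eq ?_)
  rw [norm_smul, Real.norm_eq_abs, abs_mul, mul_assoc]

theorem le_norm_dil_apply (s : ℝ) (x : E) :
    Real.exp (s - |s| * (|μ| * ‖G₀‖)) * ‖x‖ ≤ ‖dil G₀ μ s x‖ := by
  have h := norm_dil_apply_le G₀ μ (-s) (dil G₀ μ s x)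
  rw [dil_neg_dil, abs_neg] at h
  calc _ ≤ Real.exp (s - |s| * (|μ| * ‖G₀‖)) *
        (Real.exp (-s + |s| * (|μ| * ‖G₀‖)) * ‖dil G₀ μ s x‖) := by gcongr
    _ = ‖dil G₀ μ s x‖ := by
      rw [← mul_assoc, ← Real.exp_add]; simp

theorem hasDerivAt_dil (s : ℝ) :
    HasDerivAt (dil G₀ μ) ((μ • G₀ + 1) * dil G₀ μ s) s :=
  hasDerivAt_exp_smul_const' (𝕂 := ℝ) (μ • G₀ + 1) s

theorem continuous_dil : Continuous (dil G₀ μ) :=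
  continuous_iff_continuousAt.2 fun s => (hasDerivAt_dil G₀ μ s).continuousAt

theorem dil_apply_ne_zero {x : E} (hx : x ≠ 0) (s : ℝ) : dil G₀ μ s x ≠ 0 := fun h =>
  hx (by simpa [h] using (dil_neg_dil G₀ μ s x).symm)

variable {G₀ μ}

/-- Where `|μ| ‖G₀‖ < 1`, the dilation contracts strictly as its parameter decreases. -/
theorem norm_dil_neg_lt (hμ : |μ| * ‖G₀‖ ≤ 1 / 2) {x : E} (hx : x ≠ 0) {s t : ℝ} (hst : s < t) :
    ‖dil G₀ μ (-t) x‖ < ‖dil G₀ μ (-s) x‖ := by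
  have h := norm_dil_apply_le G₀ μ (-(t - s)) (dil G₀ μ (-s) x)
  rw [dil_dil, show -(t - s) + -s = -t by ring, abs_neg, abs_of_pos (sub_pos.2 hst)] at h
  refine h.trans_lt ?_
  have h0 : 0 < ‖dil G₀ μ (-s) x‖ := norm_pos_iff.2 (dil_apply_ne_zero G₀ μ hx _)
  have h1 : Real.exp (-(t - s) + (t - s) * (|μ| * ‖G₀‖)) < 1 := by
    rw [Real.exp_lt_one_iff]
    nlinarith [mul_le_mul_of_nonneg_left hμ (sub_pos.2 hst).le]
  nlinarith

theorem exists_norm_dil_eq_one (hμ : |μ| * ‖G₀‖ ≤ 1 / 2) {x : E} (hx : x ≠ 0) :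
    ∃ s : ℝ, ‖dil G₀ μ (-s) x‖ = 1 := by
  have h0 : 0 < ‖x‖ := norm_pos_iff.2 hx
  -- beyond the parameter `a`, the bounds on the dilation force the norm below, resp. above, one
  set a : ℝ := 2 * |Real.log ‖x‖| with ha
  have ha0 : 0 ≤ a := by positivity
  have hlog := Real.exp_log h0
  have h1 : ‖dil G₀ μ (-a) x‖ ≤ 1 := by
    refine (norm_dil_apply_le G₀ μ (-a) x).trans ?_
    rw [← hlog, ← Real.exp_add, Real.exp_le_one_iff, abs_neg, abs_of_nonneg ha0]
    nlinarith [le_abs_self (Real.log ‖x‖)]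
  have h2 : 1 ≤ ‖dil G₀ μ (-(-a)) x‖ := by
    refine le_trans ?_ (le_norm_dil_apply G₀ μ (-(-a)) x)
    rw [neg_neg, ← hlog, ← Real.exp_add, Real.one_le_exp_iff, abs_of_nonneg ha0]
    nlinarith [neg_abs_le (Real.log ‖x‖)]
  have hc : Continuous fun s => ‖dil G₀ μ (-s) x‖ :=
    (((continuous_dil G₀ μ).comp continuous_neg).clm_apply continuous_const).norm
  obtain ⟨s, -, hs⟩ := intermediate_value_Icc' (neg_le_self ha0) hc.continuousOn ⟨h1, h2⟩
  exact ⟨s, hs⟩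

end Dilation

/-! ### The canonical homogeneous norm -/

/-- `N` is the canonical homogeneous norm of the dilation `dil G₀ μ`, induced by the norm of the
space. -/
structure IsHomNorm (G₀ : E →L[ℝ] E) (μ : ℝ) (N : E → ℝ) : Prop where
  map_zero : N 0 = 0
  pos : ∀ {x}, x ≠ 0 → 0 < N x
  norm_eq_one : ∀ {x}, x ≠ 0 → ‖dil G₀ μ (-Real.log (N x)) x‖ = 1

/-- The quantity that controls how far the dilation is from the standard one: `q (q^{±m} - 1)` is
of order `m`, uniformly for bounded `q > 0`. -/
theorem mul_exp_sub_one_le {q Q m : ℝ} (hq : 0 < q) (hQ : q ≤ Q) (hm : 0 ≤ m)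
    (hm' : m ≤ 1 / 2) : q * (Real.exp (m * |Real.log q|) - 1) ≤ m * (2 + Q ^ 3) := by
  have hQ0 : 0 < Q := hq.trans_le hQ
  have key : ∀ y : ℝ, Real.exp y - 1 ≤ y * Real.exp y := fun y => by
    have h := Real.add_one_le_exp (-y)
    have h' : Real.exp (-y) * Real.exp y = 1 := by rw [← Real.exp_add]; simp
    nlinarith [Real.exp_pos y]
  have h1 : q * (Real.exp (m * |Real.log q|) - 1)
      ≤ m * (q * |Real.log q| * Real.exp (|Real.log q| / 2)) := by
    have : Real.exp (m * |Real.log q|) ≤ Real.exp (|Real.log q| / 2) :=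
      Real.exp_le_exp.2 (by nlinarith [abs_nonneg (Real.log q)])
    calc _ ≤ q * (m * |Real.log q| * Real.exp (m * |Real.log q|)) := by gcongr; exact key _
      _ ≤ q * (m * |Real.log q| * Real.exp (|Real.log q| / 2)) := by gcongr
      _ = _ := by ring
  refine h1.trans (mul_le_mul_of_nonneg_left ?_ hm)
  have hexp := Real.exp_log hq
  rcases le_total q 1 with h | h
  · have hl : Real.log q ≤ 0 := Real.log_nonpos hq.le h
    rw [abs_of_nonpos hl]
    have e1 : q = Real.exp (Real.log q / 2) * Real.exp (Real.log q / 2) := by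
      rw [← Real.exp_add, add_halves, hexp]
    have e2 : Real.exp (Real.log q / 2) * Real.exp (-Real.log q / 2) = 1 := by
      rw [← Real.exp_add]; simp [neg_div]
    have e3 := Real.add_one_le_exp (-Real.log q / 2)
    have e4 := Real.exp_pos (Real.log q / 2)
    have e5 : q * -Real.log q * Real.exp (-Real.log q / 2)
        = Real.exp (Real.log q / 2) * -Real.log q := by
      calc _ = (Real.exp (Real.log q / 2) * Real.exp (Real.log q / 2)) * -Real.log q
            * Real.exp (-Real.log q / 2) := by rw [← e1]
        _ = Real.exp (Real.log q / 2) * -Real.log q *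
          (Real.exp (Real.log q / 2) * Real.exp (-Real.log q / 2)) := by ring
        _ = _ := by rw [e2, mul_one]
    rw [e5]
    nlinarith [pow_pos hQ0 3]
  · have hl : 0 ≤ Real.log q := Real.log_nonneg h
    rw [abs_of_nonneg hl]
    have e1 : Real.log q ≤ q := (Real.log_le_sub_one_of_pos hq).trans (by linarith)
    have e2 : Real.exp (Real.log q / 2) ≤ q := by
      conv_rhs => rw [← hexp]
      exact Real.exp_le_exp.2 (by linarith)
    calc q * Real.log q * Real.exp (Real.log q / 2) ≤ q * q * q := by gcongr
      _ = q ^ 3 := by ring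
      _ ≤ Q ^ 3 := by gcongr
      _ ≤ 2 + Q ^ 3 := by linarith

namespace IsHomNorm

variable {G₀ : E →L[ℝ] E} {μ : ℝ} {N : E → ℝ}

theorem nonneg (hN : IsHomNorm G₀ μ N) (x : E) : 0 ≤ N x := by
  rcases eq_or_ne x 0 with rfl | hx
  · exact hN.map_zero.ge
  · exact (hN.pos hx).le

theorem rpow_eq (hN : IsHomNorm G₀ μ N) {x : E} (hx : x ≠ 0) :
    N x ^ μ = Real.exp (μ * Real.log (N x)) := by
  rw [Real.rpow_def_of_pos (hN.pos hx), mul_comm]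

variable [CompleteSpace E]

theorem eq_exp (hN : IsHomNorm G₀ μ N) (hμ : |μ| * ‖G₀‖ ≤ 1 / 2) {x : E} (hx : x ≠ 0) {s : ℝ}
    (hs : ‖dil G₀ μ (-s) x‖ = 1) : N x = Real.exp s := by
  suffices h : Real.log (N x) = s by rw [← h, Real.exp_log (hN.pos hx)]
  have h1 := hN.norm_eq_one hx
  rcases lt_trichotomy (Real.log (N x)) s with h | h | h
  · linarith [norm_dil_neg_lt hμ hx h]
  · exact h
  · linarith [norm_dil_neg_lt hμ hx h]

theorem map_dil (hN : IsHomNorm G₀ μ N) (hμ : |μ| * ‖G₀‖ ≤ 1 / 2) (s : ℝ) (x : E) :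
    N (dil G₀ μ s x) = Real.exp s * N x := by
  rcases eq_or_ne x 0 with rfl | hx
  · simp [hN.map_zero]
  · rw [hN.eq_exp hμ (dil_apply_ne_zero G₀ μ hx s) (s := s + Real.log (N x)), Real.exp_add,
      Real.exp_log (hN.pos hx)]
    rw [dil_dil, ← hN.norm_eq_one hx]
    congr 3; ring

/-- The norm of the space and the homogeneous norm are comparable up to a power close to one. -/
theorem norm_le (hN : IsHomNorm G₀ μ N) {x : E} (hx : x ≠ 0) :
    ‖x‖ ≤ N x * Real.exp (|μ| * ‖G₀‖ * |Real.log (N x)|) := by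
  have h := norm_dil_apply_le G₀ μ (Real.log (N x)) (dil G₀ μ (-Real.log (N x)) x)
  rw [dil_dil_neg, hN.norm_eq_one hx, mul_one, Real.exp_add, Real.exp_log (hN.pos hx)] at h
  rwa [mul_comm (|μ| * ‖G₀‖)]

theorem le_norm (hN : IsHomNorm G₀ μ N) {x : E} (hx : x ≠ 0) :
    N x * Real.exp (-(|μ| * ‖G₀‖ * |Real.log (N x)|)) ≤ ‖x‖ := by
  have h := le_norm_dil_apply G₀ μ (Real.log (N x)) (dil G₀ μ (-Real.log (N x)) x)
  rw [dil_dil_neg, hN.norm_eq_one hx, mul_one, sub_eq_add_neg, Real.exp_add,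
    Real.exp_log (hN.pos hx)] at h
  rwa [mul_comm (|μ| * ‖G₀‖)]

theorem le_one_add_sq (hN : IsHomNorm G₀ μ N) (hμ : |μ| * ‖G₀‖ ≤ 1 / 2) (x : E) :
    N x ≤ 1 + ‖x‖ ^ 2 := by
  rcases le_total (N x) 1 with h | h
  · nlinarith [sq_nonneg ‖x‖]
  · have hx : x ≠ 0 := by rintro rfl; rw [hN.map_zero] at h; linarith
    have h1 := hN.le_norm hx
    have h0 := hN.pos hx
    have hl : 0 ≤ Real.log (N x) := Real.log_nonneg h
    have h2 : Real.exp (Real.log (N x) / 2) ≤ ‖x‖ := by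
      refine le_trans ?_ h1
      conv_rhs => rw [← Real.exp_log h0, Real.log_exp]
      rw [← Real.exp_add]
      refine Real.exp_le_exp.2 ?_
      rw [abs_of_nonneg hl]
      nlinarith
    have h3 : Real.exp (Real.log (N x) / 2) ^ 2 = N x := by
      rw [← Real.exp_nat_mul, Nat.cast_two, mul_div_cancel₀ _ (two_ne_zero), Real.exp_log h0]
    have h4 : Real.exp (Real.log (N x) / 2) ^ 2 ≤ ‖x‖ ^ 2 := by gcongr
    linarith

/-- `‖x‖_d^μ x` tends to `x` as `μ → 0`, uniformly on bounded sets. -/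
theorem norm_rpow_smul_sub_le (hN : IsHomNorm G₀ μ N) (hμ : |μ| * (‖G₀‖ + 1) ≤ 1 / 2) {R : ℝ}
    {x : E} (hx : ‖x‖ ≤ R) :
    ‖N x ^ μ • x - x‖ ≤ |μ| * ((‖G₀‖ + 1) * (2 + (1 + R ^ 2) ^ 3)) := by
  have hR : 0 ≤ R := (norm_nonneg x).trans hx
  rcases eq_or_ne x 0 with rfl | hx0
  · simp; positivity
  have hμ' : |μ| * ‖G₀‖ ≤ 1 / 2 := by nlinarith [abs_nonneg μ]
  have hq := hN.pos hx0
  have hQ : N x ≤ 1 + R ^ 2 :=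
    (hN.le_one_add_sq hμ' x).trans (by gcongr)
  have h1 := mul_exp_sub_one_le hq hQ (by positivity) hμ
  set q := N x
  set l := |Real.log q|
  have hl : 0 ≤ l := abs_nonneg _
  have h2 : |q ^ μ - 1| ≤ Real.exp (|μ| * l) - 1 := by
    rw [hN.rpow_eq hx0]
    have hml : |μ * Real.log q| = |μ| * l := abs_mul _ _
    have := norm_normedSpaceExp_sub_one_le (μ * Real.log q)
    rw [← Real.exp_eq_exp_ℝ] at this
    simpa [hml] using this
  have h3 := hN.norm_le hx0
  calc ‖q ^ μ • x - x‖ = |q ^ μ - 1| * ‖x‖ := by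
        rw [← Real.norm_eq_abs, ← norm_smul, sub_smul, one_smul]
    _ ≤ (Real.exp (|μ| * l) - 1) * (q * Real.exp (|μ| * ‖G₀‖ * l)) := by
        gcongr
        exact (abs_nonneg _).trans h2
    _ = q * (Real.exp (|μ| * (‖G₀‖ + 1) * l) - Real.exp (|μ| * ‖G₀‖ * l)) := by
        rw [show |μ| * (‖G₀‖ + 1) * l = |μ| * l + |μ| * ‖G₀‖ * l by ring, Real.exp_add]; ring
    _ ≤ q * (Real.exp (|μ| * (‖G₀‖ + 1) * l) - 1) := by
        gcongr
        exact Real.one_le_exp (by positivity)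
    _ ≤ _ := by linarith

/-- A vector `δ` that is small relative to `x` in the homogeneous sense is small relative to `x` in
the norm of the space, with almost the same constant. -/
theorem norm_le_of_norm_dil_le (hN : IsHomNorm G₀ μ N) (hμ0 : μ ≠ 0)
    (hμ : |μ| * (‖G₀‖ + 1) ≤ 1 / 2) {R τ : ℝ} (hτ : 0 ≤ τ) {x δ : E} (hx : ‖x‖ ≤ R)
    (hδ : ‖dil G₀ μ (-Real.log (N x)) δ‖ ≤ τ * N x ^ μ) :
    ‖δ‖ ≤ τ * ‖x‖ + τ * (|μ| * (2 * (‖G₀‖ + 1) * (2 + (1 + R ^ 2) ^ 3))) := by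
  have hR : 0 ≤ R := (norm_nonneg x).trans hx
  rcases eq_or_ne x 0 with rfl | hx0
  · rw [hN.map_zero, Real.zero_rpow hμ0] at hδ
    have : ‖δ‖ ≤ 0 := by simpa using hδ
    refine this.trans ?_
    simp; positivity
  have hμ' : |μ| * ‖G₀‖ ≤ 1 / 2 := by nlinarith [abs_nonneg μ]
  have hq := hN.pos hx0
  have hQ : N x ≤ 1 + R ^ 2 := (hN.le_one_add_sq hμ' x).trans (by gcongr)
  have h1 := mul_exp_sub_one_le hq hQ (by positivity) hμ
  have h2 := hN.le_norm hx0
  rw [hN.rpow_eq hx0] at hδ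
  have h3 := norm_dil_apply_le G₀ μ (Real.log (N x)) (dil G₀ μ (-Real.log (N x)) δ)
  rw [dil_dil_neg, Real.exp_add, Real.exp_log hq] at h3
  set q := N x
  set l := |Real.log q|
  have hl : 0 ≤ l := abs_nonneg _
  set a := |μ| * (‖G₀‖ + 1) * l
  have ha : 0 ≤ a := by positivity
  have h4 : ‖δ‖ ≤ τ * (q * Real.exp a) := by
    calc ‖δ‖ ≤ q * Real.exp (l * (|μ| * ‖G₀‖)) * (τ * Real.exp (μ * Real.log q)) :=
          h3.trans (by gcongr)
      _ ≤ q * Real.exp (l * (|μ| * ‖G₀‖)) * (τ * Real.exp (|μ| * l)) := by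
          have : μ * Real.log q ≤ |μ| * l := (le_abs_self _).trans (abs_mul _ _).le
          gcongr
      _ = τ * (q * Real.exp a) := by
          rw [show a = l * (|μ| * ‖G₀‖) + |μ| * l by ring, Real.exp_add]; ring
  have h5 : q * Real.exp (-a) ≤ ‖x‖ := by
    refine le_trans ?_ h2
    gcongr
    nlinarith [mul_nonneg (abs_nonneg μ) hl]
  have h6 : Real.exp a - Real.exp (-a) ≤ 2 * (Real.exp a - 1) := by
    have e1 : Real.exp a * Real.exp (-a) = 1 := by rw [← Real.exp_add]; simp
    nlinarith [Real.exp_pos a, Real.exp_pos (-a), sq_nonneg (Real.exp a - 1)]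
  have h7 : q * Real.exp a ≤ ‖x‖ + 2 * (q * (Real.exp a - 1)) := by nlinarith
  calc ‖δ‖ ≤ τ * (q * Real.exp a) := h4
    _ ≤ τ * (‖x‖ + 2 * (|μ| * (‖G₀‖ + 1) * (2 + (1 + R ^ 2) ^ 3))) := by
        gcongr; linarith
    _ = _ := by ring

theorem abs_log_le (hN : IsHomNorm G₀ μ N) (hμ : |μ| * ‖G₀‖ ≤ 1 / 2) {x : E} (hx : x ≠ 0) :
    |Real.log (N x)| ≤ 2 * |Real.log ‖x‖| := by
  have h0 := hN.pos hx
  have hx0 : 0 < ‖x‖ := norm_pos_iff.2 hx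
  have h1 := Real.log_le_log hx0 (hN.norm_le hx)
  have h2 := Real.log_le_log (by positivity) (hN.le_norm hx)
  rw [Real.log_mul h0.ne' (Real.exp_pos _).ne', Real.log_exp] at h1 h2
  have h3 := mul_le_mul_of_nonneg_right hμ (abs_nonneg (Real.log (N x)))
  have h4 := le_abs_self (Real.log ‖x‖)
  have h5 := neg_abs_le (Real.log ‖x‖)
  rcases abs_cases (Real.log (N x)) with ⟨h, -⟩ | ⟨h, -⟩ <;> linarith

theorem continuousAt_log (hN : IsHomNorm G₀ μ N) (hμ : |μ| * ‖G₀‖ ≤ 1 / 2) {x : E}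
    (hx : x ≠ 0) : ContinuousAt (fun y => Real.log (N y)) x := by
  have hc : ∀ s, Continuous fun y => ‖dil G₀ μ s y‖ := fun s => (dil G₀ μ s).continuous.norm
  have hx1 := hN.norm_eq_one hx
  rw [Metric.continuousAt_iff']
  intro ε hε
  have h1 : ∀ᶠ y in 𝓝 x, 1 < ‖dil G₀ μ (-(Real.log (N x) - ε)) y‖ :=
    (hc _).continuousAt.eventually_const_lt
      (by rw [← hx1]; exact norm_dil_neg_lt hμ hx (by linarith))
  have h2 : ∀ᶠ y in 𝓝 x, ‖dil G₀ μ (-(Real.log (N x) + ε)) y‖ < 1 :=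
    (hc _).continuousAt.eventually_lt_const
      (by rw [← hx1]; exact norm_dil_neg_lt hμ hx (by linarith))
  filter_upwards [h1, h2, isOpen_ne.mem_nhds hx] with y hy1 hy2 hy
  have hy3 := hN.norm_eq_one hy
  rw [Real.dist_eq, abs_lt]
  constructor
  · by_contra! h
    rcases h.lt_or_eq with h | h
    · linarith [norm_dil_neg_lt hμ hy (show Real.log (N y) < Real.log (N x) - ε by linarith)]
    · rw [show Real.log (N x) - ε = Real.log (N y) by linarith] at hy1; linarith
  · by_contra! h
    rcases h.lt_or_eq with h | h
    · linarith [norm_dil_neg_lt hμ hy (show Real.log (N x) + ε < Real.log (N y) by linarith)]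
    · rw [show Real.log (N x) + ε = Real.log (N y) by linarith] at hy2; linarith

end IsHomNorm

/-- Growth at most `‖x‖ exp (|ln ‖x‖| / 2)`, that is `√‖x‖` near the origin, gives continuity at
the origin. -/
theorem continuousAt_zero_of_norm_le {X F : Type*} [NormedAddCommGroup X]
    [NormedAddCommGroup F] {f : X → F} {K : ℝ} (h0 : f 0 = 0)
    (h : ∀ x, x ≠ 0 → ‖f x‖ ≤ K * (‖x‖ * Real.exp (|Real.log ‖x‖| / 2))) :
    ContinuousAt f 0 := by
  have hlim : Tendsto (fun x : X => |K| * Real.sqrt ‖x‖) (𝓝 0) (𝓝 0) := by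
    have : Continuous fun x : X => |K| * Real.sqrt ‖x‖ := by fun_prop
    simpa using this.tendsto 0
  rw [ContinuousAt, h0]
  refine squeeze_zero_norm' ?_ hlim
  filter_upwards [Metric.ball_mem_nhds (0 : X) one_pos] with x hx
  rcases eq_or_ne x 0 with rfl | hx0
  · simp [h0]
  have hx1 : 0 < ‖x‖ := norm_pos_iff.2 hx0
  have hx2 : ‖x‖ < 1 := by simpa using hx
  refine (h x hx0).trans ?_
  have e : ‖x‖ * Real.exp (|Real.log ‖x‖| / 2) = Real.sqrt ‖x‖ := by
    rw [abs_of_neg (Real.log_neg hx1 hx2), Real.sqrt_eq_rpow, Real.rpow_def_of_pos hx1]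
    conv_lhs => rw [← Real.exp_log hx1, Real.log_exp, ← Real.exp_add]
    congr 1; ring
  rw [e]
  gcongr
  exact le_abs_self K

theorem IsHomNorm.continuous_rpow_smul [CompleteSpace E] {G₀ : E →L[ℝ] E} {μ : ℝ} {N : E → ℝ}
    (hN : IsHomNorm G₀ μ N) (hμ : |μ| * ‖G₀‖ ≤ 1 / 2) (hμ' : |μ| ≤ 1 / 4) :
    Continuous fun x => N x ^ μ • x := by
  rw [continuous_iff_continuousAt]
  intro x
  rcases eq_or_ne x 0 with rfl | hx
  · refine continuousAt_zero_of_norm_le (K := 1) (by simp) fun x hx => ?_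
    rw [hN.rpow_eq hx, norm_smul, Real.norm_eq_abs, Real.abs_exp, one_mul, mul_comm]
    have h : μ * Real.log (N x) ≤ |Real.log ‖x‖| / 2 :=
      calc μ * Real.log (N x) ≤ |μ| * |Real.log (N x)| := (le_abs_self _).trans (abs_mul _ _).le
        _ ≤ 1 / 4 * (2 * |Real.log ‖x‖|) := by gcongr; exact hN.abs_log_le hμ hx
        _ = _ := by ring
    gcongr
  · have h : ContinuousAt (fun y => Real.exp (μ * Real.log (N y)) • y) x :=
      (((hN.continuousAt_log hμ hx).const_mul μ).rexp).smul continuousAt_id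
    refine h.congr ?_
    filter_upwards [isOpen_ne.mem_nhds hx] with y hy
    rw [hN.rpow_eq hy]

/-! ### Output injection with a dilated gain -/

section OutputInjection

variable [CompleteSpace E] {F : Type*} [NormedAddCommGroup F] [NormedSpace ℝ F]
  (M : E →L[ℝ] E) (H : F →L[ℝ] E)

theorem norm_exp_log_smul_sub_le {μ R : ℝ} (hμ : |μ| * ‖M‖ ≤ 1 / 2) {ω : F} (hω : ‖ω‖ ≤ R) :
    ‖NormedSpace.exp ((μ * Real.log ‖ω‖) • M) (H ω) - H ω‖ ≤ |μ| * (‖M‖ * (2 + R ^ 3) * ‖H‖) := by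
  have hR : 0 ≤ R := (norm_nonneg ω).trans hω
  rcases eq_or_ne ω 0 with rfl | hω0
  · simp; positivity
  have h1 := mul_exp_sub_one_le (norm_pos_iff.2 hω0) hω (by positivity) hμ
  have h2 := norm_normedSpaceExp_sub_one_le ((μ * Real.log ‖ω‖) • M)
  rw [norm_smul, Real.norm_eq_abs, abs_mul, mul_right_comm] at h2
  calc _ = ‖(NormedSpace.exp ((μ * Real.log ‖ω‖) • M) - 1) (H ω)‖ := rfl
    _ ≤ (Real.exp (|μ| * ‖M‖ * |Real.log ‖ω‖|) - 1) * (‖H‖ * ‖ω‖) :=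
        (ContinuousLinearMap.le_opNorm _ _).trans (mul_le_mul h2 (H.le_opNorm ω) (norm_nonneg _)
          ((norm_nonneg _).trans h2))
    _ = ‖H‖ * (‖ω‖ * (Real.exp (|μ| * ‖M‖ * |Real.log ‖ω‖|) - 1)) := by ring
    _ ≤ ‖H‖ * (|μ| * ‖M‖ * (2 + R ^ 3)) := by gcongr
    _ = _ := by ring

theorem continuous_exp_log_smul {μ : ℝ} (hμ : |μ| * ‖M‖ ≤ 1 / 2) :
    Continuous fun ω : F => NormedSpace.exp ((μ * Real.log ‖ω‖) • M) (H ω) := by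
  rw [continuous_iff_continuousAt]
  intro ω
  rcases eq_or_ne ω 0 with rfl | hω
  · refine continuousAt_zero_of_norm_le (K := ‖H‖) (by simp) fun ω hω => ?_
    have h2 := norm_normedSpaceExp_le ((μ * Real.log ‖ω‖) • M)
    rw [norm_smul, Real.norm_eq_abs, abs_mul, mul_right_comm] at h2
    calc _ ≤ Real.exp (|μ| * ‖M‖ * |Real.log ‖ω‖|) * (‖H‖ * ‖ω‖) :=
          (ContinuousLinearMap.le_opNorm _ _).trans (mul_le_mul h2 (H.le_opNorm ω) (norm_nonneg _)
            (Real.exp_pos _).le)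
      _ ≤ Real.exp (1 / 2 * |Real.log ‖ω‖|) * (‖H‖ * ‖ω‖) := by gcongr
      _ = _ := by rw [one_div_mul_eq_div]; ring
  · have h1 : ContinuousAt (fun ω : F => (μ * Real.log ‖ω‖) • M) ω :=
      ((continuous_norm.continuousAt.log (norm_ne_zero_iff.2 hω)).const_mul μ).smul
        continuousAt_const
    have h2 : Continuous (NormedSpace.exp : (E →L[ℝ] E) → (E →L[ℝ] E)) :=
      continuous_iff_continuousAt.2 fun x =>
        ((NormedSpace.exp_analytic (𝕂 := ℝ) x).continuousAt)
    exact (h2.continuousAt.comp h1).clm_apply H.continuous.continuousAt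

end OutputInjection

end NormedSpace

/-! ### The error system on an inner product space -/

/-- The data of the estimation error system of a network of observers, on a normed space `E`: the
drift `A`, the operator `G₀` that generates the dilations, the output operators `C i` of the nodes,
their gains `H i` and the weights `a i j` of the network. The two identities make the error field
homogeneous with respect to the dilations. -/
structure ErrorSystem (ι E : Type*) (F : ι → Type*) [NormedAddCommGroup E] [NormedSpace ℝ E]
    [∀ i, NormedAddCommGroup (F i)] [∀ i, NormedSpace ℝ (F i)] where
  A : E →L[ℝ] E
  G₀ : E →L[ℝ] E
  C : ∀ i, E →L[ℝ] F i
  H : ∀ i, F i →L[ℝ] E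
  a : ι → ι → ℝ
  comm : A * G₀ - G₀ * A = A
  output : ∀ i, C i ∘L G₀ = 0

namespace ErrorSystem

section Field

variable {ι E : Type*} {F : ι → Type*} [NormedAddCommGroup E] [NormedSpace ℝ E]
  [∀ i, NormedAddCommGroup (F i)] [∀ i, NormedSpace ℝ (F i)] (S : ErrorSystem ι E F)

section Homogeneity

variable [CompleteSpace E]

theorem A_dil (μ s : ℝ) (x : E) :
    S.A (dil S.G₀ μ s x) = Real.exp (μ * s) • dil S.G₀ μ s (S.A x) := by
  have h1 : SemiconjBy S.A (s • (μ • S.G₀ + 1)) (s • (μ • S.G₀ + 1) + (μ * s) • 1) := by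
    have h : S.A * S.G₀ = S.G₀ * S.A + S.A := by
      rw [← sub_eq_iff_eq_add', S.comm]
    simp only [SemiconjBy, mul_smul_comm, mul_add, h, mul_one, add_mul, smul_mul_assoc, one_mul]
    module
  have h2 : SemiconjBy S.A (NormedSpace.exp (s • (μ • S.G₀ + 1)))
      (NormedSpace.exp (s • (μ • S.G₀ + 1) + (μ * s) • 1)) :=
    letI := NormedAlgebra.restrictScalars ℚ ℝ (E →L[ℝ] E)
    h1.exp_right
  rw [normedSpaceExp_add_of_commute ((Commute.one_right _).smul_right _),
    normedSpaceExp_smul_one] at h2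
  have h3 := DFunLike.congr_fun h2.eq x
  simpa [dil] using h3

theorem C_dil (μ s : ℝ) (i : ι) (x : E) :
    S.C i (dil S.G₀ μ s x) = Real.exp s • S.C i x := by
  rw [dil_eq, smul_apply, map_smul, comp_normedSpaceExp_of_comp_eq_zero]
  rw [ContinuousLinearMap.comp_smul, S.output, smul_zero]

theorem exp_smul_dil (μ s : ℝ) (x : E) :
    NormedSpace.exp ((μ * s) • (S.G₀ + 1)) (Real.exp s • x)
      = Real.exp (μ * s) • dil S.G₀ μ s x := by
  rw [smul_add, normedSpaceExp_add_of_commute (((Commute.one_right _).smul_right _)),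
    normedSpaceExp_smul_one, dil_eq, mul_comm s μ]
  simp [smul_comm (Real.exp s)]

end Homogeneity

variable [Fintype ι]

/-- The disagreement `θ_i = ∑_j a_ij (z_j - z_i)` of node `i` with its neighbours. -/
def disagreement (z : ι → E) (i : ι) : E := ∑ j, S.a i j • (z j - z i)

/-- The error field without the nonlinearity of the plant, of homogeneity degree `μ`; `Nm` stands
for the canonical homogeneous norm. -/
noncomputable def field (μ ν : ℝ) (Nm : E → ℝ) (z : ι → E) (i : ι) : E :=
  S.A (z i) + NormedSpace.exp ((μ * Real.log ‖S.C i (z i)‖) • (S.G₀ + 1)) (S.H i (S.C i (z i)))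
    + (ν * Nm (S.disagreement z i) ^ μ) • S.disagreement z i

/-- The linear error field, obtained for `μ = 0`. -/
def linField (ν : ℝ) (z : ι → E) (i : ι) : E :=
  S.A (z i) + S.H i (S.C i (z i)) + ν • S.disagreement z i

theorem continuous_disagreement (i : ι) : Continuous fun z => S.disagreement z i := by
  unfold disagreement; fun_prop

theorem norm_disagreement_le {R : ℝ} {z : ι → E} (hz : ∀ i, ‖z i‖ ≤ R) (i : ι) :
    ‖S.disagreement z i‖ ≤ ∑ j, |S.a i j| * (2 * R) := by
  refine norm_sum_le_of_le _ fun j _ => ?_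
  rw [norm_smul, Real.norm_eq_abs]
  gcongr
  linarith [norm_sub_le (z j) (z i), hz i, hz j]

theorem disagreement_dil (μ s : ℝ) (z : ι → E) (i : ι) :
    S.disagreement (fun i => dil S.G₀ μ s (z i)) i = dil S.G₀ μ s (S.disagreement z i) := by
  simp [disagreement, map_sum]

variable [CompleteSpace E]

/-- Homogeneity of the error field. -/
theorem field_dil {μ ν : ℝ} {Nm : E → ℝ} (hN : IsHomNorm S.G₀ μ Nm) (hμ : |μ| * ‖S.G₀‖ ≤ 1 / 2)
    (s : ℝ) (z : ι → E) (i : ι) :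
    S.field μ ν Nm (fun i => dil S.G₀ μ s (z i)) i
      = Real.exp (μ * s) • dil S.G₀ μ s (S.field μ ν Nm z i) := by
  have h1 : NormedSpace.exp ((μ * Real.log ‖S.C i (dil S.G₀ μ s (z i))‖) • (S.G₀ + 1))
      (S.H i (S.C i (dil S.G₀ μ s (z i)))) = Real.exp (μ * s) • dil S.G₀ μ s
        (NormedSpace.exp ((μ * Real.log ‖S.C i (z i)‖) • (S.G₀ + 1)) (S.H i (S.C i (z i)))) := by
    rw [C_dil]
    rcases eq_or_ne (S.C i (z i)) 0 with h | h
    · simp [h]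
    · have hl : Real.log ‖Real.exp s • S.C i (z i)‖ = s + Real.log ‖S.C i (z i)‖ := by
        rw [norm_smul, Real.norm_eq_abs, Real.abs_exp, Real.log_mul (Real.exp_pos _).ne'
          (norm_ne_zero_iff.2 h), Real.log_exp]
      rw [hl, mul_add, add_smul, normedSpaceExp_add_of_commute
        (((Commute.refl _).smul_left _).smul_right _), ← exp_smul_dil, map_smul,
        mul_apply_eq_comp, map_smul _ (Real.exp s)]
  have h2 : Nm (S.disagreement (fun i => dil S.G₀ μ s (z i)) i) ^ μ
      = Real.exp (μ * s) * Nm (S.disagreement z i) ^ μ := by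
    rw [disagreement_dil, hN.map_dil hμ, Real.mul_rpow (Real.exp_pos _).le (hN.nonneg _),
      ← Real.exp_mul, mul_comm s]
  simp only [field]
  rw [h1, h2, A_dil, disagreement_dil]
  simp only [map_add, map_smul, smul_add, smul_smul]
  congr 2
  ring

theorem continuous_field {μ ν : ℝ} {Nm : E → ℝ} (hN : IsHomNorm S.G₀ μ Nm)
    (hμ : |μ| * (‖S.G₀‖ + 1) ≤ 1 / 4) : Continuous (S.field μ ν Nm) := by
  have h0 : 0 ≤ |μ| * ‖S.G₀‖ := by positivity
  have h1 : |μ| * ‖S.G₀ + 1‖ ≤ 1 / 2 := by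
    have : ‖S.G₀ + 1‖ ≤ ‖S.G₀‖ + 1 :=
      (norm_add_le _ _).trans (by gcongr; exact ContinuousLinearMap.norm_id_le)
    nlinarith [mul_le_mul_of_nonneg_left this (abs_nonneg μ)]
  refine continuous_pi fun i => ?_
  have h2 : Continuous fun z : ι → E =>
      NormedSpace.exp ((μ * Real.log ‖S.C i (z i)‖) • (S.G₀ + 1)) (S.H i (S.C i (z i))) :=
    (continuous_exp_log_smul (S.G₀ + 1) (S.H i) h1).comp (g := fun ω => NormedSpace.exp
      ((μ * Real.log ‖ω‖) • (S.G₀ + 1)) (S.H i ω)) (by fun_prop : Continuous fun z : ι → E =>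
        S.C i (z i))
  have h3 := (hN.continuous_rpow_smul (by nlinarith [abs_nonneg μ])
    (by nlinarith [abs_nonneg μ])).comp (S.continuous_disagreement i)
  have h4 : Continuous fun z : ι → E => S.A (z i) := by fun_prop
  refine ((h4.add h2).add (h3.const_smul ν)).congr fun z => ?_
  simp [field, mul_smul]

/-- The error field tends to the linear one as `μ → 0`, uniformly on bounded sets. -/
theorem exists_norm_field_sub_linField_le (ν : ℝ) {R : ℝ} (hR : 0 ≤ R) :
    ∃ K, 0 ≤ K ∧ ∀ (μ : ℝ) (Nm : E → ℝ), |μ| * (‖S.G₀‖ + 1) ≤ 1 / 2 → IsHomNorm S.G₀ μ Nm →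
      ∀ z : ι → E, (∀ i, ‖z i‖ ≤ R) →
        ∀ i, ‖S.field μ ν Nm z i - S.linField ν z i‖ ≤ |μ| * K := by
  set k : ι → ℝ := fun i => ‖S.G₀ + 1‖ * (2 + (‖S.C i‖ * R) ^ 3) * ‖S.H i‖
    + |ν| * ((‖S.G₀‖ + 1) * (2 + (1 + (∑ j, |S.a i j| * (2 * R)) ^ 2) ^ 3)) with hk
  have hk0 : ∀ i, 0 ≤ k i := fun i => by positivity
  refine ⟨∑ i, k i, Finset.sum_nonneg fun i _ => hk0 i, fun μ Nm hμ hN z hz i => ?_⟩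
  refine le_trans ?_ (mul_le_mul_of_nonneg_left
    (Finset.single_le_sum (fun j _ => hk0 j) (Finset.mem_univ i)) (abs_nonneg μ))
  have h1 : |μ| * ‖S.G₀ + 1‖ ≤ 1 / 2 := by
    refine le_trans (mul_le_mul_of_nonneg_left ?_ (abs_nonneg μ)) hμ
    exact (norm_add_le _ _).trans (by gcongr; exact ContinuousLinearMap.norm_id_le)
  have h2 := norm_exp_log_smul_sub_le (S.G₀ + 1) (S.H i) h1 (ω := S.C i (z i)) (R := ‖S.C i‖ * R)
    ((ContinuousLinearMap.le_opNorm _ _).trans (by gcongr; exact hz i))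
  have h3 := hN.norm_rpow_smul_sub_le hμ (S.norm_disagreement_le hz i)
  have e : S.field μ ν Nm z i - S.linField ν z i
      = (NormedSpace.exp ((μ * Real.log ‖S.C i (z i)‖) • (S.G₀ + 1)) (S.H i (S.C i (z i)))
        - S.H i (S.C i (z i)))
      + ν • (Nm (S.disagreement z i) ^ μ • S.disagreement z i - S.disagreement z i) := by
    simp only [field, linField]; module
  rw [e]
  calc _ ≤ _ := norm_add_le _ _
    _ ≤ _ := add_le_add h2 (le_of_eq_of_le (norm_smul _ _)
      (mul_le_mul_of_nonneg_left h3 (norm_nonneg ν)))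
    _ = |μ| * k i := by rw [hk, Real.norm_eq_abs]; ring

end Field

/-! ### The weighted Lyapunov function -/

section Energy

variable {ι E : Type*} [Fintype ι] [NormedAddCommGroup E]

/-- `ζ` is a positive left null vector, normalized to sum `1`, of the Laplacian of a strongly
connected network with nonnegative weights. -/
structure IsBalancing (a : ι → ι → ℝ) (ζ : ι → ℝ) : Prop where
  nonneg : ∀ i j, 0 ≤ a i j
  pos : ∀ i, 0 < ζ i
  sum_eq_one : ∑ i, ζ i = 1
  balance : ∀ j, ∑ i, ζ i * a i j = ζ j * ∑ k, a j k
  connected : ∀ i j, Relation.ReflTransGen (fun i j => 0 < a i j) i j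

/-- The weighted energy `∑_i ζ_i |z_i|²`. -/
def energy (ζ : ι → ℝ) (z : ι → E) : ℝ := ∑ i, ζ i * ‖z i‖ ^ 2

theorem continuous_energy (ζ : ι → ℝ) : Continuous (energy ζ : (ι → E) → ℝ) := by
  unfold energy; fun_prop

theorem norm_le_of_energy_le_one {ζ : ι → ℝ} (hζ : ∀ i, 0 < ζ i) {z : ι → E}
    (hz : energy ζ z ≤ 1) (i : ι) :
    ‖z i‖ ≤ 1 + ∑ j, (ζ j)⁻¹ := by
  have h1 : ζ i * ‖z i‖ ^ 2 ≤ 1 := le_trans (Finset.single_le_sum (f := fun i => ζ i * ‖z i‖ ^ 2)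
    (fun j _ => mul_nonneg (hζ j).le (sq_nonneg _)) (Finset.mem_univ i)) hz
  have h2 : (ζ i)⁻¹ ≤ ∑ j, (ζ j)⁻¹ :=
    Finset.single_le_sum (fun j _ => (inv_pos.2 (hζ j)).le) (Finset.mem_univ i)
  have h3 : ‖z i‖ ^ 2 ≤ (ζ i)⁻¹ := by
    rwa [← one_div, le_div_iff₀' (hζ i)]
  nlinarith [sq_nonneg (‖z i‖ - 1)]

/-- On a compact set, a sufficiently large multiple of a nonnegative penalty makes negative every
continuous function that is negative where the penalty vanishes. -/
theorem exists_forall_sub_mul_lt_zero {X : Type*} [TopologicalSpace X] {K : Set X}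
    (hK : IsCompact K) {f g : X → ℝ} (hf : Continuous f) (hg : Continuous g) (hg0 : ∀ x, 0 ≤ g x)
    (h : ∀ x ∈ K, g x = 0 → f x < 0) :
    ∃ ν₀ > 0, ∀ ν ≥ ν₀, ∀ x ∈ K, f x - ν * g x < 0 := by
  have hK' : IsCompact (K ∩ {x | 0 ≤ f x}) := hK.inter_right (isClosed_le continuous_const hf)
  rcases (K ∩ {x | 0 ≤ f x}).eq_empty_or_nonempty with he | hne
  · refine ⟨1, one_pos, fun ν hν x hx => ?_⟩
    have : f x < 0 := by
      by_contra! h'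
      exact (he ▸ (⟨hx, h'⟩ : x ∈ K ∩ {x | 0 ≤ f x}) : x ∈ (∅ : Set X)).elim
    nlinarith [hg0 x]
  · obtain ⟨x₀, hx₀, hmin⟩ := hK'.exists_isMinOn hne hg.continuousOn
    obtain ⟨x₁, hx₁, hmax⟩ := hK'.exists_isMaxOn hne hf.continuousOn
    have hpos : 0 < g x₀ := (hg0 x₀).lt_of_ne fun h' => (h x₀ hx₀.1 h'.symm).not_ge hx₀.2
    have hf1 : 0 ≤ f x₁ := hx₁.2
    refine ⟨(f x₁ + 1) / g x₀, by positivity, fun ν hν x hx => ?_⟩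
    have hν0 : 0 < ν := lt_of_lt_of_le (by positivity) hν
    rcases lt_or_ge (f x) 0 with h' | h'
    · nlinarith [hg0 x]
    · have h1 : f x ≤ f x₁ := hmax ⟨hx, h'⟩
      have h2 : g x₀ ≤ g x := hmin ⟨hx, h'⟩
      have h3 : f x₁ + 1 ≤ ν * g x₀ := (div_le_iff₀ hpos).1 hν
      nlinarith

end Energy

section Lyapunov

variable {ι E : Type*} {F : ι → Type*} [Fintype ι] [NormedAddCommGroup E] [InnerProductSpace ℝ E]
  [∀ i, NormedAddCommGroup (F i)] [∀ i, NormedSpace ℝ (F i)] (S : ErrorSystem ι E F)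

variable {S} {ζ : ι → ℝ}

/-- Weighting the nodes by the left null vector of the Laplacian balances the network: coupling
decreases the energy by the weighted sum of the squared differences. -/
theorem sum_inner_disagreement (hζ : IsBalancing S.a ζ) (z : ι → E) :
    ∑ i, ζ i * ⟪z i, S.disagreement z i⟫
      = -(1 / 2 * ∑ i, ∑ j, ζ i * S.a i j * ‖z i - z j‖ ^ 2) := by
  have h1 : ∑ i, ∑ j, ζ i * S.a i j * ‖z j‖ ^ 2 = ∑ i, ∑ j, ζ i * S.a i j * ‖z i‖ ^ 2 := by
    rw [Finset.sum_comm]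
    refine Finset.sum_congr rfl fun j _ => ?_
    rw [← Finset.sum_mul, ← Finset.sum_mul, hζ.balance, Finset.mul_sum]
  have h2 : ∀ i j, ζ i * S.a i j * ⟪z i, z j - z i⟫ = 1 / 2 * (ζ i * S.a i j * ‖z j‖ ^ 2)
      - 1 / 2 * (ζ i * S.a i j * ‖z i‖ ^ 2) - 1 / 2 * (ζ i * S.a i j * ‖z i - z j‖ ^ 2) := by
    intro i j
    rw [norm_sub_sq_real, inner_sub_right, real_inner_self_eq_norm_sq]; ring
  simp only [disagreement, inner_sum, inner_smul_right, Finset.mul_sum, ← mul_assoc, h2,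
    Finset.sum_sub_distrib]
  simp only [mul_assoc, ← Finset.mul_sum] at h1 ⊢
  rw [h1]; ring

theorem eq_of_sum_sq_eq_zero (hζ : IsBalancing S.a ζ) {z : ι → E}
    (h : ∑ i, ∑ j, ζ i * S.a i j * ‖z i - z j‖ ^ 2 = 0) (i j : ι) : z i = z j := by
  have h0 : ∀ i j, 0 ≤ ζ i * S.a i j * ‖z i - z j‖ ^ 2 := fun i j =>
    mul_nonneg (mul_nonneg (hζ.pos i).le (hζ.nonneg i j)) (sq_nonneg _)
  have h1 : ∀ i j, ζ i * S.a i j * ‖z i - z j‖ ^ 2 = 0 := fun i j =>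
    (Finset.sum_eq_zero_iff_of_nonneg fun j _ => h0 i j).1
      ((Finset.sum_eq_zero_iff_of_nonneg fun i _ => Finset.sum_nonneg fun j _ => h0 i j).1 h i
        (Finset.mem_univ i)) j (Finset.mem_univ j)
  induction hζ.connected i j with
  | refl => rfl
  | tail _ hjk ih =>
    rename_i b c _
    rcases mul_eq_zero.1 (h1 b c) with h2 | h2
    · exact absurd h2 (mul_pos (hζ.pos b) hjk).ne'
    · rw [ih]
      exact sub_eq_zero.1 (norm_eq_zero.1 (pow_eq_zero_iff two_ne_zero |>.1 h2))

/-- For small `μ`, the generator `μ G₀ + 1` of the dilation is close to the identity in the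
weighted inner product. -/
theorem abs_sum_inner_generator_sub_le (hζ : ∀ i, 0 ≤ ζ i) (μ : ℝ) (z : ι → E) :
    |∑ i, ζ i * ⟪z i, (μ • S.G₀ + 1) (z i)⟫ - energy ζ z| ≤ |μ| * ‖S.G₀‖ * energy ζ z := by
  rw [energy, ← Finset.sum_sub_distrib, Finset.mul_sum]
  refine (Finset.abs_sum_le_sum_abs _ _).trans (Finset.sum_le_sum fun i _ => ?_)
  have e : ζ i * ⟪z i, (μ • S.G₀ + 1) (z i)⟫ - ζ i * ‖z i‖ ^ 2 = ζ i * (μ * ⟪z i, S.G₀ (z i)⟫) := by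
    simp only [add_apply, smul_apply, one_apply_eq_self, inner_add_right,
      inner_smul_right, real_inner_self_eq_norm_sq]
    ring
  rw [e, abs_mul, abs_mul, abs_of_nonneg (hζ i)]
  calc ζ i * (|μ| * |⟪z i, S.G₀ (z i)⟫|) ≤ ζ i * (|μ| * (‖z i‖ * (‖S.G₀‖ * ‖z i‖))) := by
        gcongr
        · exact hζ i
        · exact (abs_real_inner_le_norm _ _).trans (by gcongr; exact S.G₀.le_opNorm _)
    _ = _ := by ring

variable [FiniteDimensional ℝ E]

theorem isCompact_energy_eq_one (hζ : ∀ i, 0 < ζ i) :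
    IsCompact {z : ι → E | energy ζ z = 1} := by
  refine Metric.isCompact_of_isClosed_isBounded
    (isClosed_eq (continuous_energy ζ) continuous_const) ?_
  refine (Metric.isBounded_closedBall (x := (0 : ι → E)) (r := 1 + ∑ j, (ζ j)⁻¹)).subset
    fun z hz => ?_
  rw [mem_closedBall_zero_iff]
  have h0 : 0 ≤ 1 + ∑ j, (ζ j)⁻¹ :=
    add_nonneg zero_le_one (Finset.sum_nonneg fun j _ => (inv_pos.2 (hζ j)).le)
  exact (pi_norm_le_iff_of_nonneg h0).2 fun i => norm_le_of_energy_le_one hζ (le_of_eq hz) i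

/-- Where all nodes agree, the weighted energy decays because the average of the closed-loop
operators is stable; elsewhere the coupling dominates once its gain is large. -/
theorem exists_forall_sum_inner_linField_lt [Nonempty ι] (hζ : IsBalancing S.a ζ) {ρ : ℝ}
    (hρ : 0 < ρ)
    (hQ : ∀ v : E, ∑ i, ζ i * ⟪v, S.A v + S.H i (S.C i v)⟫ ≤ -(3 / 4 * ρ) * ‖v‖ ^ 2) :
    ∃ ν₀ > 0, ∀ ν ≥ ν₀, ∀ z : ι → E, energy ζ z = 1 →
      ∑ i, ζ i * ⟪z i, S.linField ν z i⟫ < -(ρ / 2) := by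
  obtain ⟨ν₀, hν₀, h⟩ := exists_forall_sub_mul_lt_zero (isCompact_energy_eq_one (E := E) hζ.pos)
    (f := fun z => ∑ i, ζ i * ⟪z i, S.A (z i) + S.H i (S.C i (z i))⟫ + ρ / 2)
    (g := fun z => 1 / 2 * ∑ i, ∑ j, ζ i * S.a i j * ‖z i - z j‖ ^ 2)
    (by fun_prop) (by fun_prop)
    (fun z => mul_nonneg (by norm_num) (Finset.sum_nonneg fun i _ => Finset.sum_nonneg fun j _ =>
      mul_nonneg (mul_nonneg (hζ.pos i).le (hζ.nonneg i j)) (sq_nonneg _)))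
    (fun z hz hgz => by
      have heq := eq_of_sum_sq_eq_zero hζ (by simpa using hgz)
      obtain ⟨i₀⟩ := ‹Nonempty ι›
      have h1 := hQ (z i₀)
      have h2 : ‖z i₀‖ ^ 2 = 1 := by
        have : energy ζ z = 1 := hz
        simp only [energy, heq _ i₀] at this
        rwa [← Finset.sum_mul, hζ.sum_eq_one, one_mul] at this
      rw [h2] at h1
      simp only [heq _ i₀]
      linarith)
  refine ⟨ν₀, hν₀, fun ν hν z hz => ?_⟩
  have h1 := h ν hν z hz
  have h2 := sum_inner_disagreement hζ z
  have h3 : ∑ i, ζ i * ⟪z i, S.linField ν z i⟫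
      = ∑ i, ζ i * ⟪z i, S.A (z i) + S.H i (S.C i (z i))⟫
        + ν * ∑ i, ζ i * ⟪z i, S.disagreement z i⟫ := by
    rw [Finset.mul_sum, ← Finset.sum_add_distrib]
    refine Finset.sum_congr rfl fun i _ => ?_
    rw [linField, inner_add_right, inner_smul_right]; ring
  rw [h3, h2]
  linarith

/-- The infinitesimal form of the decay of the homogeneous Lyapunov function: on its unit sphere
the perturbed error field points into the unit ball, faster than the generator of the dilation
scaled by `ρ / 3 - τ`. -/
theorem exists_forall_sum_inner_field_lt [Nonempty ι] (hζ : IsBalancing S.a ζ) {ρ : ℝ}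
    (hρ : 0 < ρ)
    (hQ : ∀ v : E, ∑ i, ζ i * ⟪v, S.A v + S.H i (S.C i v)⟫ ≤ -(3 / 4 * ρ) * ‖v‖ ^ 2) :
    ∃ ν₀ > 0, ∀ ν ≥ ν₀, ∃ μ₀ > 0, ∀ μ : ℝ, μ ≠ 0 → |μ| < μ₀ → ∀ Nm, IsHomNorm S.G₀ μ Nm →
      ∀ τ, 0 ≤ τ → τ < ρ / 3 → ∀ z δ : ι → E, energy ζ z = 1 →
        (∀ i, ‖dil S.G₀ μ (-Real.log (Nm (z i))) (δ i)‖ ≤ τ * Nm (z i) ^ μ) →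
        ∑ i, ζ i * ⟪z i, S.field μ ν Nm z i + δ i⟫
          < -(ρ / 3 - τ) * ∑ i, ζ i * ⟪z i, (μ • S.G₀ + 1) (z i)⟫ := by
  obtain ⟨ν₀, hν₀, h⟩ := exists_forall_sum_inner_linField_lt hζ hρ hQ
  refine ⟨ν₀, hν₀, fun ν hν => ?_⟩
  set R := 1 + ∑ j, (ζ j)⁻¹ with hRdef
  have hR : 0 ≤ R :=
    add_nonneg zero_le_one (Finset.sum_nonneg fun j _ => (inv_pos.2 (hζ.pos j)).le)
  obtain ⟨K, hK0, hK⟩ := S.exists_norm_field_sub_linField_le ν hR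
  set K' := 2 * (‖S.G₀‖ + 1) * (2 + (1 + R ^ 2) ^ 3) with hK'
  have hK'0 : 0 ≤ K' := by positivity
  -- `M` collects the errors of first order in `μ`
  set M := R * K + ρ / 3 * (R * K') + ρ / 3 * ‖S.G₀‖ with hM
  have hM0 : 0 ≤ M := by positivity
  refine ⟨min (1 / (2 * (‖S.G₀‖ + 1))) (ρ / (6 * (M + 1))), by positivity,
    fun μ hμ0 hμ Nm hN τ hτ hτρ z δ hz hδ => ?_⟩
  have hμ1 : |μ| * (‖S.G₀‖ + 1) ≤ 1 / 2 := by
    have := (hμ.trans_le (min_le_left _ _)).le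
    rw [le_div_iff₀ (by positivity)] at this
    linarith
  have hμ2 : |μ| * M < ρ / 6 := by
    have := hμ.trans_le (min_le_right _ _)
    rw [lt_div_iff₀ (by positivity)] at this
    nlinarith [abs_nonneg μ]
  have hzR := norm_le_of_energy_le_one hζ.pos hz.le
  have hV : ∑ i, ζ i * ‖z i‖ ^ 2 = 1 := hz
  have h1 := h ν hν z hz
  have h2 := hK μ Nm hμ1 hN z hzR
  have h3 : ∀ i, ‖δ i‖ ≤ τ * ‖z i‖ + τ * (|μ| * K') := fun i =>
    hN.norm_le_of_norm_dil_le hμ0 hμ1 hτ (hzR i) (hδ i)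
  have h4 : ∑ i, ζ i * ⟪z i, S.field μ ν Nm z i + δ i⟫ ≤ ∑ i, (ζ i * ⟪z i, S.linField ν z i⟫
      + ζ i * (R * (|μ| * K) + τ * (|μ| * K') * R) + τ * (ζ i * ‖z i‖ ^ 2)) := by
    refine Finset.sum_le_sum fun i _ => ?_
    have e : S.field μ ν Nm z i + δ i
        = S.linField ν z i + (S.field μ ν Nm z i - S.linField ν z i) + δ i := by abel
    rw [e, inner_add_right, inner_add_right]
    have b1 : ⟪z i, S.field μ ν Nm z i - S.linField ν z i⟫ ≤ R * (|μ| * K) :=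
      (real_inner_le_norm _ _).trans
        (mul_le_mul (hzR i) (h2 i) (norm_nonneg _) hR)
    have b2 : ⟪z i, δ i⟫ ≤ τ * (|μ| * K') * R + τ * ‖z i‖ ^ 2 := by
      refine (real_inner_le_norm _ _).trans ?_
      calc ‖z i‖ * ‖δ i‖ ≤ ‖z i‖ * (τ * ‖z i‖ + τ * (|μ| * K')) := by gcongr; exact h3 i
        _ = τ * (|μ| * K') * ‖z i‖ + τ * ‖z i‖ ^ 2 := by ring
        _ ≤ _ := by gcongr; exact hzR i
    nlinarith [hζ.pos i]
  rw [Finset.sum_add_distrib, Finset.sum_add_distrib, ← Finset.sum_mul, ← Finset.mul_sum, hV,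
    hζ.sum_eq_one] at h4
  have h5 : ∑ i, ζ i * ⟪z i, (μ • S.G₀ + 1) (z i)⟫ ≤ 1 + |μ| * ‖S.G₀‖ := by
    have h := (abs_le.1 (abs_sum_inner_generator_sub_le (S := S) (fun i => (hζ.pos i).le) μ z)).2
    rw [hz, mul_one] at h
    linarith
  have h6 : τ * (|μ| * K') * R ≤ ρ / 3 * (|μ| * K') * R := by gcongr
  have h7 : (ρ / 3 - τ) * ∑ i, ζ i * ⟪z i, (μ • S.G₀ + 1) (z i)⟫
      ≤ (ρ / 3 - τ) * (1 + |μ| * ‖S.G₀‖) :=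
    mul_le_mul_of_nonneg_left h5 (by linarith)
  have h8 : (ρ / 3 - τ) * (|μ| * ‖S.G₀‖) ≤ ρ / 3 * (|μ| * ‖S.G₀‖) := by gcongr; linarith
  have h9 : |μ| * M = |μ| * (R * K) + ρ / 3 * (|μ| * K') * R + ρ / 3 * (|μ| * ‖S.G₀‖) := by
    rw [hM]; ring
  linarith

end Lyapunov

end ErrorSystem

namespace ErrorSystem

/-! ### Decay along trajectories -/

section Decay

variable {ι E : Type*} {F : ι → Type*} [Fintype ι] [NormedAddCommGroup E] [InnerProductSpace ℝ E]
  [∀ i, NormedAddCommGroup (F i)] [∀ i, NormedSpace ℝ (F i)]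

/-- The infinitesimal decay condition with rate `c`: on the unit level set of the weighted energy,
the error field, perturbed by vectors `δ i` of homogeneous size at most `τ`, points inwards faster
than the generator of the dilation scaled by `c`. -/
structure IsDecaying (S : ErrorSystem ι E F) (ζ : ι → ℝ) (μ ν τ c : ℝ) (Nm : E → ℝ) : Prop where
  homNorm : IsHomNorm S.G₀ μ Nm
  ne_zero : μ ≠ 0
  small : |μ| * (‖S.G₀‖ + 1) ≤ 1 / 4
  weight_pos : ∀ i, 0 < ζ i
  rate_pos : 0 < c
  decay : ∀ z δ : ι → E, energy ζ z = 1 →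
    (∀ i, ‖dil S.G₀ μ (-Real.log (Nm (z i))) (δ i)‖ ≤ τ * Nm (z i) ^ μ) →
    ∑ i, ζ i * ⟪z i, S.field μ ν Nm z i + δ i⟫ < -c * ∑ i, ζ i * ⟪z i, (μ • S.G₀ + 1) (z i)⟫

/-- The energy of `d(-s) w`. The homogeneous Lyapunov function is at most `exp s` at `w` iff this
is at most `1`. -/
noncomputable def scaledEnergy (S : ErrorSystem ι E F) (ζ : ι → ℝ) (μ s : ℝ) (w : ι → E) : ℝ :=
  energy ζ fun i => dil S.G₀ μ (-s) (w i)

variable {S : ErrorSystem ι E F} {ζ : ι → ℝ} {μ ν τ c : ℝ} {Nm : E → ℝ}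

theorem IsDecaying.mul_norm_le (h : S.IsDecaying ζ μ ν τ c Nm) : |μ| * ‖S.G₀‖ ≤ 1 / 4 := by
  nlinarith [h.small, abs_nonneg μ]

variable [CompleteSpace E]

/-- The decay condition, transported from the unit level set by homogeneity. -/
theorem IsDecaying.decay_dil (h : S.IsDecaying ζ μ ν τ c Nm) {s : ℝ} {w δ : ι → E}
    (hw : S.scaledEnergy ζ μ s w = 1)
    (hδ : ∀ i, ‖dil S.G₀ μ (-Real.log (Nm (w i))) (δ i)‖ ≤ τ * Nm (w i) ^ μ) :
    ∑ i, ζ i * ⟪dil S.G₀ μ (-s) (w i), dil S.G₀ μ (-s) (S.field μ ν Nm w i + δ i)⟫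
      < -(c * Real.exp (μ * s)) *
        ∑ i, ζ i * ⟪dil S.G₀ μ (-s) (w i), (μ • S.G₀ + 1) (dil S.G₀ μ (-s) (w i))⟫ := by
  have hμ : |μ| * ‖S.G₀‖ ≤ 1 / 2 := by linarith [h.mul_norm_le]
  have hexp : Real.exp (μ * s) * Real.exp (μ * -s) = 1 := by rw [← Real.exp_add]; simp
  have key := h.decay (fun i => dil S.G₀ μ (-s) (w i))
    (fun i => Real.exp (μ * -s) • dil S.G₀ μ (-s) (δ i)) hw fun i => by
      have hNm := h.homNorm.map_dil hμ (-s) (w i)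
      rcases eq_or_ne (w i) 0 with h0 | h0
      · have h1 := hδ i
        simp only [h0, h.homNorm.map_zero, _root_.map_zero, Real.log_zero, neg_zero, dil_zero,
          one_apply_eq_self] at h1 ⊢
        rw [Real.zero_rpow h.ne_zero, mul_zero] at h1 ⊢
        simp [norm_le_zero_iff.1 h1]
      · rw [hNm, Real.log_mul (Real.exp_pos _).ne' (h.homNorm.pos h0).ne', Real.log_exp, map_smul,
          dil_dil, show -(-s + Real.log (Nm (w i))) + -s = -Real.log (Nm (w i)) by ring, norm_smul,
          Real.norm_eq_abs, Real.abs_exp, Real.mul_rpow (Real.exp_pos _).le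
          (h.homNorm.nonneg _), ← Real.exp_mul, mul_comm (-s) μ, mul_left_comm]
        exact mul_le_mul_of_nonneg_left (hδ i) (Real.exp_pos _).le
  simp only [S.field_dil h.homNorm hμ, ← smul_add, ← map_add, inner_smul_right,
    mul_left_comm _ (Real.exp (μ * -s)), ← Finset.mul_sum] at key
  have := mul_lt_mul_of_pos_left key (Real.exp_pos (μ * s))
  rw [← mul_assoc, hexp, one_mul] at this
  linarith

theorem hasDerivWithinAt_dil_comp (G₀ : E →L[ℝ] E) {u : Set ℝ} {t s' : ℝ} {x : ℝ → E} {x' : E}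
    {s : ℝ → ℝ} (hx : HasDerivWithinAt x x' u t) (hs : HasDerivWithinAt s s' u t) :
    HasDerivWithinAt (fun t => dil G₀ μ (-s t) (x t))
      (-s' • (μ • G₀ + 1) (dil G₀ μ (-s t) (x t)) + dil G₀ μ (-s t) x') u t := by
  have h : HasDerivWithinAt (fun t => dil G₀ μ (-s t))
      (-s' • ((μ • G₀ + 1) * dil G₀ μ (-s t))) u t :=
    HasDerivAt.scomp_hasDerivWithinAt (h := fun t => -s t) t (hasDerivAt_dil G₀ μ (-s t)) hs.neg
  refine (h.clm_apply hx).congr_deriv ?_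
  rw [smul_apply, mul_apply_eq_comp]

theorem hasDerivWithinAt_scaledEnergy (S : ErrorSystem ι E F) {u : Set ℝ} {t s' : ℝ}
    {e : ℝ → ι → E} {g : ι → E} {s : ℝ → ℝ} (he : HasDerivWithinAt e g u t)
    (hs : HasDerivWithinAt s s' u t) :
    HasDerivWithinAt (fun t => S.scaledEnergy ζ μ (s t) (e t))
      (2 * (-s' * ∑ i, ζ i * ⟪dil S.G₀ μ (-s t) (e t i),
          (μ • S.G₀ + 1) (dil S.G₀ μ (-s t) (e t i))⟫
        + ∑ i, ζ i * ⟪dil S.G₀ μ (-s t) (e t i), dil S.G₀ μ (-s t) (g i)⟫)) u t := by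
  have h : ∀ i, HasDerivWithinAt (fun t => ζ i * ‖dil S.G₀ μ (-s t) (e t i)‖ ^ 2)
      (ζ i * (2 * ⟪dil S.G₀ μ (-s t) (e t i), -s' • (μ • S.G₀ + 1) (dil S.G₀ μ (-s t) (e t i))
        + dil S.G₀ μ (-s t) (g i)⟫)) u t := fun i =>
    (hasDerivWithinAt_dil_comp S.G₀ (hasDerivWithinAt_pi.1 he i) hs).norm_sq.const_mul (ζ i)
  have h2 := HasDerivWithinAt.fun_sum (u := Finset.univ) fun i _ => h i
  refine h2.congr_deriv ?_
  rw [Finset.mul_sum, ← Finset.sum_add_distrib, Finset.mul_sum]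
  refine Finset.sum_congr rfl fun i _ => ?_
  rw [inner_add_right, inner_smul_right]
  ring

/-- The sublevel sets of the homogeneous Lyapunov function, shrinking along a curve
`exp (s t)` of radii with `s' ≥ -c exp (μ s)`, are invariant: `e` need satisfy the error equation
only when it is on the boundary. -/
theorem IsDecaying.scaledEnergy_le_one (h : S.IsDecaying ζ μ ν τ c Nm) {a b : ℝ}
    {e g : ℝ → ι → E} {s s' : ℝ → ℝ} (he : ContinuousOn e (Icc a b))
    (hg : ∀ t ∈ Ico a b, HasDerivWithinAt e (g t) (Ici t) t) (hs : ContinuousOn s (Icc a b))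
    (hs' : ∀ t ∈ Ico a b, HasDerivWithinAt s (s' t) (Ici t) t)
    (hrate : ∀ t ∈ Ico a b, -(c * Real.exp (μ * s t)) ≤ s' t)
    (hfield : ∀ t ∈ Ico a b, S.scaledEnergy ζ μ (s t) (e t) = 1 → ∀ i,
      ‖dil S.G₀ μ (-Real.log (Nm (e t i))) (g t i - S.field μ ν Nm (e t) i)‖
        ≤ τ * Nm (e t i) ^ μ)
    (h0 : S.scaledEnergy ζ μ (s a) (e a) ≤ 1) :
    ∀ t ∈ Icc a b, S.scaledEnergy ζ μ (s t) (e t) ≤ 1 := by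
  have hwc : ContinuousOn (fun t i => dil S.G₀ μ (-s t) (e t i)) (Icc a b) :=
    continuousOn_pi.2 fun i =>
      ((continuous_dil S.G₀ μ).comp_continuousOn hs.neg).clm_apply (continuousOn_pi.1 he i)
  have hE := (continuous_energy ζ).comp_continuousOn hwc
  refine fun t ht => image_le_of_deriv_right_lt_deriv_boundary (B := fun _ => 1) (B' := fun _ => 0)
    hE (fun t ht => S.hasDerivWithinAt_scaledEnergy (hg t ht) (hs' t ht)) h0
    (fun t => hasDerivAt_const t (1 : ℝ)) ?_ ht
  intro t ht h1
  have key := h.decay_dil h1 (hfield t ht h1)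
  have h2 := (abs_le.1 (abs_sum_inner_generator_sub_le (S := S)
      (fun i => (h.weight_pos i).le) μ fun i => dil S.G₀ μ (-s t) (e t i))).1
  rw [show energy ζ (fun i => dil S.G₀ μ (-s t) (e t i)) = 1 from h1] at h2
  simp only [add_sub_cancel] at key
  have hX : 0 ≤ ∑ i, ζ i * ⟪dil S.G₀ μ (-s t) (e t i),
      (μ • S.G₀ + 1) (dil S.G₀ μ (-s t) (e t i))⟫ := by
    linarith [h.mul_norm_le]
  have h3 := mul_le_mul_of_nonneg_right (hrate t ht) hX
  linarith

/-- `e` satisfies on `[a, b]`, in the sense of right derivatives, the error equation perturbed by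
a vector of homogeneous size at most `τ` at each node. -/
def IsErrorPath (S : ErrorSystem ι E F) (μ ν τ : ℝ) (Nm : E → ℝ) (a b : ℝ) (e : ℝ → ι → E) :
    Prop :=
  ContinuousOn e (Icc a b) ∧ ∃ g : ℝ → ι → E, ∀ t ∈ Ico a b,
    HasDerivWithinAt e (g t) (Ici t) t ∧
      ∀ i, ‖dil S.G₀ μ (-Real.log (Nm (e t i))) (g t i - S.field μ ν Nm (e t) i)‖
        ≤ τ * Nm (e t i) ^ μ

omit [CompleteSpace E] in
theorem IsErrorPath.mono {a b a' b' : ℝ} {e : ℝ → ι → E} (he : S.IsErrorPath μ ν τ Nm a b e)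
    (ha : a ≤ a') (hb : b' ≤ b) : S.IsErrorPath μ ν τ Nm a' b' e :=
  ⟨he.1.mono (Icc_subset_Icc ha hb), he.2.imp fun _ hg t ht => hg t (Ico_subset_Ico ha hb ht)⟩

theorem IsDecaying.scaledEnergy_le_one_of_const (h : S.IsDecaying ζ μ ν τ c Nm) {a b s : ℝ}
    {e : ℝ → ι → E} (he : S.IsErrorPath μ ν τ Nm a b e) (h0 : S.scaledEnergy ζ μ s (e a) ≤ 1)
    {t : ℝ} (ht : t ∈ Icc a b) : S.scaledEnergy ζ μ s (e t) ≤ 1 := by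
  obtain ⟨hc, g, hg⟩ := he
  exact h.scaledEnergy_le_one (s := fun _ => s) (s' := fun _ => 0) hc (fun t ht => (hg t ht).1)
    continuousOn_const (fun t _ => hasDerivWithinAt_const _ _ _)
    (fun t _ => neg_nonpos.2 (mul_nonneg h.rate_pos.le (Real.exp_pos _).le))
    (fun t ht _ => (hg t ht).2) h0 t ht

/-- The homogeneous Lyapunov function decreases from `exp s₀` to `exp s₁` within the time that the
comparison equation `r' = -c r ^ (1 + μ)` takes. -/
theorem IsDecaying.scaledEnergy_le_one_of_le (h : S.IsDecaying ζ μ ν τ c Nm) {a b s₀ s₁ : ℝ}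
    {e : ℝ → ι → E} (he : S.IsErrorPath μ ν τ Nm a b e) (h0 : S.scaledEnergy ζ μ s₀ (e a) ≤ 1)
    (hs : s₁ ≤ s₀)
    (hb : a + (Real.exp (-(μ * s₁)) - Real.exp (-(μ * s₀))) / (μ * c) ≤ b) :
    S.scaledEnergy ζ μ s₁ (e b) ≤ 1 := by
  have hμc : μ * c ≠ 0 := mul_ne_zero h.ne_zero h.rate_pos.ne'
  set T := (Real.exp (-(μ * s₁)) - Real.exp (-(μ * s₀))) / (μ * c) with hT
  have hT' : μ * c * T = Real.exp (-(μ * s₁)) - Real.exp (-(μ * s₀)) := by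
    rw [hT, mul_div_cancel₀ _ hμc]
  have hT0 : 0 ≤ T := by
    rcases h.ne_zero.lt_or_gt with hμ | hμ
    · refine div_nonneg_of_nonpos ?_ (mul_neg_of_neg_of_pos hμ h.rate_pos).le
      exact sub_nonpos.2 (Real.exp_le_exp.2 (by nlinarith))
    · refine div_nonneg ?_ (mul_pos hμ h.rate_pos).le
      exact sub_nonneg.2 (Real.exp_le_exp.2 (by nlinarith))
  refine h.scaledEnergy_le_one_of_const (he.mono (le_add_of_nonneg_right hT0) le_rfl) ?_
    ⟨hb, le_rfl⟩
  -- the solution of the comparison equation is `q ^ (-1 / μ)` with `q` affine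
  set q : ℝ → ℝ := fun t => Real.exp (-(μ * s₀)) + μ * c * (t - a) with hq
  have hqa : q a = Real.exp (-(μ * s₀)) := by simp [hq]
  have hqT : q (a + T) = Real.exp (-(μ * s₁)) := by simp only [hq, add_sub_cancel_left]; linarith
  have hqpos : ∀ t ∈ Icc a (a + T), 0 < q t := by
    intro t ht
    rcases h.ne_zero.lt_or_gt with hμ | hμ
    · have h1 : μ * c * (a + T - a) ≤ μ * c * (t - a) :=
        mul_le_mul_of_nonpos_left (by linarith [ht.2]) (mul_neg_of_neg_of_pos hμ h.rate_pos).le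
      have h2 := Real.exp_pos (-(μ * s₁))
      rw [← hqT] at h2
      simp only [hq] at h2 ⊢
      linarith
    · have h1 : 0 ≤ μ * c * (t - a) :=
        mul_nonneg (mul_pos hμ h.rate_pos).le (by linarith [ht.1])
      have h2 := Real.exp_pos (-(μ * s₀))
      simp only [hq]
      linarith
  have hqd : ∀ t, HasDerivAt q (μ * c) t := fun t =>
    ((((hasDerivAt_id t).sub_const a).const_mul (μ * c)).const_add
      (Real.exp (-(μ * s₀)))).congr_deriv (mul_one _)
  obtain ⟨hc, g, hg⟩ := he.mono le_rfl hb
  have := h.scaledEnergy_le_one (s := fun t => -(1 / μ) * Real.log (q t))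
    (s' := fun t => -(1 / μ) * (μ * c / q t)) hc (fun t ht => (hg t ht).1)
    (fun t ht => (((hqd t).continuousAt.log (hqpos t ht).ne').const_mul _).continuousWithinAt)
    (fun t ht => (((hqd t).log (hqpos t (Ico_subset_Icc_self ht)).ne').const_mul
      _).hasDerivWithinAt)
    (fun t ht => by
      have h1 := hqpos t (Ico_subset_Icc_self ht)
      rw [show μ * (-(1 / μ) * Real.log (q t)) = -Real.log (q t) by
        have := h.ne_zero; field_simp, Real.exp_neg, Real.exp_log h1]
      refine le_of_eq ?_
      have := h.ne_zero
      field_simp)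
    (fun t ht _ => (hg t ht).2)
    (by
      simp only [hqa, Real.log_exp]
      rwa [show -(1 / μ) * -(μ * s₀) = s₀ by have := h.ne_zero; field_simp])
    (a + T) ⟨le_add_of_nonneg_right hT0, le_rfl⟩
  simp only [hqT, Real.log_exp] at this
  rwa [show -(1 / μ) * -(μ * s₁) = s₁ by have := h.ne_zero; field_simp] at this

/-! ### The size of the sublevel sets -/

theorem IsDecaying.scaledEnergy_anti (h : S.IsDecaying ζ μ ν τ c Nm) {s t : ℝ} (hst : s ≤ t)
    (w : ι → E) : S.scaledEnergy ζ μ t w ≤ S.scaledEnergy ζ μ s w := by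
  refine Finset.sum_le_sum fun i _ => mul_le_mul_of_nonneg_left ?_ (h.weight_pos i).le
  rcases hst.eq_or_lt with rfl | hst
  · exact le_rfl
  · rcases eq_or_ne (w i) 0 with h0 | h0
    · simp [h0]
    · gcongr
      exact (norm_dil_neg_lt (by linarith [h.mul_norm_le]) h0 hst).le

theorem IsDecaying.exists_scaledEnergy_le_one (h : S.IsDecaying ζ μ ν τ c Nm) (w : ι → E) :
    ∃ s, S.scaledEnergy ζ μ s w ≤ 1 := by
  have h0 : 0 ≤ energy ζ w :=
    Finset.sum_nonneg fun i _ => mul_nonneg (h.weight_pos i).le (sq_nonneg _)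
  refine ⟨energy ζ w, ?_⟩
  have h1 : S.scaledEnergy ζ μ (energy ζ w) w ≤ Real.exp (-energy ζ w) * energy ζ w := by
    rw [scaledEnergy, energy]
    refine (Finset.sum_le_sum fun i _ => ?_).trans_eq (Finset.mul_sum _ _ _).symm
    rw [mul_left_comm]
    refine mul_le_mul_of_nonneg_left ?_ (h.weight_pos i).le
    have h2 : ‖dil S.G₀ μ (-energy ζ w) (w i)‖ ≤ Real.exp (-energy ζ w / 2) * ‖w i‖ := by
      refine (norm_dil_apply_le S.G₀ μ _ _).trans ?_
      rw [abs_neg, abs_of_nonneg h0]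
      gcongr
      nlinarith [h.mul_norm_le]
    calc _ ≤ (Real.exp (-energy ζ w / 2) * ‖w i‖) ^ 2 := by gcongr
      _ = _ := by rw [mul_pow, ← Real.exp_nat_mul]; congr 2; push_cast; ring
  refine h1.trans ?_
  have h2 := Real.add_one_le_exp (energy ζ w)
  rw [Real.exp_neg, inv_mul_le_iff₀ (Real.exp_pos _)]
  linarith

theorem IsDecaying.exists_forall_norm_lt (h : S.IsDecaying ζ μ ν τ c Nm) {ε : ℝ} (hε : 0 < ε) :
    ∃ s, ∀ w : ι → E, S.scaledEnergy ζ μ s w ≤ 1 → ‖w‖ < ε := by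
  set R := 1 + ∑ j, (ζ j)⁻¹ with hR
  have hR0 : 0 < R := add_pos_of_pos_of_nonneg one_pos
    (Finset.sum_nonneg fun j _ => (inv_pos.2 (h.weight_pos j)).le)
  have hlim : Tendsto (fun s : ℝ => Real.exp (s / 2) * R) atBot (𝓝 0) := by
    have h1 : Tendsto (fun s : ℝ => Real.exp (s / 2)) atBot (𝓝 0) :=
      Real.tendsto_exp_atBot.comp (tendsto_id.atBot_div_const two_pos)
    simpa using h1.mul_const R
  obtain ⟨s, hs, hs0⟩ := ((hlim.eventually_lt_const hε).and (eventually_le_atBot 0)).exists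
  refine ⟨s, fun w hw => ?_⟩
  rw [pi_norm_lt_iff hε]
  intro i
  have h1 := norm_le_of_energy_le_one h.weight_pos hw i
  have h2 := norm_dil_apply_le S.G₀ μ s (dil S.G₀ μ (-s) (w i))
  rw [dil_dil_neg, abs_of_nonpos hs0] at h2
  refine (h2.trans ?_).trans_lt hs
  gcongr
  nlinarith [h.mul_norm_le]

omit [CompleteSpace E] in
theorem exists_forall_scaledEnergy_le_one (S : ErrorSystem ι E F) (ζ : ι → ℝ) (μ s : ℝ) :
    ∃ δ > 0, ∀ w : ι → E, ‖w‖ < δ → S.scaledEnergy ζ μ s w ≤ 1 := by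
  have hc : Continuous fun w : ι → E => S.scaledEnergy ζ μ s w :=
    (continuous_energy ζ).comp (by fun_prop)
  have h0 : S.scaledEnergy ζ μ s (0 : ι → E) < 1 := by simp [scaledEnergy, energy]
  obtain ⟨δ, hδ, h⟩ := Metric.eventually_nhds_iff_ball.1 (hc.continuousAt.eventually_lt_const h0)
  exact ⟨δ, hδ, fun w hw => (h w (by simpa using hw)).le⟩

end Decay

end ErrorSystem

/-! ### Peano's existence theorem -/

section Peano

variable {V : Type*} [NormedAddCommGroup V] [NormedSpace ℝ V]

theorem hasDerivWithinAt_of_eq_integral [CompleteSpace V] {a b : ℝ} {x G : ℝ → V}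
    (hG : ContinuousOn G (Icc a b)) (hx : ∀ t ∈ Icc a b, x t = x a + ∫ s in a..t, G s) {t : ℝ}
    (ht : t ∈ Ico a b) : HasDerivWithinAt x (G t) (Ici t) t := by
  have hab : a ≤ b := ht.1.trans ht.2.le
  set G' : ℝ → V := IccExtend hab ((Icc a b).domRestrict G) with hG'
  have hc : Continuous G' := (continuousOn_iff_continuous_domRestrict.1 hG).Icc_extend'
  have heq : ∀ s ∈ Icc a b, G' s = G s := fun s hs => by
    rw [hG', IccExtend_of_mem _ _ hs]; rfl
  have h1 : HasDerivAt (fun t => x a + ∫ s in a..t, G' s) (G' t) t :=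
    (intervalIntegral.integral_hasDerivAt_right (hc.intervalIntegrable _ _)
      hc.aestronglyMeasurable.stronglyMeasurableAtFilter hc.continuousAt).const_add _
  have h2 : ∀ r ∈ Icc a b, x r = x a + ∫ s in a..r, G' s := fun r hr => by
    rw [hx r hr]
    congr 1
    refine intervalIntegral.integral_congr fun s hs => ?_
    rw [uIcc_of_le hr.1] at hs
    exact (heq s ⟨hs.1, hs.2.trans hr.2⟩).symm
  rw [← heq t (Ico_subset_Icc_self ht)]
  refine h1.hasDerivWithinAt.congr_of_eventuallyEq ?_ (h2 t (Ico_subset_Icc_self ht))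
  filter_upwards [Icc_mem_nhdsGE ht.2] with r hr
  exact h2 r ⟨ht.1.trans hr.1, hr.2⟩

/-- The integral equation with delay `h`, for the field `F`, the initial time `a` and the constant
initial function `x₀`. -/
noncomputable def delayStep (F : ℝ → V → V) (a h : ℝ) (x₀ : V) (y : ℝ → V) (t : ℝ) : V :=
  x₀ + ∫ s in a..max a t, F s (y (s - h))

variable {F : ℝ → V → V} {a h M : ℝ} {x₀ : V}

theorem norm_delayStep_sub_le (hM : ∀ t x, ‖F t x‖ ≤ M) (hF : Continuous (Function.uncurry F))
    {y : ℝ → V} (hy : Continuous y) (t t' : ℝ) :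
    ‖delayStep F a h x₀ y t - delayStep F a h x₀ y t'‖ ≤ M * |t - t'| := by
  have hc : Continuous fun s => F s (y (s - h)) :=
    hF.comp (continuous_id.prodMk (hy.comp (continuous_id.sub continuous_const)))
  have hM0 : 0 ≤ M := (norm_nonneg _).trans (hM 0 0)
  rw [delayStep, delayStep, add_sub_add_left_eq_sub,
    intervalIntegral.integral_interval_sub_left (hc.intervalIntegrable _ _)
      (hc.intervalIntegrable _ _)]
  refine (intervalIntegral.norm_integral_le_of_norm_le_const fun s _ => hM _ _).trans ?_
  refine mul_le_mul_of_nonneg_left ?_ hM0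
  have := abs_max_sub_max_le_abs t t' a
  rwa [max_comm t, max_comm t'] at this

/-- On a bounded time interval, iteration of the delayed integral operator stabilizes: its `n`-th
iterate is determined up to the time `a + n h`. -/
theorem exists_delay_solution (hM : ∀ t x, ‖F t x‖ ≤ M) (hF : Continuous (Function.uncurry F))
    (hh : 0 < h) (b : ℝ) :
    ∃ y : ℝ → V, (∀ t t', ‖y t - y t'‖ ≤ M * |t - t'|) ∧ y a = x₀ ∧
      ∀ t ∈ Icc a b, y t = x₀ + ∫ s in a..t, F s (y (s - h)) := by
  set y : ℕ → ℝ → V := fun n => (delayStep F a h x₀)^[n] fun _ => x₀ with hy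
  have hM0 : 0 ≤ M := (norm_nonneg _).trans (hM 0 0)
  have hsucc : ∀ n, y (n + 1) = delayStep F a h x₀ (y n) := fun n =>
    Function.iterate_succ_apply' _ _ _
  have hlip : ∀ n, ∀ t t', ‖y n t - y n t'‖ ≤ M * |t - t'| := by
    intro n
    induction n with
    | zero => intro t t'; simp [hy]; positivity
    | succ n ih =>
      have hc : Continuous (y n) := by
        refine (LipschitzWith.of_dist_le_mul (K := ⟨M, hM0⟩) fun t t' => ?_).continuous
        rw [dist_eq_norm, Real.dist_eq]; exact ih t t'
      rw [hsucc]
      exact norm_delayStep_sub_le hM hF hc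
  have hstab : ∀ n : ℕ, ∀ t ≤ a + n * h, y (n + 1) t = y n t := by
    intro n
    induction n with
    | zero =>
      intro t ht
      rw [hsucc]
      simp [delayStep, max_eq_left (show t ≤ a by simpa using ht), hy]
    | succ n ih =>
      intro t ht
      push_cast at ht
      rw [hsucc (n + 1)]
      nth_rw 2 [hsucc n]
      simp only [delayStep]
      congr 1
      refine intervalIntegral.integral_congr fun s hs => ?_
      rw [uIcc_of_le (le_max_left _ _)] at hs
      have h1 : s - h ≤ a + n * h := by
        rcases le_max_iff.1 hs.2 with h2 | h2
        · nlinarith [Nat.cast_nonneg (α := ℝ) n]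
        · linarith
      simp only [ih _ h1]
  obtain ⟨n, hn⟩ := exists_nat_ge ((b - a) / h)
  rw [div_le_iff₀ hh] at hn
  refine ⟨y (n + 1), hlip _, ?_, fun t ht => ?_⟩
  · rw [hsucc]; simp [delayStep]
  · conv_lhs => rw [hsucc, delayStep, max_eq_right ht.1]
    congr 1
    refine intervalIntegral.integral_congr fun s hs => ?_
    rw [uIcc_of_le ht.1] at hs
    simp only [hstab n (s - h) (by linarith [hs.2, ht.2])]

/-- Peano's theorem for a bounded field: the solutions of the equations with delays `1 / (k + 1)`
are equicontinuous, and every limit of them solves the equation without delay. -/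
theorem exists_solution_of_bounded [FiniteDimensional ℝ V] (hM : ∀ t x, ‖F t x‖ ≤ M)
    (hF : Continuous (Function.uncurry F)) {b : ℝ} (hab : a ≤ b) (x₀ : V) :
    ∃ x : ℝ → V, Continuous x ∧ x a = x₀ ∧ ∀ t ∈ Icc a b, x t = x₀ + ∫ s in a..t, F s (x s) := by
  have hM0 : 0 ≤ M := (norm_nonneg _).trans (hM 0 0)
  have : ProperSpace V := FiniteDimensional.proper ℝ V
  choose y hylip hya hy using fun k : ℕ =>
    exists_delay_solution (x₀ := x₀) (a := a) (h := 1 / ((k : ℝ) + 1)) hM hF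
      (by positivity) b
  have hyc : ∀ k, Continuous (y k) := fun k => by
    refine (LipschitzWith.of_dist_le_mul (K := ⟨M, hM0⟩) fun t t' => ?_).continuous
    rw [dist_eq_norm, Real.dist_eq]; exact hylip k t t'
  set f : ℕ → BoundedContinuousFunction (Icc a b) V := fun k =>
    BoundedContinuousFunction.mkOfCompact ⟨fun t => y k t, (hyc k).comp continuous_subtype_val⟩
    with hf
  have hcomp : IsCompact (closure (range f)) := by
    refine BoundedContinuousFunction.arzela_ascoli (Metric.closedBall x₀ (M * (b - a)))
      (isCompact_closedBall _ _) _ ?_ ?_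
    · rintro _ t ⟨k, rfl⟩
      have h1 := hylip k t a
      rw [hya, abs_of_nonneg (sub_nonneg.2 t.2.1)] at h1
      rw [mem_closedBall_iff_norm]
      exact h1.trans (by gcongr; exact t.2.2)
    · intro t
      rw [Metric.equicontinuousAt_iff]
      intro ε hε
      refine ⟨ε / (M + 1), by positivity, fun t' ht' => ?_⟩
      rintro ⟨_, k, rfl⟩
      rw [dist_eq_norm]
      rw [Subtype.dist_eq, Real.dist_eq, lt_div_iff₀ (by positivity)] at ht'
      rw [abs_sub_comm] at ht'
      refine (hylip k t t').trans_lt ?_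
      nlinarith [abs_nonneg ((t : ℝ) - t')]
  obtain ⟨x, -, φ, hφ, hlim⟩ := hcomp.tendsto_subseq fun k => subset_closure (mem_range_self k)
  have hpt : ∀ t (ht : t ∈ Icc a b), Tendsto (fun k => y (φ k) t) atTop (𝓝 (x ⟨t, ht⟩)) :=
    fun t ht => ((continuous_eval_const (F := BoundedContinuousFunction (Icc a b) V)
      (⟨t, ht⟩ : Icc a b)).tendsto x).comp hlim
  have hx : ∀ t (ht : t ∈ Icc a b), IccExtend hab x t = x ⟨t, ht⟩ := fun t ht =>
    IccExtend_of_mem _ _ ht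
  refine ⟨IccExtend hab x, x.continuous.Icc_extend', ?_, fun t ht => ?_⟩
  · rw [hx a (left_mem_Icc.2 hab)]
    refine tendsto_nhds_unique (hpt a (left_mem_Icc.2 hab)) ?_
    simp only [hya]
    exact tendsto_const_nhds
  · rw [hx t ht]
    refine tendsto_nhds_unique (hpt t ht) ?_
    have h1 : ∀ k, y (φ k) t = x₀ + ∫ s in a..t, F s (y (φ k) (s - 1 / ((φ k : ℝ) + 1))) :=
      fun k => hy (φ k) t ht
    simp only [h1]
    refine tendsto_const_nhds.add
      (intervalIntegral.tendsto_integral_filter_of_dominated_convergence (fun _ => M) ?_ ?_ ?_ ?_)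
    · refine Eventually.of_forall fun k => Continuous.aestronglyMeasurable ?_
      exact hF.comp (continuous_id.prodMk ((hyc _).comp (continuous_id.sub continuous_const)))
    · exact Eventually.of_forall fun k => Eventually.of_forall fun s _ => hM _ _
    · exact intervalIntegrable_const
    · refine Eventually.of_forall fun s hs => ?_
      rw [uIoc_of_le ht.1] at hs
      have hs' : s ∈ Icc a b := ⟨hs.1.le, hs.2.trans ht.2⟩
      have h2 : Tendsto (fun k => 1 / ((φ k : ℝ) + 1)) atTop (𝓝 0) :=
        tendsto_one_div_add_atTop_nhds_zero_nat.comp hφ.tendsto_atTop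
      have h3 : Tendsto (fun k => y (φ k) (s - 1 / ((φ k : ℝ) + 1)) - y (φ k) s) atTop (𝓝 0) := by
        refine squeeze_zero_norm (a := fun k => M * |1 / ((φ k : ℝ) + 1)|) (fun k => ?_)
          (by simpa using (h2.abs).const_mul M)
        refine (hylip (φ k) _ _).trans_eq ?_
        rw [sub_sub_cancel_left, abs_neg]
      have h4 : Tendsto (fun k => y (φ k) (s - 1 / ((φ k : ℝ) + 1))) atTop
          (𝓝 (IccExtend hab x s)) := by
        rw [hx s hs']
        simpa using h3.add (hpt s hs')
      exact ((hF.tendsto (s, IccExtend hab x s)).comp (tendsto_const_nhds.prodMk_nhds h4))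

end Peano

/-! ### Global existence for the error equation -/

namespace ErrorSystem

section Existence

variable {ι E : Type*} {F : ι → Type*} [Fintype ι] [NormedAddCommGroup E] [InnerProductSpace ℝ E]
  [∀ i, NormedAddCommGroup (F i)] [∀ i, NormedSpace ℝ (F i)] {S : ErrorSystem ι E F} {ζ : ι → ℝ}
  {μ ν τ c : ℝ} {Nm : E → ℝ}

theorem IsDecaying.exists_norm_le [CompleteSpace E] (h : S.IsDecaying ζ μ ν τ c Nm) (s : ℝ) :
    ∃ R, 0 ≤ R ∧ ∀ w : ι → E, S.scaledEnergy ζ μ s w ≤ 1 → ‖w‖ ≤ R := by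
  have hR0 : 0 ≤ 1 + ∑ j, (ζ j)⁻¹ := add_nonneg zero_le_one
    (Finset.sum_nonneg fun j _ => (inv_pos.2 (h.weight_pos j)).le)
  refine ⟨Real.exp (s + |s| * (|μ| * ‖S.G₀‖)) * (1 + ∑ j, (ζ j)⁻¹), by positivity, fun w hw => ?_⟩
  refine (pi_norm_le_iff_of_nonneg (by positivity)).2 fun i => ?_
  have h1 := norm_le_of_energy_le_one h.weight_pos hw i
  have h2 := norm_dil_apply_le S.G₀ μ s (dil S.G₀ μ (-s) (w i))
  rw [dil_dil_neg] at h2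
  exact h2.trans (by gcongr)

variable [FiniteDimensional ℝ E]

/-- The error equation has global solutions: the field is cut off outside an invariant sublevel
set of the Lyapunov function, which the solution does not leave. -/
theorem IsDecaying.exists_solution (h : S.IsDecaying ζ μ ν τ c Nm) {Γ : ℝ → (ι → E) → ι → E}
    {a b : ℝ} (hab : a ≤ b) (hΓ : ContinuousOn (Function.uncurry Γ) (Icc a b ×ˢ univ))
    (hΓτ : ∀ t ∈ Icc a b, ∀ w i,
      ‖dil S.G₀ μ (-Real.log (Nm (w i))) (Γ t w i)‖ ≤ τ * Nm (w i) ^ μ) (e₀ : ι → E) :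
    ∃ e : ℝ → ι → E, ContinuousOn e (Icc a b) ∧ e a = e₀ ∧ ∀ t ∈ Icc a b,
      e t = e₀ + ∫ s in a..t, (S.field μ ν Nm (e s) + Γ s (e s)) := by
  obtain ⟨s₀, hs₀⟩ := h.exists_scaledEnergy_le_one e₀
  obtain ⟨R, hR0, hR⟩ := h.exists_norm_le s₀
  have hfc := S.continuous_field (ν := ν) h.homNorm h.small
  set χ : (ι → E) → ℝ := fun w => max 0 (min 1 (R + 1 - ‖w‖)) with hχ
  have hχc : Continuous χ := by fun_prop
  have hχ1 : ∀ w, ‖w‖ ≤ R → χ w = 1 := fun w hw => by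
    simp only [hχ]
    rw [min_eq_left (by linarith), max_eq_right zero_le_one]
  have hχ0 : ∀ w, R + 1 ≤ ‖w‖ → χ w = 0 := fun w hw => by
    simp only [hχ]
    exact max_eq_left ((min_le_right _ _).trans (by linarith))
  have hχle : ∀ w, ‖χ w‖ ≤ 1 := fun w => by
    rw [Real.norm_of_nonneg (le_max_left _ _)]
    exact max_le zero_le_one (min_le_left _ _)
  set Φ : ℝ → (ι → E) → ι → E := fun t w =>
    χ w • (S.field μ ν Nm w + Γ (projIcc a b hab t) w) with hΦ
  have hpc : Continuous fun t => (projIcc a b hab t : ℝ) :=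
    continuous_subtype_val.comp continuous_projIcc
  have hΓc : Continuous fun p : ℝ × (ι → E) => S.field μ ν Nm p.2 + Γ (projIcc a b hab p.1) p.2 :=
    (hfc.comp continuous_snd).add
      (hΓ.comp_continuous ((hpc.comp continuous_fst).prodMk continuous_snd)
        fun p => ⟨(projIcc a b hab p.1).2, mem_univ _⟩)
  have hΦc : Continuous (Function.uncurry Φ) := (hχc.comp continuous_snd).smul hΓc
  have : ProperSpace (ι → E) := FiniteDimensional.proper ℝ _
  obtain ⟨M, hM⟩ := ((isCompact_Icc (a := a) (b := b)).prod
    (isCompact_closedBall (0 : ι → E) (R + 1))).exists_bound_of_continuousOn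
      (f := fun p : ℝ × (ι → E) => S.field μ ν Nm p.2 + Γ (projIcc a b hab p.1) p.2)
      hΓc.continuousOn
  have hΦM : ∀ t w, ‖Φ t w‖ ≤ |M| := by
    intro t w
    rcases le_total (R + 1) ‖w‖ with hw | hw
    · simp [hΦ, hχ0 w hw]
    · have h1 := hM (projIcc a b hab t, w) ⟨(projIcc a b hab t).2, by simpa using hw⟩
      simp only [projIcc_val] at h1
      rw [hΦ, norm_smul]
      calc _ ≤ 1 * |M| := by
            gcongr
            · exact hχle w
            · exact h1.trans (le_abs_self M)
        _ = |M| := one_mul _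
  obtain ⟨e, hec, hea, he⟩ := exists_solution_of_bounded hΦM hΦc hab e₀
  have hGc : Continuous fun s => Φ s (e s) := hΦc.comp (continuous_id.prodMk hec)
  have hder : ∀ t ∈ Ico a b, HasDerivWithinAt e (Φ t (e t)) (Ici t) t := fun t ht =>
    hasDerivWithinAt_of_eq_integral hGc.continuousOn (fun t ht => by rw [hea]; exact he t ht) ht
  have hΦeq : ∀ t ∈ Icc a b, ∀ w, S.scaledEnergy ζ μ s₀ w ≤ 1 →
      Φ t w = S.field μ ν Nm w + Γ t w := fun t ht w hw => by
    simp only [hΦ]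
    rw [hχ1 w (hR w hw), one_smul, projIcc_of_mem hab ht]
  have hinv := h.scaledEnergy_le_one (s := fun _ => s₀) (s' := fun _ => 0) hec.continuousOn hder
    continuousOn_const (fun t _ => hasDerivWithinAt_const _ _ _)
    (fun t _ => neg_nonpos.2 (mul_nonneg h.rate_pos.le (Real.exp_pos _).le))
    (fun t ht h1 i => by
      rw [hΦeq t (Ico_subset_Icc_self ht) _ h1.le, Pi.add_apply, add_sub_cancel_left]
      exact hΓτ t (Ico_subset_Icc_self ht) _ i)
    (by rwa [hea])
  refine ⟨e, hec.continuousOn, hea, fun t ht => ?_⟩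
  rw [he t ht]
  congr 1
  refine intervalIntegral.integral_congr fun s hs => ?_
  rw [uIcc_of_le ht.1] at hs
  exact hΦeq s ⟨hs.1, hs.2.trans ht.2⟩ _ (hinv s ⟨hs.1, hs.2.trans ht.2⟩)

end Existence

end ErrorSystem

/-! ### Weighted norms and matrix dilations in coordinates adapted to the weight -/

section Coordinates

variable {ι : Type*} [Fintype ι] [DecidableEq ι]

open scoped MatrixOrder Matrix.Norms.L2Operator in
/-- Coordinates in which the inner product `xᵀ P y` is the Euclidean one. -/
theorem exists_coordinates {P : Matrix ι ι ℝ} (hP : P.PosDef) :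
    ∃ φ : (ι → ℝ) ≃L[ℝ] EuclideanSpace ℝ ι, ∀ x y, ⟪φ x, φ y⟫ = x ⬝ᵥ P *ᵥ y := by
  obtain ⟨B, hB⟩ := CStarAlgebra.nonneg_iff_eq_star_mul_self.mp hP.posSemidef.nonneg
  have hB' : P = Bᵀ * B := by
    rw [hB, Matrix.star_eq_conjTranspose, Matrix.conjTranspose_eq_transpose_of_trivial]
  have hdot : ∀ x y, (B *ᵥ x) ⬝ᵥ (B *ᵥ y) = x ⬝ᵥ P *ᵥ y := fun x y => by
    rw [hB', ← Matrix.mulVec_mulVec, Matrix.dotProduct_mulVec x, Matrix.vecMul_transpose]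
  have hinj : Function.Injective B.mulVecLin := by
    rw [← LinearMap.ker_eq_bot, LinearMap.ker_eq_bot']
    intro x hx
    by_contra h0
    have h1 := hP.dotProduct_mulVec_pos h0
    have h2 := hdot x x
    simp only [Matrix.mulVecLin_apply] at hx
    rw [hx, zero_dotProduct] at h2
    simp only [star_trivial] at h1
    linarith
  refine ⟨((LinearEquiv.ofInjectiveEndo _ hinj).trans
    (WithLp.linearEquiv 2 ℝ (ι → ℝ)).symm).toContinuousLinearEquiv, fun x y => ?_⟩
  rw [← hdot, PiLp.inner_apply]
  simp [dotProduct, mul_comm]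

variable {E : Type*} [NormedAddCommGroup E] [NormedSpace ℝ E] (φ : (ι → ℝ) ≃L[ℝ] E)

/-- The operator of a square matrix in the coordinates `φ`. -/
noncomputable def matrixOp : Matrix ι ι ℝ →ₐ[ℝ] (E →L[ℝ] E) :=
  AlgHom.ofLinearMap
    { toFun := fun M => φ.toContinuousLinearMap ∘L
        (LinearMap.toContinuousLinearMap M.mulVecLin) ∘L φ.symm.toContinuousLinearMap
      map_add' := fun M M' => by ext x; simp
      map_smul' := fun r M => by ext x; simp }
    (by ext x; simp) (fun M M' => by ext x; simp [Matrix.mulVec_mulVec])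

theorem matrixOp_apply (M : Matrix ι ι ℝ) (x : E) : matrixOp φ M x = φ (M *ᵥ φ.symm x) := rfl

@[simp] theorem matrixOp_apply_apply (M : Matrix ι ι ℝ) (x : ι → ℝ) :
    matrixOp φ M (φ x) = φ (M *ᵥ x) := by simp [matrixOp_apply]

theorem map_matrix_exp {R : Type*} [NormedRing R] [NormedAlgebra ℝ R]
    (f : Matrix ι ι ℝ →ₐ[ℝ] R) (M : Matrix ι ι ℝ) :
    f (NormedSpace.exp M) = NormedSpace.exp (f M) := by
  let : NormedRing (Matrix ι ι ℝ) := Matrix.linftyOpNormedRing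
  let : NormedAlgebra ℝ (Matrix ι ι ℝ) := Matrix.linftyOpNormedAlgebra
  let := NormedAlgebra.restrictScalars ℚ ℝ (Matrix ι ι ℝ)
  let := NormedAlgebra.restrictScalars ℚ ℝ R
  exact NormedSpace.map_exp f (LinearMap.continuous_of_finiteDimensional f.toLinearMap) M

theorem apply_dilation_mulVec (G₀ : Matrix ι ι ℝ) (μ s : ℝ) (x : ι → ℝ) :
    φ (dilation (μ • G₀ + 1) s *ᵥ x) = dil (matrixOp φ G₀) μ s (φ x) := by
  rw [dil, ← matrixOp_apply_apply, dilation, map_matrix_exp]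
  simp

end Coordinates

section HomNorm

variable {ι : Type*} [Fintype ι] [DecidableEq ι] {P : Matrix ι ι ℝ}
  {E : Type*} [NormedAddCommGroup E] [InnerProductSpace ℝ E]
  {φ : (ι → ℝ) ≃L[ℝ] E}

omit [DecidableEq ι] in
theorem weightedNorm_eq_norm (hφ : ∀ x y, ⟪φ x, φ y⟫ = x ⬝ᵥ P *ᵥ y) (x : ι → ℝ) :
    weightedNorm P x = ‖φ x‖ := by
  rw [weightedNorm, ← hφ, real_inner_self_eq_norm_sq, Real.sqrt_sq (norm_nonneg _)]

variable [CompleteSpace E]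

/-- In adapted coordinates, `homNorm` is the canonical homogeneous norm, provided that the dilation
is close enough to the standard one for this norm to exist. -/
theorem isHomNorm_homNorm (hφ : ∀ x y, ⟪φ x, φ y⟫ = x ⬝ᵥ P *ᵥ y) {G₀ : Matrix ι ι ℝ} {μ : ℝ}
    (hμ : |μ| * ‖matrixOp φ G₀‖ ≤ 1 / 2) :
    IsHomNorm (matrixOp φ G₀) μ fun x => homNorm (μ • G₀ + 1) P (φ.symm x) := by
  have h : ∀ {x : E}, x ≠ 0 → φ.symm x ≠ 0 ∧ ∃ s : ℝ,
      weightedNorm P (dilation (μ • G₀ + 1) (-s) *ᵥ φ.symm x) = 1 := fun {x} hx => by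
    refine ⟨by simpa using hx, ?_⟩
    obtain ⟨s, hs⟩ := exists_norm_dil_eq_one hμ hx
    refine ⟨s, ?_⟩
    rwa [weightedNorm_eq_norm hφ, apply_dilation_mulVec, φ.apply_symm_apply]
  refine ⟨by simp [homNorm], fun {x} hx => ?_, fun {x} hx => ?_⟩
  · simp only [homNorm]
    rw [dif_pos (h hx)]
    exact Real.exp_pos _
  · simp only [homNorm]
    rw [dif_pos (h hx), Real.log_exp]
    have h1 := (h hx).2.choose_spec
    rwa [weightedNorm_eq_norm hφ, apply_dilation_mulVec, φ.apply_symm_apply] at h1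

end HomNorm

/-! ### The stacked dilation -/

section Stacked

variable {n N : ℕ}

theorem one_kronecker_mulVec_uncurry (M : Matrix (Fin n) (Fin n) ℝ) (v : Fin N → Fin n → ℝ) :
    ((1 : Matrix (Fin N) (Fin N) ℝ) ⊗ₖ M) *ᵥ Function.uncurry v
      = Function.uncurry fun i => M *ᵥ v i := by
  ext ⟨i, j⟩
  simp [Matrix.mulVec, dotProduct, Fintype.sum_prod_type, Matrix.one_apply, Function.uncurry,
    ite_mul]

theorem dilation_one_kronecker (G : Matrix (Fin n) (Fin n) ℝ) (s : ℝ) :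
    dilation ((1 : Matrix (Fin N) (Fin N) ℝ) ⊗ₖ G) s
      = (1 : Matrix (Fin N) (Fin N) ℝ) ⊗ₖ dilation G s := by
  let : NormedRing (Matrix (Fin N × Fin n) (Fin N × Fin n) ℝ) := Matrix.linftyOpNormedRing
  let : NormedAlgebra ℝ (Matrix (Fin N × Fin n) (Fin N × Fin n) ℝ) :=
    Matrix.linftyOpNormedAlgebra
  let f : Matrix (Fin n) (Fin n) ℝ →ₐ[ℝ] Matrix (Fin N × Fin n) (Fin N × Fin n) ℝ :=
    AlgHom.ofLinearMap
      { toFun := fun M => (1 : Matrix (Fin N) (Fin N) ℝ) ⊗ₖ M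
        map_add' := fun M M' => Matrix.kronecker_add _ _ _
        map_smul' := fun r M => Matrix.kronecker_smul _ _ _ }
      Matrix.one_kronecker_one
      (fun M M' => by
        change (1 : Matrix (Fin N) (Fin N) ℝ) ⊗ₖ (M * M') = _ ⊗ₖ M * _ ⊗ₖ M'
        rw [← Matrix.mul_kronecker_mul, one_mul])
  have h := map_matrix_exp f (s • G)
  rw [map_smul] at h
  exact h.symm

theorem weightedNorm_one_kronecker_sq {P : Matrix (Fin n) (Fin n) ℝ} (hP : P.PosDef)
    (v : Fin N → Fin n → ℝ) :
    weightedNorm ((1 : Matrix (Fin N) (Fin N) ℝ) ⊗ₖ P) (Function.uncurry v) ^ 2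
      = ∑ i, weightedNorm P (v i) ^ 2 := by
  have h0 : ∀ x : Fin n → ℝ, 0 ≤ x ⬝ᵥ P *ᵥ x := fun x => by
    simpa using hP.posSemidef.dotProduct_mulVec_nonneg x
  have h1 : Function.uncurry v ⬝ᵥ ((1 : Matrix (Fin N) (Fin N) ℝ) ⊗ₖ P) *ᵥ Function.uncurry v
      = ∑ i, v i ⬝ᵥ P *ᵥ v i := by
    rw [one_kronecker_mulVec_uncurry]
    simp [dotProduct, Fintype.sum_prod_type, Function.uncurry]
  simp only [weightedNorm]
  rw [Real.sq_sqrt (h1 ▸ Finset.sum_nonneg fun i _ => h0 _), h1]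
  exact Finset.sum_congr rfl fun i _ => (Real.sq_sqrt (h0 _)).symm

end Stacked

section StackedHomNorm

variable {n N : ℕ} {Pa G₀ : Matrix (Fin n) (Fin n) ℝ} {μ : ℝ} {E : Type*} [NormedAddCommGroup E]
  [InnerProductSpace ℝ E] [CompleteSpace E] {φ : (Fin n → ℝ) ≃L[ℝ] E} {E' : Type*}
  [NormedAddCommGroup E'] [InnerProductSpace ℝ E'] [CompleteSpace E']
  {φ' : (Fin N × Fin n → ℝ) ≃L[ℝ] E'}

theorem one_kronecker_genD (μ : ℝ) (G₀ : Matrix (Fin n) (Fin n) ℝ) :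
    (1 : Matrix (Fin N) (Fin N) ℝ) ⊗ₖ genD μ G₀
      = μ • ((1 : Matrix (Fin N) (Fin N) ℝ) ⊗ₖ G₀) + 1 := by
  rw [genD, Matrix.kronecker_add, Matrix.kronecker_smul, Matrix.one_kronecker_one]

theorem stackedHomNorm_zero (Gd Pa : Matrix (Fin n) (Fin n) ℝ) :
    stackedHomNorm Gd Pa (0 : Fin N → Fin n → ℝ) = 0 := by
  have h : Function.uncurry (0 : Fin N → Fin n → ℝ) = 0 := rfl
  simp [stackedHomNorm, homNorm, h]

theorem stackedHomNorm_le_one_add_sq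
    (hφ' : ∀ x y, ⟪φ' x, φ' y⟫ = x ⬝ᵥ ((1 : Matrix (Fin N) (Fin N) ℝ) ⊗ₖ Pa) *ᵥ y)
    (hμ' : |μ| * ‖matrixOp φ' ((1 : Matrix (Fin N) (Fin N) ℝ) ⊗ₖ G₀)‖ ≤ 1 / 2)
    (e : Fin N → Fin n → ℝ) :
    stackedHomNorm (genD μ G₀) Pa e
      ≤ 1 + ‖φ' (Function.uncurry e)‖ ^ 2 := by
  have h := (isHomNorm_homNorm hφ' hμ').le_one_add_sq hμ' (φ' (Function.uncurry e))
  rwa [φ'.symm_apply_apply, ← one_kronecker_genD] at h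

omit [CompleteSpace E] in
theorem weightedNorm_stacked_dilation_sq (hPa : Pa.PosDef)
    (hφ : ∀ x y, ⟪φ x, φ y⟫ = x ⬝ᵥ Pa *ᵥ y) (s : ℝ) (e : Fin N → Fin n → ℝ) :
    weightedNorm ((1 : Matrix (Fin N) (Fin N) ℝ) ⊗ₖ Pa)
      (dilation ((1 : Matrix (Fin N) (Fin N) ℝ) ⊗ₖ genD μ G₀) s *ᵥ Function.uncurry e) ^ 2
      = ∑ i, ‖dil (matrixOp φ G₀) μ s (φ (e i))‖ ^ 2 := by
  rw [dilation_one_kronecker, one_kronecker_mulVec_uncurry, weightedNorm_one_kronecker_sq hPa]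
  simp only [weightedNorm_eq_norm hφ, genD, apply_dilation_mulVec]

omit [CompleteSpace E] in
theorem stackedHomNorm_spec (hPa : Pa.PosDef) (hφ : ∀ x y, ⟪φ x, φ y⟫ = x ⬝ᵥ Pa *ᵥ y)
    (hφ' : ∀ x y, ⟪φ' x, φ' y⟫ = x ⬝ᵥ ((1 : Matrix (Fin N) (Fin N) ℝ) ⊗ₖ Pa) *ᵥ y)
    (hμ' : |μ| * ‖matrixOp φ' ((1 : Matrix (Fin N) (Fin N) ℝ) ⊗ₖ G₀)‖ ≤ 1 / 2)
    {e : Fin N → Fin n → ℝ} (he : e ≠ 0) :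
    0 < stackedHomNorm (genD μ G₀) Pa e ∧
      ∑ i, ‖dil (matrixOp φ G₀) μ (-Real.log (stackedHomNorm (genD μ G₀) Pa e)) (φ (e i))‖ ^ 2
        = 1 := by
  have hN := isHomNorm_homNorm hφ' hμ'
  have he' : φ' (Function.uncurry e) ≠ 0 := by
    rw [Ne, EmbeddingLike.map_eq_zero_iff]
    intro h
    exact he (funext fun i => funext fun j => congrFun h (i, j))
  have h1 := hN.pos he'
  have h2 := hN.norm_eq_one he'
  simp only [φ'.symm_apply_apply, ← one_kronecker_genD] at h1 h2
  refine ⟨h1, ?_⟩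
  rw [← weightedNorm_stacked_dilation_sq hPa hφ, stackedHomNorm, weightedNorm_eq_norm hφ',
    one_kronecker_genD, apply_dilation_mulVec, ← one_kronecker_genD, h2, one_pow]

/-- On vectors supported at one node, the stacked homogeneous norm is that of the node. -/
theorem stackedHomNorm_single (hPa : Pa.PosDef) (hφ : ∀ x y, ⟪φ x, φ y⟫ = x ⬝ᵥ Pa *ᵥ y)
    (hμ : |μ| * ‖matrixOp φ G₀‖ ≤ 1 / 2)
    (hφ' : ∀ x y, ⟪φ' x, φ' y⟫ = x ⬝ᵥ ((1 : Matrix (Fin N) (Fin N) ℝ) ⊗ₖ Pa) *ᵥ y)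
    (hμ' : |μ| * ‖matrixOp φ' ((1 : Matrix (Fin N) (Fin N) ℝ) ⊗ₖ G₀)‖ ≤ 1 / 2)
    (i : Fin N) (v : Fin n → ℝ) :
    stackedHomNorm (genD μ G₀) Pa (Pi.single i v) = homNorm (genD μ G₀) Pa v := by
  rcases eq_or_ne v 0 with rfl | hv
  · rw [Pi.single_zero, stackedHomNorm_zero]; simp [homNorm]
  have he : (Pi.single i v : Fin N → Fin n → ℝ) ≠ 0 := by simpa using hv
  obtain ⟨h1, h2⟩ := stackedHomNorm_spec hPa hφ hφ' hμ' he
  rw [Finset.sum_eq_single i (fun j _ hj => by simp [Pi.single_eq_of_ne hj]) (by simp),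
    Pi.single_eq_same, pow_eq_one_iff_of_nonneg (norm_nonneg _) two_ne_zero] at h2
  have h3 := (isHomNorm_homNorm hφ hμ).eq_exp hμ (by simpa using hv : φ v ≠ 0) h2
  rw [φ.symm_apply_apply, Real.exp_log h1] at h3
  exact h3.symm

/-- The condition on the nonlinearity, tested on estimates that are exact at all nodes but one. -/
theorem HolderCondition.norm_dil_le {τ : ℝ} {γ : ℝ → (Fin n → ℝ) → (Fin n → ℝ)}
    (h : HolderCondition N (genD μ G₀) Pa μ τ γ) (hγ : Continuous (Function.uncurry γ))
    (hPa : Pa.PosDef) (hφ : ∀ x y, ⟪φ x, φ y⟫ = x ⬝ᵥ Pa *ᵥ y)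
    (hμ : |μ| * ‖matrixOp φ G₀‖ ≤ 1 / 2)
    (hφ' : ∀ x y, ⟪φ' x, φ' y⟫ = x ⬝ᵥ ((1 : Matrix (Fin N) (Fin N) ℝ) ⊗ₖ Pa) *ᵥ y)
    (hμ' : |μ| * ‖matrixOp φ' ((1 : Matrix (Fin N) (Fin N) ℝ) ⊗ₖ G₀)‖ ≤ 1 / 2)
    (hN : 0 < N) {t : ℝ} (ht : 0 ≤ t) (x v : Fin n → ℝ) :
    ‖dil (matrixOp φ G₀) μ (-Real.log (homNorm (genD μ G₀) Pa v)) (φ (γ t (x + v) - γ t x))‖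
      ≤ τ * homNorm (genD μ G₀) Pa v ^ μ := by
  have hclosed : IsClosed {t | ‖dil (matrixOp φ G₀) μ (-Real.log (homNorm (genD μ G₀) Pa v))
      (φ (γ t (x + v) - γ t x))‖ ≤ τ * homNorm (genD μ G₀) Pa v ^ μ} := by
    have h1 : ∀ y, Continuous fun t => γ t y := fun y =>
      hγ.comp (continuous_id.prodMk continuous_const)
    refine isClosed_le ?_ continuous_const
    exact ((ContinuousLinearMap.continuous _).comp
      (φ.continuous.comp ((h1 _).sub (h1 _)))).norm
  suffices hsub : Ioi (0 : ℝ) ⊆ {t | ‖dil (matrixOp φ G₀) μ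
      (-Real.log (homNorm (genD μ G₀) Pa v)) (φ (γ t (x + v) - γ t x))‖
        ≤ τ * homNorm (genD μ G₀) Pa v ^ μ} by
    have := closure_minimal hsub hclosed
    rw [closure_Ioi] at this
    exact this ht
  intro t ht
  let i : Fin N := ⟨0, hN⟩
  have h1 := h t ht (fun j => x + (Pi.single i v : Fin N → Fin n → ℝ) j) x
  simp only [add_sub_cancel_left] at h1
  change weightedNorm _ (dilation _ (-Real.log (stackedHomNorm _ _ (Pi.single i v))) *ᵥ _)
    ≤ τ * stackedHomNorm _ _ (Pi.single i v) ^ μ at h1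
  rw [stackedHomNorm_single hPa hφ hμ hφ' hμ'] at h1
  refine le_trans (le_of_eq ?_) h1
  refine (pow_left_inj₀ (norm_nonneg _) (Real.sqrt_nonneg _) two_ne_zero).1 ?_
  refine Eq.trans ?_ (weightedNorm_stacked_dilation_sq hPa hφ _ _).symm
  rw [Finset.sum_eq_single i (fun j _ hj => by simp [Pi.single_eq_of_ne hj]) (by simp),
    Pi.single_eq_same]

end StackedHomNorm

/-! ### The error system of the network of observers -/

section ErrorSystemOfObserver

variable {n m N : ℕ} {p : Fin N → ℕ} {E : Type*} [NormedAddCommGroup E] [InnerProductSpace ℝ E]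
  (φ : (Fin n → ℝ) ≃L[ℝ] E)

/-- The error system of the network of observers, in the coordinates `φ`. -/
noncomputable def observerErrorSystem (A G₀ : Matrix (Fin n) (Fin n) ℝ)
    (C : ∀ i, Matrix (Fin (p i)) (Fin n) ℝ) (H : ∀ i, Matrix (Fin n) (Fin (p i)) ℝ)
    (G : Digraph (Fin N)) (hA : A * G₀ - G₀ * A = A) (hC : ∀ i, C i * G₀ = 0) :
    ErrorSystem (Fin N) E fun i => EuclideanSpace ℝ (Fin (p i)) where
  A := matrixOp φ A
  G₀ := matrixOp φ G₀
  C i := (EuclideanSpace.equiv (Fin (p i)) ℝ).symm.toContinuousLinearMap ∘L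
    (LinearMap.toContinuousLinearMap (C i).mulVecLin) ∘L φ.symm.toContinuousLinearMap
  H i := φ.toContinuousLinearMap ∘L (LinearMap.toContinuousLinearMap (H i).mulVecLin) ∘L
    (EuclideanSpace.equiv (Fin (p i)) ℝ).toContinuousLinearMap
  a := adj G
  comm := by rw [← map_mul, ← map_mul, ← map_sub, hA]
  output i := by
    ext x j
    simp [matrixOp_apply, Matrix.mulVec_mulVec, hC]

variable {φ} {A G₀ Pa : Matrix (Fin n) (Fin n) ℝ} {B : Matrix (Fin n) (Fin m) ℝ}
  {C : ∀ i, Matrix (Fin (p i)) (Fin n) ℝ} {H : ∀ i, Matrix (Fin n) (Fin (p i)) ℝ}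
  {G : Digraph (Fin N)} (hA : A * G₀ - G₀ * A = A) (hC : ∀ i, C i * G₀ = 0)

theorem observerErrorSystem_C_apply (i : Fin N) (x : Fin n → ℝ) :
    (observerErrorSystem φ A G₀ C H G hA hC).C i (φ x) = WithLp.toLp 2 (C i *ᵥ x) := by
  simp [observerErrorSystem]

theorem observerErrorSystem_H_apply (i : Fin N) (ω : Fin (p i) → ℝ) :
    (observerErrorSystem φ A G₀ C H G hA hC).H i (WithLp.toLp 2 ω) = φ (H i *ᵥ ω) := rfl

/-- The difference of the observer and the plant is the error field plus the difference of the
nonlinearities. -/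
theorem apply_observerField_sub_plantField (μ ν : ℝ) (γ : ℝ → (Fin n → ℝ) → (Fin n → ℝ))
    (u : ℝ → Fin m → ℝ) (x : ℝ → Fin n → ℝ) (t : ℝ) (xh : Fin N → Fin n → ℝ) (i : Fin N) :
    φ (observerField A B C G G₀ Pa H μ ν γ u x t xh i - plantField A B u γ t (x t))
      = (observerErrorSystem φ A G₀ C H G hA hC).field μ ν
          (fun w => homNorm (genD μ G₀) Pa (φ.symm w)) (fun i => φ (xh i - x t)) i
        + φ (γ t (xh i) - γ t (x t)) := by
  have hθ : (observerErrorSystem φ A G₀ C H G hA hC).disagreement (fun i => φ (xh i - x t)) i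
      = φ (∑ j, adj G i j • (xh j - xh i)) := by
    simp [ErrorSystem.disagreement, observerErrorSystem]
  have hω : (observerErrorSystem φ A G₀ C H G hA hC).C i (φ (xh i - x t))
      = WithLp.toLp 2 (C i *ᵥ xh i - C i *ᵥ x t) := by
    rw [observerErrorSystem_C_apply, Matrix.mulVec_sub]
  have hexp : ∀ r : ℝ, ∀ ω : Fin (p i) → ℝ, φ (outputScaling μ G₀ r *ᵥ (H i *ᵥ ω))
      = NormedSpace.exp ((μ * Real.log r) • ((observerErrorSystem φ A G₀ C H G hA hC).G₀ + 1))
        ((observerErrorSystem φ A G₀ C H G hA hC).H i (WithLp.toLp 2 ω)) := fun r ω => by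
    have h1 := observerErrorSystem_H_apply (φ := φ) (H := H) (G := G) hA hC i ω
    have h2 : (observerErrorSystem φ A G₀ C H G hA hC).G₀ = matrixOp φ G₀ := rfl
    rw [h1, h2, ← map_one (matrixOp φ), ← map_add, ← map_smul, ← map_matrix_exp,
      matrixOp_apply_apply, outputScaling]
  have hAx : (observerErrorSystem φ A G₀ C H G hA hC).A (φ (xh i - x t))
      = φ (A *ᵥ (xh i - x t)) := matrixOp_apply_apply _ _ _
  rw [ErrorSystem.field, hθ, hω, ← hexp, hAx, φ.symm_apply_apply, ← map_smul, ← map_add, ← map_add,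
    ← map_add]
  congr 1
  simp only [observerField, plantField, Matrix.mulVec_sub]
  abel

/-- The left null vector of the Laplacian of a strongly connected graph is positive. -/
theorem isBalancing_of_laplacian {ζ : Fin N → ℝ} (hloop : ∀ i, ¬ G.Adj i i)
    (hconn : StronglyConnected G) (hζ : ζ ᵥ* laplacian G = 0) (hζ_sum : ∑ i, ζ i = 1) :
    ErrorSystem.IsBalancing (adj G) ζ := by
  have hadj0 : ∀ i j, 0 ≤ adj G i j := fun i j => by unfold adj; split_ifs <;> simp
  have hadj1 : ∀ {i j}, G.Adj i j → 0 < adj G i j := fun h => by simp [adj, h]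
  have hdiag : ∀ i, adj G i i = 0 := fun i => by simp [adj, hloop]
  have hbal : ∀ j, ∑ i, ζ i * adj G i j = ζ j * ∑ k, adj G j k := by
    intro j
    have h1 := congrFun hζ j
    simp only [Matrix.vecMul, dotProduct, laplacian, Matrix.of_apply, Pi.zero_apply] at h1
    have h2 : ∀ i, ζ i * (if i = j then ∑ k, adj G i k else -adj G i j)
        = (if i = j then ζ i * ∑ k, adj G i k else 0) - ζ i * adj G i j := by
      intro i
      split_ifs with h
      · rw [h, hdiag]; ring
      · ring
    simp only [h2, Finset.sum_sub_distrib, Finset.sum_ite_eq', Finset.mem_univ, if_true] at h1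
    linarith
  -- a nonnegative left null vector with a zero entry vanishes along all paths into that node
  have hprop : ∀ η : Fin N → ℝ, (∀ i, 0 ≤ η i) →
      (∀ j, ∑ i, η i * adj G i j = η j * ∑ k, adj G j k) → ∀ j, η j = 0 → ∀ i, η i = 0 := by
    intro η hη hηb j hj i
    refine Relation.ReflTransGen.head_induction_on (hconn i j) hj ?_
    intro i k hik _ hk
    have h1 := hηb k
    rw [hk, zero_mul, Finset.sum_eq_zero_iff_of_nonneg
      fun i _ => mul_nonneg (hη i) (hadj0 i k)] at h1
    exact (mul_eq_zero.1 (h1 i (Finset.mem_univ i))).resolve_right (hadj1 hik).ne'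
  have habs_le : ∀ j, |ζ j| * ∑ k, adj G j k ≤ ∑ i, |ζ i| * adj G i j := fun j => by
    have h0 : 0 ≤ ∑ k, adj G j k := Finset.sum_nonneg fun k _ => hadj0 j k
    calc |ζ j| * ∑ k, adj G j k = |∑ i, ζ i * adj G i j| := by
          rw [hbal, abs_mul, abs_of_nonneg h0]
      _ ≤ ∑ i, |ζ i * adj G i j| := Finset.abs_sum_le_sum_abs _ _
      _ = _ := Finset.sum_congr rfl fun i _ => by rw [abs_mul, abs_of_nonneg (hadj0 i j)]
  -- both sides have the same sum over `j`, so the entrywise absolute value is a null vector too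
  have habs : ∀ j, ∑ i, |ζ i| * adj G i j = |ζ j| * ∑ k, adj G j k := by
    have hsum : ∑ j, |ζ j| * ∑ k, adj G j k = ∑ j, ∑ i, |ζ i| * adj G i j := by
      rw [Finset.sum_comm]
      exact Finset.sum_congr rfl fun j _ => Finset.mul_sum _ _ _
    intro j
    exact (((Finset.sum_eq_sum_iff_of_le fun j _ => habs_le j).1 hsum) j (Finset.mem_univ j)).symm
  have hpos : ∃ j, 0 < ζ j := by
    by_contra! h
    linarith [Finset.sum_nonpos fun i (_ : i ∈ Finset.univ) => h i]
  obtain ⟨j₀, hj₀⟩ := hpos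
  have hnonneg : ∀ i, 0 ≤ ζ i := fun i => by
    have h1 := hprop (fun i => |ζ i| - ζ i) (fun i => sub_nonneg.2 (le_abs_self _))
      (fun j => by simp only [sub_mul, Finset.sum_sub_distrib, habs, hbal]) j₀
      (by simp [abs_of_pos hj₀]) i
    linarith [abs_nonneg (ζ i)]
  refine ⟨hadj0, fun i => (hnonneg i).lt_of_ne fun h => ?_, hζ_sum, hbal, fun i j =>
    Relation.ReflTransGen.mono (fun _ _ h => hadj1 h) i j (hconn i j)⟩
  have := hprop ζ hnonneg hbal i h.symm
  simp [this] at hζ_sum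

/-- Where all nodes agree, the matrix inequality governs the weighted sum of the closed-loop
drifts. -/
theorem sum_inner_closedLoop_le {ζ : Fin N → ℝ} (hζ : ∀ i, 0 < ζ i) (hζ_sum : ∑ i, ζ i = 1)
    {Y : Matrix (Fin n) (Σ i, Fin (p i)) ℝ} {ρ μ : ℝ} (hρ : 0 < ρ)
    (hφ : ∀ x y, ⟪φ x, φ y⟫ = x ⬝ᵥ Pa *ᵥ y) (hμ : |μ| * ‖matrixOp φ G₀‖ ≤ 1 / 4)
    (h : HomogeneousLMI A (stack C) (genD μ G₀) ρ Pa Y) (v : E) :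
    ∑ i, ζ i * ⟪v, (observerErrorSystem φ A G₀ C (gain Pa Y ζ) G hA hC).A v
      + (observerErrorSystem φ A G₀ C (gain Pa Y ζ) G hA hC).H i
        ((observerErrorSystem φ A G₀ C (gain Pa Y ζ) G hA hC).C i v)⟫
      ≤ -(3 / 4 * ρ) * ‖v‖ ^ 2 := by
  obtain ⟨x, rfl⟩ := φ.surjective v
  have hPa := h.posDef
  have hunit : IsUnit Pa.det := (Matrix.isUnit_iff_isUnit_det _).1 hPa.isUnit
  have hsymm : Paᵀ = Pa := by
    simpa [Matrix.conjTranspose_eq_transpose_of_trivial] using hPa.isHermitian.eq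
  have hterm : ∀ i, ζ i * ⟪φ x, (observerErrorSystem φ A G₀ C (gain Pa Y ζ) G hA hC).A (φ x)
      + (observerErrorSystem φ A G₀ C (gain Pa Y ζ) G hA hC).H i
        ((observerErrorSystem φ A G₀ C (gain Pa Y ζ) G hA hC).C i (φ x))⟫
      = ζ i * (x ⬝ᵥ (Pa * A) *ᵥ x)
        + x ⬝ᵥ Pa *ᵥ (ζ i • (gain Pa Y ζ i *ᵥ (C i *ᵥ x))) := by
    intro i
    have h1 : (observerErrorSystem φ A G₀ C (gain Pa Y ζ) G hA hC).A (φ x) = φ (A *ᵥ x) :=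
      matrixOp_apply_apply _ _ _
    rw [h1, observerErrorSystem_C_apply, observerErrorSystem_H_apply, inner_add_right, hφ,
      hφ, Matrix.mulVec_mulVec, Matrix.mulVec_smul, dotProduct_smul, smul_eq_mul]
    ring
  have hgain : ∑ i, ζ i • (gain Pa Y ζ i *ᵥ (C i *ᵥ x)) = (Pa⁻¹ * Y) *ᵥ (stack C *ᵥ x) := by
    ext a
    simp only [Finset.sum_apply, gain, Matrix.smul_mulVec, smul_smul,
      mul_inv_cancel₀ (hζ _).ne', one_smul]
    simp only [Matrix.mulVec, dotProduct, Matrix.of_apply, stack]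
    rw [Fintype.sum_sigma]
  have hsum : ∑ i, ζ i * ⟪φ x, (observerErrorSystem φ A G₀ C (gain Pa Y ζ) G hA hC).A (φ x)
      + (observerErrorSystem φ A G₀ C (gain Pa Y ζ) G hA hC).H i
        ((observerErrorSystem φ A G₀ C (gain Pa Y ζ) G hA hC).C i (φ x))⟫
      = x ⬝ᵥ (Pa * A) *ᵥ x + x ⬝ᵥ (Y * stack C) *ᵥ x := by
    simp only [hterm]
    rw [Finset.sum_add_distrib, ← Finset.sum_mul, hζ_sum, one_mul, ← dotProduct_sum,
      ← Matrix.mulVec_sum, hgain, Matrix.mulVec_mulVec, Matrix.mulVec_mulVec, ← Matrix.mul_assoc,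
      Matrix.mul_nonsing_inv _ hunit, Matrix.one_mul]
  have htr : ∀ M : Matrix (Fin n) (Fin n) ℝ, x ⬝ᵥ Mᵀ *ᵥ x = x ⬝ᵥ M *ᵥ x := fun M => by
    rw [Matrix.mulVec_transpose, dotProduct_comm, Matrix.dotProduct_mulVec]
  have hLMI : 0 ≤ x ⬝ᵥ (-(Pa * A + Aᵀ * Pa + Y * stack C + (stack C)ᵀ * Yᵀ
      + ρ • (Pa * genD μ G₀ + (genD μ G₀)ᵀ * Pa))) *ᵥ x := by
    simpa using h.stable.posSemidef.dotProduct_mulVec_nonneg x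
  rw [show Aᵀ * Pa = (Pa * A)ᵀ by rw [Matrix.transpose_mul, hsymm],
    show (genD μ G₀)ᵀ * Pa = (Pa * genD μ G₀)ᵀ by rw [Matrix.transpose_mul, hsymm],
    ← Matrix.transpose_mul] at hLMI
  simp only [Matrix.neg_mulVec, Matrix.add_mulVec, Matrix.smul_mulVec, dotProduct_neg,
    dotProduct_add, dotProduct_smul, htr, smul_eq_mul] at hLMI
  have hG : x ⬝ᵥ (Pa * genD μ G₀) *ᵥ x = ⟪φ x, matrixOp φ G₀ (φ x)⟫ * μ + ‖φ x‖ ^ 2 := by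
    rw [matrixOp_apply_apply, ← real_inner_self_eq_norm_sq, hφ, hφ, genD, ← Matrix.mulVec_mulVec,
      Matrix.add_mulVec, Matrix.smul_mulVec, Matrix.one_mulVec, Matrix.mulVec_add,
      Matrix.mulVec_smul, dotProduct_add, dotProduct_smul, smul_eq_mul, mul_comm]
  have hb : |⟪φ x, matrixOp φ G₀ (φ x)⟫ * μ| ≤ 1 / 4 * ‖φ x‖ ^ 2 := by
    rw [abs_mul]
    calc |⟪φ x, matrixOp φ G₀ (φ x)⟫| * |μ| ≤ ‖φ x‖ * (‖matrixOp φ G₀‖ * ‖φ x‖) * |μ| := by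
          gcongr
          exact (abs_real_inner_le_norm _ _).trans
            (by gcongr; exact ContinuousLinearMap.le_opNorm _ _)
      _ = |μ| * ‖matrixOp φ G₀‖ * ‖φ x‖ ^ 2 := by ring
      _ ≤ 1 / 4 * ‖φ x‖ ^ 2 := by gcongr
  rw [hsum]
  rw [hG] at hLMI
  have hb' := (abs_le.1 hb).1
  nlinarith

end ErrorSystemOfObserver

/-! ### Operations on solutions -/

section Solutions

variable {V W : Type*} [NormedAddCommGroup V] [NormedSpace ℝ V] [NormedAddCommGroup W]
  [NormedSpace ℝ W] {t₀ : ℝ} {I : Set ℝ}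

theorem IsSolutionOn.mono {F : ℝ → V → V} {x : ℝ → V} (hx : IsSolutionOn F t₀ I x) {J : Set ℝ}
    (hJ : J ⊆ I) : IsSolutionOn F t₀ J x :=
  ⟨hx.1.mono hJ, fun t ht => hx.2 t (hJ ht)⟩

theorem IsSolutionOn.add {F G K : ℝ → V → V} {x y : ℝ → V} (hx : IsSolutionOn F t₀ I x)
    (hy : IsSolutionOn G t₀ I y) (h : ∀ t, K t (x t + y t) = F t (x t) + G t (y t)) :
    IsSolutionOn K t₀ I fun t => x t + y t := by
  refine ⟨hx.1.add hy.1, fun t ht => ?_⟩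
  simp only [h]
  refine ⟨(hx.2 t ht).1.add (hy.2 t ht).1, ?_⟩
  rw [intervalIntegral.integral_add (hx.2 t ht).1 (hy.2 t ht).1]
  nth_rw 1 [(hx.2 t ht).2, (hy.2 t ht).2]
  abel

theorem IsSolutionOn.sub {F G K : ℝ → V → V} {x y : ℝ → V} (hx : IsSolutionOn F t₀ I x)
    (hy : IsSolutionOn G t₀ I y) (h : ∀ t, K t (x t - y t) = F t (x t) - G t (y t)) :
    IsSolutionOn K t₀ I fun t => x t - y t := by
  refine ⟨hx.1.sub hy.1, fun t ht => ?_⟩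
  simp only [h]
  refine ⟨(hx.2 t ht).1.sub (hy.2 t ht).1, ?_⟩
  rw [intervalIntegral.integral_sub (hx.2 t ht).1 (hy.2 t ht).1]
  nth_rw 1 [(hx.2 t ht).2, (hy.2 t ht).2]
  abel

theorem IsSolutionOn.clm [CompleteSpace V] [CompleteSpace W] {F : ℝ → V → V} {K : ℝ → W → W}
    {x : ℝ → V} (hx : IsSolutionOn F t₀ I x) (L : V →L[ℝ] W)
    (h : ∀ t, K t (L (x t)) = L (F t (x t))) : IsSolutionOn K t₀ I fun t => L (x t) := by
  refine ⟨L.continuous.comp_continuousOn hx.1, fun t ht => ?_⟩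
  simp only [h]
  refine ⟨⟨L.integrable_comp (hx.2 t ht).1.1, L.integrable_comp (hx.2 t ht).1.2⟩, ?_⟩
  rw [L.intervalIntegral_comp_comm (hx.2 t ht).1]
  nth_rw 1 [(hx.2 t ht).2]
  rw [map_add]

/-- A solution on an interval along which the field is integrable can be continued up to any time
up to which solutions of all initial value problems exist. -/
theorem exists_extension [CompleteSpace V] {F : ℝ → V → V} {a c : ℝ} {J : Set ℝ}
    (hJ : IsTimeInterval a J) (hJc : J ⊆ Icc a c) {e : ℝ → V} (he : IsSolutionOn F a J e)
    (hint : IntegrableOn (fun s => F s (e s)) J)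
    (hex : ∀ b ∈ Icc a c, ∀ v, ∃ y : ℝ → V, y b = v ∧
      IntervalIntegrable (fun s => F s (y s)) volume b c ∧
      ∀ t ∈ Icc b c, y t = v + ∫ s in b..t, F s (y s)) :
    ∃ e' : ℝ → V, IsSolutionOn F a (Icc a c) e' ∧ EqOn e' e J := by
  classical
  have haJ : a ∈ J := hJ.1.1
  have hbdd : BddAbove J := ⟨c, fun t ht => (hJc ht).2⟩
  set b := sSup J with hb
  have hab : a ≤ b := le_csSup hbdd haJ
  have hbc : b ≤ c := csSup_le ⟨a, haJ⟩ fun t ht => (hJc ht).2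
  have hsub : ∀ t, a ≤ t → t < b → t ∈ J := fun t hat htb => by
    obtain ⟨r, hr, htr⟩ := exists_lt_of_lt_csSup ⟨a, haJ⟩ htb
    exact hJ.2.out haJ hr ⟨hat, htr.le⟩
  have hJb : ∀ t ∈ J, t ≤ b := fun t ht => le_csSup hbdd ht
  obtain ⟨y, -, hyint, hy⟩ := hex b ⟨hab, hbc⟩ (e a + ∫ s in a..b, F s (e s))
  set e' : ℝ → V := fun t => if t ∈ J then e t else y t with he'
  have heJ : EqOn e' e J := fun t ht => if_pos ht
  have heb : ∀ t, b < t → e' t = y t := fun t ht => if_neg fun h => (hJb t h).not_gt ht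
  have hint1 : IntervalIntegrable (fun s => F s (e' s)) volume a b := by
    rw [intervalIntegrable_iff_integrableOn_Ioo_of_le hab]
    refine (hint.mono_set fun t ht => hsub t ht.1.le ht.2).congr_fun (fun t ht => ?_)
      measurableSet_Ioo
    simp only [heJ (hsub t ht.1.le ht.2)]
  have hint2 : IntervalIntegrable (fun s => F s (e' s)) volume b c := by
    rw [intervalIntegrable_iff_integrableOn_Ioc_of_le hbc] at hyint ⊢
    refine hyint.congr_fun (fun t ht => ?_) measurableSet_Ioc
    simp only [heb t ht.1]
  have hint3 := hint1.trans hint2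
  have hval : ∀ t ∈ Icc a c, e' t = e a + ∫ s in a..t, F s (e' s) := by
    intro t ht
    by_cases htJ : t ∈ J
    · rw [heJ htJ, (he.2 t htJ).2]
      congr 1
      refine intervalIntegral.integral_congr fun s hs => ?_
      rw [uIcc_of_le ht.1] at hs
      simp only [heJ (hJ.2.out haJ htJ hs)]
    · have hbt : b ≤ t := by
        by_contra! h
        exact htJ (hsub t ht.1 h)
      have h1 : ∫ s in a..b, F s (e' s) = ∫ s in a..b, F s (e s) := by
        rw [intervalIntegral.integral_of_le hab, intervalIntegral.integral_of_le hab,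
          integral_Ioc_eq_integral_Ioo, integral_Ioc_eq_integral_Ioo]
        refine setIntegral_congr_fun measurableSet_Ioo fun s hs => ?_
        simp only [heJ (hsub s hs.1.le hs.2)]
      have h2 : ∫ s in b..t, F s (e' s) = ∫ s in b..t, F s (y s) := by
        rw [intervalIntegral.integral_of_le hbt, intervalIntegral.integral_of_le hbt]
        refine setIntegral_congr_fun measurableSet_Ioc fun s hs => ?_
        simp only [heb s hs.1]
      have h3 : IntervalIntegrable (fun s => F s (e' s)) volume b t :=
        hint2.mono_set (by rw [uIcc_of_le hbt, uIcc_of_le hbc]; exact Icc_subset_Icc_right ht.2)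
      rw [← intervalIntegral.integral_add_adjacent_intervals hint1 h3, h1, h2, ← add_assoc,
        ← hy t ⟨hbt, ht.2⟩]
      exact if_neg htJ
  refine ⟨e', ⟨?_, fun t ht => ⟨?_, ?_⟩⟩, heJ⟩
  · have hac := hab.trans hbc
    have h1 := intervalIntegral.continuousOn_primitive_interval' hint3 left_mem_uIcc
    rw [uIcc_of_le hac] at h1
    exact (continuousOn_const.add h1).congr hval
  · exact hint3.mono_set (by
      rw [uIcc_of_le ht.1, uIcc_of_le (hab.trans hbc)]; exact Icc_subset_Icc_right ht.2)
  · rw [hval t ht, heJ haJ]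

end Solutions

/-! ### The error trajectories -/

section Trajectories

variable {n m N : ℕ} {p : Fin N → ℕ} {E : Type*} [NormedAddCommGroup E] [InnerProductSpace ℝ E]
  {A G₀ Pa : Matrix (Fin n) (Fin n) ℝ} {B : Matrix (Fin n) (Fin m) ℝ}
  {C : ∀ i, Matrix (Fin (p i)) (Fin n) ℝ} {H : ∀ i, Matrix (Fin n) (Fin (p i)) ℝ}
  {G : Digraph (Fin N)} {φ : (Fin n → ℝ) ≃L[ℝ] E} {S : ErrorSystem (Fin N) E fun i =>
    EuclideanSpace ℝ (Fin (p i))} {Nm : E → ℝ} {μ ν : ℝ} {γ : ℝ → (Fin n → ℝ) → (Fin n → ℝ)}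

/-- The differences of the nonlinearity that act on the error, along the plant trajectory `x`. -/
def nonlinearError (N : ℕ) (φ : (Fin n → ℝ) ≃L[ℝ] E) (γ : ℝ → (Fin n → ℝ) → (Fin n → ℝ))
    (x : ℝ → Fin n → ℝ) (t : ℝ) (w : Fin N → E) (i : Fin N) : E :=
  φ (γ t (x t + φ.symm (w i)) - γ t (x t))

theorem continuousOn_nonlinearError (hγ : Continuous (Function.uncurry γ)) {x : ℝ → Fin n → ℝ}
    {I : Set ℝ} (hx : ContinuousOn x I) :
    ContinuousOn (Function.uncurry (nonlinearError N φ γ x)) (I ×ˢ univ) := by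
  have hx' : ContinuousOn (fun q : ℝ × (Fin N → E) => x q.1) (I ×ˢ univ) :=
    hx.comp continuousOn_fst fun q hq => hq.1
  have hw : ∀ i, Continuous fun q : ℝ × (Fin N → E) => φ.symm (q.2 i) := fun i => by fun_prop
  refine continuousOn_pi.2 fun i => φ.continuous.comp_continuousOn ?_
  exact (hγ.comp_continuousOn (continuousOn_fst.prodMk (hx'.add (hw i).continuousOn))).sub
    (hγ.comp_continuousOn (continuousOn_fst.prodMk hx'))

/-- The estimation errors at all nodes, in the coordinates `φ`. -/
noncomputable def errorCoord (N : ℕ) (φ : (Fin n → ℝ) ≃L[ℝ] E) :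
    (Fin N → Fin n → ℝ) ≃L[ℝ] (Fin N → E) :=
  ContinuousLinearEquiv.piCongrRight fun _ => φ

@[simp] theorem errorCoord_apply (e : Fin N → Fin n → ℝ) (i : Fin N) :
    errorCoord N φ e i = φ (e i) := rfl

/-- The copies of one vector at all nodes. -/
def replicate (n N : ℕ) : (Fin n → ℝ) →L[ℝ] (Fin N → Fin n → ℝ) :=
  ContinuousLinearMap.pi fun _ => ContinuousLinearMap.id ℝ _

@[simp] theorem replicate_apply (x : Fin n → ℝ) (i : Fin N) : replicate n N x i = x := rfl

/-- In the coordinates `φ`, the error of the observers `obs` has the velocity `f`, plus the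
differences of the nonlinearity `γ`. -/
def Represents (A : Matrix (Fin n) (Fin n) ℝ) (B : Matrix (Fin n) (Fin m) ℝ)
    (φ : (Fin n → ℝ) ≃L[ℝ] E) (f : (Fin N → E) → Fin N → E)
    (γ : ℝ → (Fin n → ℝ) → (Fin n → ℝ))
    (obs : (ℝ → Fin m → ℝ) → (ℝ → Fin n → ℝ) → ℝ → (Fin N → Fin n → ℝ) → (Fin N → Fin n → ℝ)) :
    Prop :=
  ∀ u x t xh, errorCoord N φ (obs u x t xh - replicate n N (plantField A B u γ t (x t)))
    = f (errorCoord N φ (xh - replicate n N (x t)))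
      + nonlinearError N φ γ x t (errorCoord N φ (xh - replicate n N (x t)))

variable [FiniteDimensional ℝ E] {f : (Fin N → E) → Fin N → E}
  {obs : (ℝ → Fin m → ℝ) → (ℝ → Fin n → ℝ) → ℝ → (Fin N → Fin n → ℝ) → (Fin N → Fin n → ℝ)}
  {u : ℝ → Fin m → ℝ} {x : ℝ → Fin n → ℝ} {t₀ : ℝ} {I : Set ℝ}

theorem Represents.isSolutionOn_error (h : Represents A B φ f γ obs)
    (hx : IsSolutionOn (plantField A B u γ) t₀ I x) {xh : ℝ → Fin N → Fin n → ℝ}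
    (hxh : IsSolutionOn (obs u x) t₀ I xh) :
    IsSolutionOn (fun t w => f w + nonlinearError N φ γ x t w) t₀ I
      fun t => errorCoord N φ (xh t - replicate n N (x t)) := by
  have : CompleteSpace E := FiniteDimensional.complete ℝ E
  have h1 : IsSolutionOn (fun t _ => replicate n N (plantField A B u γ t (x t))) t₀ I
      fun t => replicate n N (x t) := hx.clm (replicate n N) fun t => rfl
  have h2 := hxh.sub h1
    (K := fun t _ => obs u x t (xh t) - replicate n N (plantField A B u γ t (x t))) fun t => rfl
  exact h2.clm (errorCoord N φ).toContinuousLinearMap fun t => (h u x t (xh t)).symm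

theorem Represents.isSolutionOn_observer (h : Represents A B φ f γ obs)
    (hx : IsSolutionOn (plantField A B u γ) t₀ I x) {w : ℝ → Fin N → E}
    (hw : IsSolutionOn (fun t w => f w + nonlinearError N φ γ x t w) t₀ I w) :
    IsSolutionOn (obs u x) t₀ I fun t => replicate n N (x t) + (errorCoord N φ).symm (w t) := by
  have : CompleteSpace E := FiniteDimensional.complete ℝ E
  have h1 : IsSolutionOn (fun t _ => replicate n N (plantField A B u γ t (x t))) t₀ I
      fun t => replicate n N (x t) := hx.clm (replicate n N) fun t => rfl
  have h2 : IsSolutionOn (fun t _ => (errorCoord N φ).symm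
      (f (w t) + nonlinearError N φ γ x t (w t))) t₀ I fun t => (errorCoord N φ).symm (w t) :=
    hw.clm (errorCoord N φ).symm.toContinuousLinearMap fun t => rfl
  refine h1.add h2 fun t => ?_
  have h3 := h u x t (replicate n N (x t) + (errorCoord N φ).symm (w t))
  rw [add_sub_cancel_left, ContinuousLinearEquiv.apply_symm_apply] at h3
  rw [← h3, ContinuousLinearEquiv.symm_apply_apply, add_sub_cancel]

variable {ζ : Fin N → ℝ} {τ c : ℝ}

omit [FiniteDimensional ℝ E] in
/-- The error equation, in the sense of right derivatives. -/
theorem isErrorPath_of_isSolutionOn [CompleteSpace E] (h : S.IsDecaying ζ μ ν τ c Nm)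
    (hγ : Continuous (Function.uncurry γ)) (hγτ : ∀ t ≥ 0, ∀ (x : Fin n → ℝ) (w : E),
      ‖dil S.G₀ μ (-Real.log (Nm w)) (φ (γ t (x + φ.symm w) - γ t x))‖ ≤ τ * Nm w ^ μ)
    (ht₀ : 0 ≤ t₀) (hI : IsTimeInterval t₀ I) (hx : ContinuousOn x I) {w : ℝ → Fin N → E}
    (hw : IsSolutionOn (fun t w => S.field μ ν Nm w + nonlinearError N φ γ x t w) t₀ I w)
    {t : ℝ} (ht : t ∈ I) : S.IsErrorPath μ ν τ Nm t₀ t w := by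
  have hsub : Icc t₀ t ⊆ I := hI.2.out hI.1.1 ht
  refine ⟨hw.1.mono hsub, fun s => S.field μ ν Nm (w s) + nonlinearError N φ γ x s (w s),
    fun s hs => ⟨?_, fun i => ?_⟩⟩
  · refine hasDerivWithinAt_of_eq_integral ?_ (fun r hr => (hw.2 r (hsub hr)).2) hs
    refine ((S.continuous_field h.homNorm h.small).comp_continuousOn (hw.1.mono hsub)).add ?_
    exact (continuousOn_nonlinearError hγ hx).comp (continuousOn_id.prodMk (hw.1.mono hsub))
      fun r hr => ⟨hsub hr, mem_univ _⟩
  · simp only [Pi.add_apply, add_sub_cancel_left]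
    exact hγτ s (ht₀.trans hs.1) _ _

theorem errorForwardComplete (h : S.IsDecaying ζ μ ν τ c Nm)
    (hγ : Continuous (Function.uncurry γ)) (hγτ : ∀ t ≥ 0, ∀ (x : Fin n → ℝ) (w : E),
      ‖dil S.G₀ μ (-Real.log (Nm w)) (φ (γ t (x + φ.symm w) - γ t x))‖ ≤ τ * Nm w ^ μ)
    (hobs : Represents A B φ (S.field μ ν Nm) γ obs) :
    ErrorForwardComplete (fun u => plantField A B u γ) obs := by
  intro u x t₀ t₁ ht₀ h01 hx J xh hJ hJI hxh
  have : CompleteSpace E := FiniteDimensional.complete ℝ E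
  have : ProperSpace (Fin N → E) := FiniteDimensional.proper ℝ _
  set w : ℝ → Fin N → E := fun t => errorCoord N φ (xh t - replicate n N (x t))
  have hwsol := hobs.isSolutionOn_error (hx.mono hJ) hxh
  have hΓ := continuousOn_nonlinearError (N := N) (φ := φ) hγ hx.1
  have hF : ContinuousOn (fun q : ℝ × (Fin N → E) =>
      S.field μ ν Nm q.2 + nonlinearError N φ γ x q.1 q.2) (Icc t₀ t₁ ×ˢ univ) :=
    ((S.continuous_field h.homNorm h.small).comp continuous_snd).continuousOn.add hΓ
  -- the trajectory stays in a sublevel set of the Lyapunov function, where the field is bounded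
  obtain ⟨s₀, hs₀⟩ := h.exists_scaledEnergy_le_one (w t₀)
  obtain ⟨R, -, hR⟩ := h.exists_norm_le s₀
  have hwR : ∀ t ∈ J, ‖w t‖ ≤ R := fun t ht =>
    hR _ (h.scaledEnergy_le_one_of_const (isErrorPath_of_isSolutionOn h hγ hγτ ht₀ hJI
      (hx.1.mono hJ) hwsol ht) hs₀ ⟨hJI.1.2 ht, le_rfl⟩)
  obtain ⟨M, hM⟩ := ((isCompact_Icc (a := t₀) (b := t₁)).prod
    (isCompact_closedBall (0 : Fin N → E) R)).exists_bound_of_continuousOn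
      (hF.mono (prod_mono_right (subset_univ _)))
  have hint : IntegrableOn
      (fun s => S.field μ ν Nm (w s) + nonlinearError N φ γ x s (w s)) J := by
    have hmeas : MeasurableSet J := hJI.2.measurableSet
    have hcont : ContinuousOn
        (fun s => S.field μ ν Nm (w s) + nonlinearError N φ γ x s (w s)) J :=
      hF.comp (continuousOn_id.prodMk hwsol.1) fun t ht => ⟨hJ ht, mem_univ _⟩
    have : IsFiniteMeasure (volume.restrict J) :=
      ⟨by rw [Measure.restrict_apply_univ]; exact (measure_mono hJ).trans_lt measure_Icc_lt_top⟩
    refine Integrable.of_bound (hcont.aestronglyMeasurable hmeas) M ?_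
    refine (ae_restrict_iff' hmeas).2 (Eventually.of_forall fun t ht => ?_)
    exact hM (t, w t) ⟨hJ ht, by simpa using hwR t ht⟩
  obtain ⟨w', hw', heq⟩ := exists_extension
    (F := fun t w => S.field μ ν Nm w + nonlinearError N φ γ x t w) hJI hJ hwsol hint
    fun b hb v => by
      have hsub : Icc b t₁ ⊆ Icc t₀ t₁ := Icc_subset_Icc_left hb.1
      obtain ⟨y, hyc, hyb, hy⟩ := h.exists_solution hb.2 (hΓ.mono (prod_mono_left hsub))
        (fun t ht w i => hγτ t (ht₀.trans (hb.1.trans ht.1)) _ _) v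
      refine ⟨y, hyb, ContinuousOn.intervalIntegrable ?_, hy⟩
      rw [uIcc_of_le hb.2]
      exact hF.comp (continuousOn_id.prodMk hyc) fun t ht => ⟨hsub ht, mem_univ _⟩
  refine ⟨_, hobs.isSolutionOn_observer hx hw', fun t ht => ?_⟩
  simp only [heq ht, ContinuousLinearEquiv.symm_apply_apply, add_sub_cancel]

/-- The error trajectories, in the coordinates `φ`, satisfy the error equation. -/
theorem IsErrorTrajectory.exists_isErrorPath (h : S.IsDecaying ζ μ ν τ c Nm)
    (hγ : Continuous (Function.uncurry γ)) (hγτ : ∀ t ≥ 0, ∀ (x : Fin n → ℝ) (w : E),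
      ‖dil S.G₀ μ (-Real.log (Nm w)) (φ (γ t (x + φ.symm w) - γ t x))‖ ≤ τ * Nm w ^ μ)
    (hobs : Represents A B φ (S.field μ ν Nm) γ obs) (ht₀ : 0 ≤ t₀) {e : ℝ → Fin N → Fin n → ℝ}
    (he : IsErrorTrajectory (fun u => plantField A B u γ) obs t₀ I e) :
    ∃ w : ℝ → Fin N → E, ∀ t ∈ I, w t = errorCoord N φ (e t) ∧ S.IsErrorPath μ ν τ Nm t₀ t w := by
  have : CompleteSpace E := FiniteDimensional.complete ℝ E
  obtain ⟨hI, u, x, xh, hx, hxh, hex⟩ := he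
  refine ⟨fun t => errorCoord N φ (xh t - replicate n N (x t)), fun t ht => ⟨?_, ?_⟩⟩
  · funext i
    exact congrArg φ (hex t ht i).symm
  · exact isErrorPath_of_isSolutionOn h hγ hγτ ht₀ hI hx.1 (hobs.isSolutionOn_error hx hxh) ht

section Stability

variable (h : S.IsDecaying ζ μ ν τ c Nm)
  {Tr : ℝ → Set ℝ → (ℝ → Fin N → Fin n → ℝ) → Prop}
  (hTr : ∀ t₀ ≥ 0, ∀ I e, Tr t₀ I e → t₀ ∈ I ∧ (∀ t ∈ I, t₀ ≤ t) ∧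
    ∃ w : ℝ → Fin N → E, ∀ t ∈ I, w t = errorCoord N φ (e t) ∧ S.IsErrorPath μ ν τ Nm t₀ t w)

include h

theorem exists_forall_norm_lt_of_scaledEnergy_le {ε : ℝ} (hε : 0 < ε) :
    ∃ s, ∀ e : Fin N → Fin n → ℝ, S.scaledEnergy ζ μ s (errorCoord N φ e) ≤ 1 → ‖e‖ < ε := by
  have : CompleteSpace E := FiniteDimensional.complete ℝ E
  have hc : ContinuousAt (errorCoord N φ).symm 0 := (errorCoord N φ).symm.continuous.continuousAt
  obtain ⟨δ, hδ, hδ'⟩ := Metric.continuousAt_iff.1 hc ε hε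
  obtain ⟨s, hs⟩ := h.exists_forall_norm_lt hδ
  refine ⟨s, fun e he => ?_⟩
  simpa using hδ' (x := errorCoord N φ e) (by simpa using hs _ he)

include hTr

theorem lyapunovStable_of_isErrorPath : LyapunovStable Tr := by
  have : CompleteSpace E := FiniteDimensional.complete ℝ E
  intro ε hε
  obtain ⟨s, hs⟩ := exists_forall_norm_lt_of_scaledEnergy_le (φ := φ) h hε
  obtain ⟨δ, hδ, hδs⟩ := S.exists_forall_scaledEnergy_le_one ζ μ s
  obtain ⟨δ', hδ', hδδ⟩ := Metric.continuousAt_iff.1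
    ((errorCoord N φ).continuous.continuousAt (x := 0)) δ hδ
  refine ⟨δ', hδ', fun t₀ ht₀ I e he he0 t ht => hs _ ?_⟩
  obtain ⟨h0I, hIt, w, hw⟩ := hTr t₀ ht₀ I e he
  rw [← (hw t ht).1]
  refine h.scaledEnergy_le_one_of_const (hw t ht).2 (hδs _ ?_) ⟨hIt t ht, le_rfl⟩
  rw [(hw t₀ h0I).1]
  simpa using hδδ (x := e t₀) (by simpa using he0)

theorem eq_zero_of_isErrorPath_of_eq_zero {t₀ : ℝ} (ht₀ : 0 ≤ t₀) {I : Set ℝ}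
    {e : ℝ → Fin N → Fin n → ℝ} (he : Tr t₀ I e) (h0 : e t₀ = 0) {t : ℝ} (ht : t ∈ I) :
    e t = 0 := by
  have : CompleteSpace E := FiniteDimensional.complete ℝ E
  obtain ⟨h0I, hIt, w, hw⟩ := hTr t₀ ht₀ I e he
  rw [← norm_le_zero_iff]
  refine le_of_forall_pos_lt_add fun ε hε => ?_
  rw [zero_add]
  obtain ⟨s, hs⟩ := exists_forall_norm_lt_of_scaledEnergy_le (φ := φ) h hε
  refine hs _ ?_
  rw [← (hw t ht).1]
  refine h.scaledEnergy_le_one_of_const (hw t ht).2 ?_ ⟨hIt t ht, le_rfl⟩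
  rw [(hw t₀ h0I).1, h0]
  simp [ErrorSystem.scaledEnergy, ErrorSystem.energy]

/-- For `μ < 0` the Lyapunov function reaches zero in finite time. -/
theorem eq_zero_of_isErrorPath (hμ : μ < 0) {t₀ : ℝ} (ht₀ : 0 ≤ t₀) {I : Set ℝ}
    {e : ℝ → Fin N → Fin n → ℝ} (he : Tr t₀ I e) {s₀ t : ℝ}
    (hs₀ : S.scaledEnergy ζ μ s₀ (errorCoord N φ (e t₀)) ≤ 1) (ht : t ∈ I)
    (htT : t₀ + Real.exp (-(μ * s₀)) / (-(μ * c)) ≤ t) : e t = 0 := by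
  have : CompleteSpace E := FiniteDimensional.complete ℝ E
  obtain ⟨h0I, hIt, w, hw⟩ := hTr t₀ ht₀ I e he
  rw [← norm_le_zero_iff]
  refine le_of_forall_pos_lt_add fun ε hε => ?_
  rw [zero_add]
  obtain ⟨s, hs⟩ := exists_forall_norm_lt_of_scaledEnergy_le (φ := φ) h hε
  refine hs _ ((h.scaledEnergy_anti (min_le_left s s₀) _).trans ?_)
  rw [← (hw t₀ h0I).1] at hs₀
  rw [← (hw t ht).1]
  refine h.scaledEnergy_le_one_of_le (hw t ht).2 hs₀ (min_le_right _ _) (le_trans ?_ htT)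
  have hμc : 0 < -(μ * c) := neg_pos.2 (mul_neg_of_neg_of_pos hμ h.rate_pos)
  rw [← neg_div_neg_eq]
  gcongr
  linarith [Real.exp_pos (-(μ * min s s₀))]

/-- For `μ > 0` the Lyapunov function reaches any positive level in a time that does not depend on
its initial value. -/
theorem nearlyFixedTimeAttractive_of_isErrorPath (hμ : 0 < μ) : NearlyFixedTimeAttractive Tr := by
  have : CompleteSpace E := FiniteDimensional.complete ℝ E
  intro r hr
  obtain ⟨s, hs⟩ := exists_forall_norm_lt_of_scaledEnergy_le (φ := φ) h hr
  have hμc : 0 < μ * c := mul_pos hμ h.rate_pos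
  refine ⟨Real.exp (-(μ * s)) / (μ * c), by positivity, fun t₀ ht₀ I e he t ht htT => hs _ ?_⟩
  obtain ⟨h0I, hIt, w, hw⟩ := hTr t₀ ht₀ I e he
  obtain ⟨s₀, hs₀⟩ := h.exists_scaledEnergy_le_one (w t₀)
  rw [← (hw t ht).1]
  refine h.scaledEnergy_le_one_of_le (s₀ := max s s₀) (hw t ht).2
    ((h.scaledEnergy_anti (le_max_right _ _) _).trans hs₀) (le_max_left _ _) (le_trans ?_ htT)
  gcongr
  linarith [Real.exp_pos (-(μ * max s s₀))]

end Stability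

end Trajectories

/-! ### The settling time -/

section SettlingTime

variable {n N : ℕ} {Pa G₀ : Matrix (Fin n) (Fin n) ℝ} {μ : ℝ} {E : Type*} [NormedAddCommGroup E]
  [InnerProductSpace ℝ E] {φ : (Fin n → ℝ) ≃L[ℝ] E} {E' : Type*}
  [NormedAddCommGroup E'] [InnerProductSpace ℝ E'] [CompleteSpace E']
  {φ' : (Fin N × Fin n → ℝ) ≃L[ℝ] E'}

theorem eventually_const_mul_stackedHomNorm_rpow_le
    (hφ' : ∀ x y, ⟪φ' x, φ' y⟫ = x ⬝ᵥ ((1 : Matrix (Fin N) (Fin N) ℝ) ⊗ₖ Pa) *ᵥ y)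
    (hμ' : |μ| * ‖matrixOp φ' ((1 : Matrix (Fin N) (Fin N) ℝ) ⊗ₖ G₀)‖ ≤ 1 / 2) {K r : ℝ}
    (hK : 0 ≤ K) (hr : 0 ≤ r) (hnonneg : ∀ e : Fin N → Fin n → ℝ,
      0 ≤ stackedHomNorm (genD μ G₀) Pa e) (e₀ : Fin N → Fin n → ℝ) :
    ∃ M, ∀ᶠ e in 𝓝 e₀, K * stackedHomNorm (genD μ G₀) Pa e ^ r ≤ M := by
  have hu : Continuous fun e : Fin N → Fin n → ℝ => Function.uncurry e :=
    continuous_pi fun q => (continuous_apply q.2).comp (continuous_apply q.1)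
  have hc : Continuous fun e : Fin N → Fin n → ℝ =>
      K * (1 + ‖φ' (Function.uncurry e)‖ ^ 2) ^ r :=
    continuous_const.mul ((continuous_const.add
      ((φ'.continuous.comp hu).norm.pow 2)).rpow_const fun _ => Or.inr hr)
  refine ⟨K * (1 + ‖φ' (Function.uncurry e₀)‖ ^ 2) ^ r + 1, ?_⟩
  filter_upwards [hc.continuousAt.eventually_lt_const (lt_add_one _)] with e he
  refine le_trans ?_ he.le
  exact mul_le_mul_of_nonneg_left
    (Real.rpow_le_rpow (hnonneg e) (stackedHomNorm_le_one_add_sq hφ' hμ' e) hr) hK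

theorem stackedHomNorm_nonneg (hPa : Pa.PosDef) (hφ : ∀ x y, ⟪φ x, φ y⟫ = x ⬝ᵥ Pa *ᵥ y)
    (hφ' : ∀ x y, ⟪φ' x, φ' y⟫ = x ⬝ᵥ ((1 : Matrix (Fin N) (Fin N) ℝ) ⊗ₖ Pa) *ᵥ y)
    (hμ' : |μ| * ‖matrixOp φ' ((1 : Matrix (Fin N) (Fin N) ℝ) ⊗ₖ G₀)‖ ≤ 1 / 2)
    (e : Fin N → Fin n → ℝ) : 0 ≤ stackedHomNorm (genD μ G₀) Pa e := by
  rcases eq_or_ne e 0 with rfl | he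
  · exact (stackedHomNorm_zero _ _).ge
  · exact (stackedHomNorm_spec hPa hφ hφ' hμ' he).1.le

/-- Since the weights are at most `1`, the Lyapunov function is dominated by the stacked homogeneous
norm. -/
theorem scaledEnergy_log_stackedHomNorm_le {F : Fin N → Type*} [∀ i, NormedAddCommGroup (F i)]
    [∀ i, NormedSpace ℝ (F i)] {S : ErrorSystem (Fin N) E F} (hS : S.G₀ = matrixOp φ G₀)
    {ζ : Fin N → ℝ} (hζ : ErrorSystem.IsBalancing S.a ζ)
    (hPa : Pa.PosDef) (hφ : ∀ x y, ⟪φ x, φ y⟫ = x ⬝ᵥ Pa *ᵥ y)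
    (hφ' : ∀ x y, ⟪φ' x, φ' y⟫ = x ⬝ᵥ ((1 : Matrix (Fin N) (Fin N) ℝ) ⊗ₖ Pa) *ᵥ y)
    (hμ' : |μ| * ‖matrixOp φ' ((1 : Matrix (Fin N) (Fin N) ℝ) ⊗ₖ G₀)‖ ≤ 1 / 2)
    {e : Fin N → Fin n → ℝ} (he : e ≠ 0) :
    S.scaledEnergy ζ μ (Real.log (stackedHomNorm (genD μ G₀) Pa e)) (errorCoord N φ e) ≤ 1 := by
  rw [← (stackedHomNorm_spec hPa hφ hφ' hμ' he).2]
  unfold ErrorSystem.scaledEnergy ErrorSystem.energy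
  refine Finset.sum_le_sum fun i _ => ?_
  have h1 : ζ i ≤ 1 := by
    rw [← hζ.sum_eq_one]
    exact Finset.single_le_sum (fun j _ => (hζ.pos j).le) (Finset.mem_univ i)
  rw [hS]
  exact mul_le_of_le_one_left (sq_nonneg _) h1

end SettlingTime

theorem eq_zero_of_gainL₀_eq_zero {n : ℕ} {ι : Type*} {Y₀ : Matrix (Fin n) ι ℝ}
    {G₀ : Matrix (Fin n) (Fin n) ℝ} (hG₀ : IsUnit (1 + G₀)) (h : gainL₀ Y₀ G₀ = 0) : Y₀ = 0 := by
  have h1 := congrArg (fun M => (1 + G₀) * M) h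
  simp only [gainL₀, ← Matrix.mul_assoc] at h1
  rwa [Matrix.mul_nonsing_inv _ ((Matrix.isUnit_iff_isUnit_det _).1 hG₀), Matrix.one_mul,
    Matrix.mul_zero] at h1

end DistObs

open DistObs in
theorem mainTheorem1 {n m N : ℕ} (hn : 0 < n) (hN : 0 < N) {p : Fin N → ℕ}
    (A : Matrix (Fin n) (Fin n) ℝ) (B : Matrix (Fin n) (Fin m) ℝ)
    (C : ∀ i, Matrix (Fin (p i)) (Fin n) ℝ)
    (hobs : IsObservable A (stack C))
    (Y₀ : Matrix (Fin n) (Σ i, Fin (p i)) ℝ) (G₀ : Matrix (Fin n) (Fin n) ℝ)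
    (hG₀ : SolvesGeneratorEq A (stack C) Y₀ G₀) (hL₀ : gainL₀ Y₀ G₀ = 0)
    (G : Digraph (Fin N)) (hloop : ∀ i, ¬ G.Adj i i) (hconn : StronglyConnected G)
    (ζ : Fin N → ℝ) (hζ : ζ ᵥ* laplacian G = 0) (hζ_sum : ∑ i, ζ i = 1)
    (Δ : Matrix (Fin (N - 1)) (Fin (N - 1)) ℝ)
    (hΔ : (laplacian G).charpoly = Polynomial.X * Δ.charpoly)
    (ρ : ℝ) (hρ : 0 < ρ)
    (Pa : Matrix (Fin n) (Fin n) ℝ) (Y : Matrix (Fin n) (Σ i, Fin (p i)) ℝ)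
    (hPa : Pa.PosDef) (hΔPa : ((Δᵀ + Δ) ⊗ₖ Pa).PosDef) :
    ∃ ν₀ > 0, ∀ ν ≥ ν₀, ∃ μ₀ > 0, ∀ μ : ℝ,
      -(1 / (obsIndex A (stack C) : ℝ)) < μ → |μ| < μ₀ →
      HomogeneousLMI A (stack C) (genD μ G₀) ρ Pa Y →
      ∀ (τ : ℝ) (γ : ℝ → (Fin n → ℝ) → (Fin n → ℝ)), 0 < τ → τ < ρ / 3 →
        Continuous (Function.uncurry γ) →
        HolderCondition N (genD μ G₀) Pa μ τ γ →
        (μ < 0 →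
          FiniteTimeStable (fun u => plantField A B u γ)
            (fun u x => observerField A B C G G₀ Pa (gain Pa Y ζ) μ ν γ u x)
            (fun e₀ => 3 / (μ * (3 * τ - ρ)) * stackedHomNorm (genD μ G₀) Pa e₀ ^ (-μ))) ∧
        (0 < μ →
          NearlyFixedTimeStable (fun u => plantField A B u γ)
            (fun u x => observerField A B C G G₀ Pa (gain Pa Y ζ) μ ν γ u x)) := by
  obtain ⟨φ, hφ⟩ := exists_coordinates hPa
  obtain ⟨φ', hφ'⟩ := exists_coordinates
    ((Matrix.PosDef.one (n := Fin N) (R := ℝ)).kronecker hPa)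
  have hY₀ := eq_zero_of_gainL₀_eq_zero hG₀.isUnit hL₀
  have hA : A * G₀ - G₀ * A = A := by
    have h1 := hG₀.eq_A
    rw [hY₀, Matrix.zero_mul, add_zero] at h1
    rw [← neg_sub, h1, neg_neg]
  have hC : ∀ i, C i * G₀ = 0 := fun i => by
    ext a b
    exact congrFun (congrFun hG₀.eq_C ⟨i, a⟩) b
  set S := observerErrorSystem φ A G₀ C (gain Pa Y ζ) G hA hC with hS
  have hbal : ErrorSystem.IsBalancing S.a ζ := isBalancing_of_laplacian hloop hconn hζ hζ_sum
  have : Nonempty (Fin N) := ⟨⟨0, hN⟩⟩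
  set κ := ‖matrixOp φ G₀‖ with hκ
  have hκ0 : 0 ≤ κ := norm_nonneg _
  by_cases hQ : ∀ v, ∑ i, ζ i * inner ℝ v (S.A v + S.H i (S.C i v)) ≤ -(3 / 4 * ρ) * ‖v‖ ^ 2
  swap
  · -- the matrix inequalities, which give the rate `ρ` up to a term of order `|μ|`, then fail for
    -- all small `μ`
    refine ⟨1, one_pos, fun ν _ => ⟨1 / (4 * (κ + 1)), by positivity, fun μ _ hμ hLMI => ?_⟩⟩
    rw [lt_div_iff₀ (by positivity)] at hμ
    exact absurd (sum_inner_closedLoop_le hA hC hbal.pos hζ_sum hρ hφ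
      (by nlinarith [abs_nonneg μ]) hLMI) hQ
  obtain ⟨ν₀, hν₀, hdecay⟩ := ErrorSystem.exists_forall_sum_inner_field_lt hbal hρ hQ
  refine ⟨ν₀, hν₀, fun ν hν => ?_⟩
  obtain ⟨μ₁, hμ₁, hdecay⟩ := hdecay ν hν
  set κ' := ‖matrixOp φ' ((1 : Matrix (Fin N) (Fin N) ℝ) ⊗ₖ G₀)‖ with hκ'
  have hκ'0 : 0 ≤ κ' := norm_nonneg _
  refine ⟨min μ₁ (min (1 / (4 * (κ + 1))) (1 / (2 * (κ' + 1)))), by positivity,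
    fun μ _ hμ _ τ γ hτ hτρ hγ hHolder => ?_⟩
  have hμ1 : |μ| < μ₁ := hμ.trans_le (min_le_left _ _)
  have hμ2 : |μ| * (κ + 1) ≤ 1 / 4 := by
    have := hμ.trans_le ((min_le_right _ _).trans (min_le_left _ _))
    rw [lt_div_iff₀ (by positivity)] at this
    linarith
  have hμκ : |μ| * κ ≤ 1 / 2 := by nlinarith [abs_nonneg μ]
  have hμ3 : |μ| * κ' ≤ 1 / 2 := by
    have := hμ.trans_le ((min_le_right _ _).trans (min_le_right _ _))
    rw [lt_div_iff₀ (by positivity)] at this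
    nlinarith [abs_nonneg μ]
  set Nm : EuclideanSpace ℝ (Fin n) → ℝ := fun w => homNorm (genD μ G₀) Pa (φ.symm w) with hNm
  have hNm : IsHomNorm S.G₀ μ Nm := isHomNorm_homNorm hφ hμκ
  have hγτ : ∀ t ≥ 0, ∀ (x : Fin n → ℝ) (w : EuclideanSpace ℝ (Fin n)),
      ‖dil S.G₀ μ (-Real.log (Nm w)) (φ (γ t (x + φ.symm w) - γ t x))‖ ≤ τ * Nm w ^ μ :=
    fun t ht x w => hHolder.norm_dil_le hγ hPa hφ hμκ hφ' hμ3 hN ht x (φ.symm w)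
  have hdec : μ ≠ 0 → S.IsDecaying ζ μ ν τ (ρ / 3 - τ) Nm := fun hμ0 =>
    ⟨hNm, hμ0, hμ2, hbal.pos, by linarith, hdecay μ hμ0 hμ1 Nm hNm τ hτ.le hτρ⟩
  have hrep : Represents A B φ (S.field μ ν Nm) γ
      (fun u x => observerField A B C G G₀ Pa (gain Pa Y ζ) μ ν γ u x) := by
    intro u x t xh
    funext i
    have h1 := apply_observerField_sub_plantField (φ := φ) (B := B) (Pa := Pa)
      (H := gain Pa Y ζ) (G := G) hA hC μ ν γ u x t xh i
    refine h1.trans ?_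
    simp only [Pi.add_apply, nonlinearError, errorCoord_apply, Pi.sub_apply, replicate_apply,
      φ.symm_apply_apply, add_sub_cancel]
    rfl
  have hpath : μ ≠ 0 → ∀ t₀ ≥ 0, ∀ I e, IsErrorTrajectory (fun u => plantField A B u γ)
      (fun u x => observerField A B C G G₀ Pa (gain Pa Y ζ) μ ν γ u x) t₀ I e →
      t₀ ∈ I ∧ (∀ t ∈ I, t₀ ≤ t) ∧ ∃ w : ℝ → Fin N → EuclideanSpace ℝ (Fin n), ∀ t ∈ I,
        w t = errorCoord N φ (e t) ∧ S.IsErrorPath μ ν τ Nm t₀ t w := fun hμ0 t₀ ht₀ I e he =>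
    ⟨he.1.1.1, fun t ht => he.1.1.2 ht, he.exists_isErrorPath (hdec hμ0) hγ hγτ hrep ht₀⟩
  refine ⟨fun hμneg => ⟨errorForwardComplete (hdec hμneg.ne) hγ hγτ hrep,
    lyapunovStable_of_isErrorPath (hdec hμneg.ne) (hpath hμneg.ne), _, ⟨fun e₀ => ?_, fun e₀ => ?_,
      fun t₀ ht₀ I e he t ht htT => ?_⟩, fun e₀ => le_rfl⟩,
    fun hμpos => ⟨errorForwardComplete (hdec hμpos.ne') hγ hγτ hrep,
      lyapunovStable_of_isErrorPath (hdec hμpos.ne') (hpath hμpos.ne'),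
      nearlyFixedTimeAttractive_of_isErrorPath (hdec hμpos.ne') (hpath hμpos.ne') hμpos⟩⟩
  · have hK : 0 < μ * (3 * τ - ρ) := mul_pos_of_neg_of_neg hμneg (by linarith)
    have := stackedHomNorm_nonneg hPa hφ hφ' hμ3 e₀
    positivity
  · have hK : 0 < μ * (3 * τ - ρ) := mul_pos_of_neg_of_neg hμneg (by linarith)
    exact eventually_const_mul_stackedHomNorm_rpow_le hφ' hμ3 (by positivity)
      (by linarith) (stackedHomNorm_nonneg hPa hφ hφ' hμ3) e₀
  · have hc : 0 < ρ / 3 - τ := by linarith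
    rcases eq_or_ne (e t₀) 0 with h0 | h0
    · exact eq_zero_of_isErrorPath_of_eq_zero (hdec hμneg.ne) (hpath hμneg.ne) ht₀ he h0 ht
    · refine eq_zero_of_isErrorPath (hdec hμneg.ne) (hpath hμneg.ne) hμneg ht₀ he
        (scaledEnergy_log_stackedHomNorm_le rfl hbal hPa hφ hφ' hμ3 h0) ht
        (le_of_eq_of_le ?_ htT)
      rw [Real.rpow_def_of_pos (stackedHomNorm_spec hPa hφ hφ' hμ3 h0).1]
      have e1 : -(μ * (ρ / 3 - τ)) = μ * (3 * τ - ρ) / 3 := by ring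
      rw [e1, div_div_eq_mul_div, mul_comm (Real.log _), neg_mul]
      ring
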